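/- Let $A$ be a discrete valuation ring with fraction field $K$, maximal ideal $\mathfrak p_A$, and residue field of characteristic $p>0$ (possibly imperfect). A complete residual perfection of $A$ is a flat $A$-algebra $C$ that is complete and separated with respect to $\mathfrak p_AC$ and for which the $\mathbf F_p$-algebra $\overline C = C/\mathfrak p_AC$ is perfect, i.e. $x\mapsto x^p$ is bijective on $\overline C$; these form a full subcategory of the category of $A$-algebras. The universal residual perfection $A^{\mathrm u}$ is the initial object of this category, and the generic residual perfection $A^{\mathrm g}$ is the complete residual perfection of $A$ for which the map $\overline{A^{\mathrm u}}\to\overline{A^{\mathrm g}}$, induced by the unique $A$-algebra map $A^{\mathrm u}\to A^{\mathrm g}$, exhibits $\overline{A^{\mathrm g}}$ as the fraction field of $\overline{A^{\mathrm u}}$. (Both are unique up to unique isomorphism.) Let $B$ be a discrete valuation ring and $A\to B$ an injective local homomorphism that makes $B$ a finite $A$-module and for which the fraction field $L$ of $B$ is a separable extension of $K$. Then $B$ is generated as an $A$-algebra by one element if and only if $B\otimes_A A^{\mathrm g}$ is a discrete valuation ring. In that case $A^{\mathrm g}\to B\otimes_A A^{\mathrm g}$ is an extension of discrete valuation rings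 (an injective local homomorphism between discrete valuation rings), and its separable residue degree (the separable degree of the extension of residue fields) is equal to that of $A\to B$. -/

import Mathlib

open IsLocalRing TensorProduct

universe u v

/-- The extension `𝔭_B = 𝔭_A B` to an `A`-algebra `B` of the maximal ideal of the local ring `A`. -/
abbrev extIdeal (A : Type u) [CommRing A] [IsLocalRing A] (B : Type v) [CommRing B] [Algebra A B] :
    Ideal B :=
  (maximalIdeal A).map (algebraMap A B)

/-- The map `B ⧸ 𝔭_B → C ⧸ 𝔭_C` induced by a map of `A`-algebras `B → C`. -/
def redMap {A : Type u} [CommRing A] [IsLocalRing A] {B : Type v} [CommRing B] [Algebra A B]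
    {C : Type v} [CommRing C] [Algebra A C] (f : B →ₐ[A] C) :
    B ⧸ extIdeal A B →+* C ⧸ extIdeal A C :=
  Ideal.quotientMap (extIdeal A C) f.toRingHom <| by
    rw [← Ideal.map_le_iff_le_comap, extIdeal, Ideal.map_map, AlgHom.toRingHom_eq_coe,
      f.comp_algebraMap]

/-- `B` is a complete residual perfection of `A` (where `A` has residue characteristic `p`):
`B` is flat over `A`, complete (and separated) with respect to `𝔭_A B`, and the
`𝔽_p`-algebra `B ⧸ 𝔭_A B` is perfect, i.e. its Frobenius endomorphism is bijective. -/
structure IsCompleteResidualPerfection (p : ℕ) (A : Type u) [CommRing A] [IsLocalRing A]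
    (B : Type v) [CommRing B] [Algebra A B] : Prop where
  flat : Module.Flat A B
  complete : IsAdicComplete (extIdeal A B) B
  perfect : Function.Bijective (fun x : B ⧸ extIdeal A B => x ^ p)

/-- `U` is the universal residual perfection `A^u` of `A`: it is an initial object in the category
of complete residual perfections of `A` (a full subcategory of the category of `A`-algebras). -/
structure IsUniversalResidualPerfection (p : ℕ) (A : Type u) [CommRing A] [IsLocalRing A]
    (U : Type u) [CommRing U] [Algebra A U] : Prop where
  isCompleteResidualPerfection : IsCompleteResidualPerfection p A U
  initial : ∀ (C : Type u) [CommRing C] [Algebra A C], IsCompleteResidualPerfection p A C →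
    ∃! _f : U →ₐ[A] C, True

/-- `G` is the generic residual perfection `A^g` of `A`: it is the complete residual perfection
of `A` whose reduction, as an algebra over the reduction of the universal residual perfection
`A^u`, is the fraction field of the reduction of `A^u`. -/
def IsGenericResidualPerfection (p : ℕ) (A : Type u) [CommRing A] [IsLocalRing A]
    (G : Type u) [CommRing G] [Algebra A G] : Prop :=
  IsCompleteResidualPerfection p A G ∧
    ∃ (U : Type u) (_ : CommRing U) (_ : Algebra A U),
      IsUniversalResidualPerfection p A U ∧
        ∃ φ : U →ₐ[A] G,
          letI : Algebra (U ⧸ extIdeal A U) (G ⧸ extIdeal A G) := (redMap φ).toAlgebra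
          IsFractionRing (U ⧸ extIdeal A U) (G ⧸ extIdeal A G)

/-- The commutative ring `R` is a discrete valuation ring (in particular a domain). -/
def IsDVR (R : Type u) [CommRing R] : Prop :=
  ∃ _ : IsDomain R, IsDiscreteValuationRing R

theorem IsDVR.isLocalRing {R : Type u} [CommRing R] (h : IsDVR R) : IsLocalRing R := by
  obtain ⟨_, _⟩ := h
  infer_instance

/-- `φ : R → S` is an extension of discrete valuation rings: an injective local homomorphism
between discrete valuation rings. -/
structure IsDVRExtension {R : Type u} {S : Type v} [CommRing R] [CommRing S] (φ : R →+* S) :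
    Prop where
  source : IsDVR R
  target : IsDVR S
  injective : Function.Injective φ
  isLocalHom : IsLocalHom φ

/-- The separable residue degree of an extension of discrete valuation rings: the separable degree
of the residue field extension. -/
noncomputable def sepResidueDegree {R : Type u} {S : Type v} [CommRing R] [CommRing S]
    (φ : R →+* S) (h : IsDVRExtension φ) : ℕ :=
  haveI : IsLocalRing R := h.source.isLocalRing
  haveI : IsLocalRing S := h.target.isLocalRing
  haveI : IsLocalHom φ := h.isLocalHom
  letI : Algebra (ResidueField R) (ResidueField S) := (ResidueField.map φ).toAlgebra
  Field.finSepDegree (ResidueField R) (ResidueField S)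

/-- `B` is generated as an `A`-algebra by a single element. -/
def IsMonogenic (A : Type u) (B : Type v) [CommRing A] [CommRing B] [Algebra A B] : Prop :=
  ∃ x : B, Algebra.adjoin A {x} = ⊤

/-! Write `k` for the residue field of `A`, `t` for a uniformizer, `G` for the generic residual
perfection and `R = B ⊗ G`. Two properties of `G` carry the forward direction. Elements of the
residue field of `G` that are algebraic over `k` are purely inseparable
(`IsGenericResidualPerfection.exists_pow_mem_range`). And if `f` over `A` is monic with inseparable
irreducible reduction, then `f = T ^ p + t H` over `G` with `H` coprime to `f` modulo `t`
(`IsGenericResidualPerfection.exists_isCoprime`).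

Both come from an explicit model. In a complete residual perfection every element expands in powers
of `t` with digits that have compatible `p`-power roots. Adjoining to `A` indeterminate remainders
`W` for the expansions of lifts of a `p`-basis of `k`, together with all `p`-power roots of the
digits, and completing, gives an algebra `C` that maps to every complete residual perfection with
nonzero reduction (`exists_versal_complete`). Its reduction is perfect and radicial over `k[W]`. The
universal residual perfection is a retract of `C`, so the residue field of `G` embeds into an
algebraically closed field `F` in which the `W` are algebraically independent over `k`. For the
coprimality, a coefficient of `f` whose reduction is not a `p`-th power is made one of the lifts.
Then `H` becomes `H₀ + w H₁` modulo `t`, where `w` is the first remainder of that lift, `H₁` is a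
nonzero polynomial over `k` of degree below that of `f`, and `H₀` is algebraic over the other
remainders. A common root with `f` would make `w` algebraic over them.

Suppose `B = A[x]`. The minimal polynomial of `x` over the residue field of `G` and that of `x` over
`k` divide each other up to powers. Hence `R` is local, the separable residue degrees agree, and the
maximal ideal is `(t, S(x))` for a lift `S` of the former polynomial. It remains to see that `t`
lies in its square or generates it (`mem_sq_or_maximalIdeal_eq`). This is clear if `t` does not
generate the maximal ideal of `B`. Otherwise `f(x) ∈ (t ^ 2)` for some lift `f` of the minimal
polynomial over `k`: a separable reduction gives `S(x) ∈ (t)`, an inseparable one makes `t` a unit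
times `T(x) ^ p`.

Conversely, if `R` is a discrete valuation ring, it is monogenic over `G`, whose residue field is
perfect. Being a generator is the nonvanishing of a determinant with coefficients in `A`, so a
generator of `B` exists when `k` is infinite. A finite `k` is perfect and needs no base change. -/

open MvPolynomial in
/-- A family `x` in a field of characteristic `p` is `p`-independent if the twisted evaluation
`∑ cₐ Xᵃ ↦ ∑ cₐ ^ p xᵃ` has no relations besides those generated by `Xᵢ ^ p = xᵢ`. -/
def PIndep (p : ℕ) {k : Type u} [Field k] [ExpChar k p] {ι : Type v} (x : ι → k) : Prop :=
  RingHom.ker (eval₂Hom (frobenius k p) x) ≤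
    Ideal.span (Set.range fun i => (X i ^ p - C (x i) : MvPolynomial ι k))

/-! ### Existence of `p`-bases. -/

section PBasis

open MvPolynomial

variable {p : ℕ} [Fact p.Prime] {k : Type u} [Field k] [CharP k p]

theorem PIndep.reindex {ι κ : Type*} {x : ι → k} (hx : PIndep p x) (e : κ ≃ ι) :
    PIndep p (x ∘ e) := by
  intro P hP
  have h1 : rename e P ∈ RingHom.ker (eval₂Hom (frobenius k p) x) := by
    rw [RingHom.mem_ker] at hP ⊢
    simpa [eval₂_rename] using hP
  have h2 := Ideal.mem_map_of_mem (rename (R := k) e.symm).toRingHom (hx h1)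
  rw [Ideal.map_span] at h2
  have h3 : (rename (R := k) e.symm).toRingHom (rename e P) = P := by
    simp [rename_rename]
  rw [h3] at h2
  refine Ideal.span_mono ?_ h2
  rintro _ ⟨_, ⟨i, rfl⟩, rfl⟩
  exact ⟨e.symm i, by simp⟩

variable (p) in
/-- The subfield of values of the twisted evaluation at a family `x`, that is `k ^ p (x)`. -/
noncomputable def twistedRange {ι : Type*} (x : ι → k) : Subfield k where
  toSubring := (eval₂Hom (frobenius k p) x).range
  inv_mem' := by
    rintro y ⟨P, hP⟩
    -- The inverse of `y` is `y ^ (p - 1) * (y⁻¹) ^ p`, and the second factor is the value of a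
    -- constant.
    refine ⟨P ^ (p - 1) * C y⁻¹, ?_⟩
    rcases eq_or_ne y 0 with rfl | hy
    · simp
    · rw [map_mul, map_pow, hP]
      have hp : p = (p - 1) + 1 := by have := (Fact.out : p.Prime).pos; omega
      simp only [coe_eval₂Hom, eval₂_C, frobenius_def]
      nth_rewrite 2 [hp]
      rw [pow_succ, ← mul_assoc, ← mul_pow, mul_inv_cancel₀ hy, one_pow, one_mul]

theorem pow_mem_twistedRange {ι : Type*} (x : ι → k) (a : k) : a ^ p ∈ twistedRange p x :=
  ⟨C a, by simp [frobenius_def]⟩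

/-- The polynomial `X ^ p - a ^ p` is irreducible over the subfield: a `p`-th root of `a ^ p` there
would equal `a`, Frobenius being injective. -/
theorem minpoly_twistedRange {ι : Type*} {x : ι → k} {a : k} (ha : a ∉ twistedRange p x) :
    (minpoly (twistedRange p x) a).natDegree = p := by
  have hirr : Irreducible (Polynomial.X ^ p - Polynomial.C
      (⟨a ^ p, pow_mem_twistedRange x a⟩ : twistedRange p x)) := by
    refine X_pow_sub_C_irreducible_of_prime (Fact.out : p.Prime) fun b hb => ha ?_
    have : (b : k) = a := by
      have := congrArg Subtype.val hb
      exact frobenius_inj k p (by simpa [frobenius_def] using this)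
    exact this ▸ b.2
  have := minpoly.eq_of_irreducible_of_monic hirr (x := a)
    (by
      simp only [map_sub, map_pow, Polynomial.aeval_X, Polynomial.aeval_C]
      exact sub_self _)
    (Polynomial.monic_X_pow_sub_C _ (Fact.out : p.Prime).ne_zero)
  rw [← this, Polynomial.natDegree_X_pow_sub_C]

/-- A relation is read as a polynomial in the new variable and divided by `X ^ p - a`. The remainder
has degree below `p`, the degree of `a` over the old subfield, so its coefficients are relations
between the old elements. -/
theorem PIndep.option {ι : Type*} {x : ι → k} (hx : PIndep p x) {a : k}
    (ha : a ∉ twistedRange p x) : PIndep p (fun o : Option ι => o.elim a x) := by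
  intro P hP
  set y : Option ι → k := fun o => o.elim a x with hy
  set I := Ideal.span (Set.range fun i => (X i ^ p - C (y i) : MvPolynomial (Option ι) k)) with hI
  set ev := eval₂Hom (frobenius k p) x with hev
  have hsymm : ∀ f : Polynomial (MvPolynomial ι k),
      Polynomial.eval₂ ev a f = eval₂Hom (frobenius k p) y ((optionEquivLeft k ι).symm f) := by
    intro f
    have : (Polynomial.eval₂RingHom ev a) =
        (eval₂Hom (frobenius k p) y).comp (optionEquivLeft k ι).symm.toRingEquiv.toRingHom := by
      apply Polynomial.ringHom_ext'
      · apply MvPolynomial.ringHom_ext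
        · intro r; simp [hev]
        · intro i; simp [hev, hy]
      · simp [hy]
    exact congrArg (fun g => g f) this
  have hJ : ∀ f ∈ RingHom.ker ev, rename some f ∈ I := by
    intro f hf
    have h2 := Ideal.mem_map_of_mem (rename (R := k) (some : ι → Option ι)).toRingHom (hx hf)
    rw [Ideal.map_span] at h2
    refine Ideal.span_mono ?_ h2
    rintro _ ⟨_, ⟨i, rfl⟩, rfl⟩
    exact ⟨some i, by simp [hy]⟩
  set q : Polynomial (MvPolynomial ι k) := Polynomial.X ^ p - Polynomial.C (C a) with hq
  have hqm : q.Monic := Polynomial.monic_X_pow_sub_C _ (Fact.out : p.Prime).ne_zero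
  set P' := optionEquivLeft k ι P with hP'
  set r := P' %ₘ q with hr
  have hdiv := Polynomial.modByMonic_add_div P' q
  have hqa : Polynomial.eval₂ ev a q = 0 := by simp [hq, hev, frobenius_def]
  have hra : Polynomial.eval₂ ev a r = 0 := by
    have h0 : Polynomial.eval₂ ev a P' = 0 := by
      rw [hsymm, hP', AlgEquiv.symm_apply_apply]; exact hP
    rw [← hdiv, Polynomial.eval₂_add, Polynomial.eval₂_mul, hqa, zero_mul, add_zero] at h0
    exact h0
  have hrdeg : r.degree < p := by
    have := Polynomial.degree_modByMonic_lt P' hqm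
    rwa [hq, Polynomial.degree_X_pow_sub_C (Fact.out : p.Prime).pos] at this
  let evF : MvPolynomial ι k →+* twistedRange p x := ev.rangeRestrict
  have hmap : r.map evF = 0 := by
    by_contra hne
    have h1 := minpoly.degree_le_of_ne_zero (twistedRange p x) a hne (by
      rw [Polynomial.aeval_def, Polynomial.eval₂_map]
      exact hra)
    have h2 : (minpoly (twistedRange p x) a).degree = (p : WithBot ℕ) := by
      rw [Polynomial.degree_eq_natDegree, minpoly_twistedRange ha]
      apply minpoly.ne_zero
      refine ⟨Polynomial.X ^ p - Polynomial.C
        (⟨a ^ p, pow_mem_twistedRange x a⟩ : twistedRange p x),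
        Polynomial.monic_X_pow_sub_C _ (Fact.out : p.Prime).ne_zero, ?_⟩
      simp only [Polynomial.eval₂_sub, Polynomial.eval₂_pow, Polynomial.eval₂_X,
        Polynomial.eval₂_C]
      exact sub_self _
    rw [h2] at h1
    exact absurd (h1.trans Polynomial.degree_map_le) (not_le.mpr hrdeg)
  have hcoeff : ∀ j, r.coeff j ∈ RingHom.ker ev := by
    intro j
    have h : evF (r.coeff j) = 0 := by simpa using congrArg (fun f => f.coeff j) hmap
    exact congrArg Subtype.val h
  have hsr : (optionEquivLeft k ι).symm r ∈ I := by
    rw [Polynomial.as_sum_range_C_mul_X_pow r, map_sum]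
    refine Ideal.sum_mem _ fun j _ => ?_
    rw [map_mul]
    refine Ideal.mul_mem_right _ _ ?_
    have := hJ _ (hcoeff j)
    simpa [optionEquivLeft] using this
  have hsq : (optionEquivLeft k ι).symm q ∈ I := by
    refine Ideal.subset_span ⟨none, ?_⟩
    simp [hq, hy]
  have : P = (optionEquivLeft k ι).symm (r + q * (P' /ₘ q)) := by
    rw [hdiv, hP', AlgEquiv.symm_apply_apply]
  rw [this, map_add, map_mul]
  exact I.add_mem hsr (I.mul_mem_right _ hsq)

theorem PIndep.empty : PIndep p (fun i : (∅ : Set k) => (i : k)) := by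
  intro P hP
  obtain ⟨c, rfl⟩ := C_surjective _ P
  rw [RingHom.mem_ker] at hP
  simp only [coe_eval₂Hom, eval₂_C] at hP
  have : c = 0 := frobenius_inj k p (by simpa using hP)
  simp [this]

theorem PIndep.insert {S : Set k} (hS : PIndep p (fun i : S => (i : k))) {a : k}
    (ha : a ∉ twistedRange p (fun i : S => (i : k))) :
    PIndep p (fun i : (insert a S : Set k) => (i : k)) := by
  classical
  have haS : a ∉ S := fun h => ha ⟨X ⟨a, h⟩, by simp⟩
  have := (hS.option ha).reindex (Set.subtypeInsertEquivOption haS)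
  convert this using 1
  ext ⟨i, hi⟩
  by_cases h : i = a
  · simp [Set.subtypeInsertEquivOption, h]
  · simp [Set.subtypeInsertEquivOption, h]

/-- A relation involves finitely many variables, so it already lives on one member of the chain. -/
theorem PIndep.sUnion {c : Set (Set k)} (hc : IsChain (· ⊆ ·) c) (hne : c.Nonempty)
    (h : ∀ S ∈ c, PIndep p (fun i : S => (i : k))) :
    PIndep p (fun i : (⋃₀ c : Set k) => (i : k)) := by
  classical
  intro P hP
  obtain ⟨T, hT, hsub⟩ := DirectedOn.exists_mem_subset_of_finite_of_subset_sUnion hne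
    hc.directedOn (s := Subtype.val '' (P.vars : Set (⋃₀ c : Set k)))
    (P.vars.finite_toSet.image _) (by rintro _ ⟨i, -, rfl⟩; exact i.2)
  let j : T → (⋃₀ c : Set k) := Set.inclusion (Set.subset_sUnion_of_mem hT)
  obtain ⟨Q, rfl⟩ := exists_rename_eq_of_vars_subset_range P j
    (Set.inclusion_injective _) (by
      intro i hi
      exact ⟨⟨i, hsub ⟨i, hi, rfl⟩⟩, rfl⟩)
  have h1 : Q ∈ RingHom.ker (eval₂Hom (frobenius k p) (fun i : T => (i : k))) := by
    rw [RingHom.mem_ker] at hP ⊢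
    rw [coe_eval₂Hom, eval₂_rename] at hP
    exact hP
  have h2 := Ideal.mem_map_of_mem (rename (R := k) j).toRingHom (h T hT h1)
  rw [Ideal.map_span] at h2
  refine Ideal.span_mono ?_ h2
  rintro _ ⟨_, ⟨i, rfl⟩, rfl⟩
  exact ⟨j i, by simp [j]⟩

/-- By Zorn's lemma: an element outside `k ^ p (S)` could be added to a maximal `S`. -/
theorem exists_pBasis {S₀ : Set k} (h₀ : PIndep p (fun i : S₀ => (i : k))) :
    ∃ S : Set k, S₀ ⊆ S ∧ PIndep p (fun i : S => (i : k)) ∧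
      Function.Surjective (eval₂Hom (frobenius k p) (fun i : S => (i : k))) := by
  obtain ⟨S, hsub, hmax⟩ := zorn_subset_nonempty
    {S : Set k | PIndep p (fun i : S => (i : k))}
    (fun c hc hch hne => ⟨⋃₀ c, PIndep.sUnion hch hne hc, fun s hs => Set.subset_sUnion_of_mem hs⟩)
    S₀ h₀
  refine ⟨S, hsub, hmax.1, fun a => ?_⟩
  by_contra ha
  have h1 := hmax.2 (PIndep.insert hmax.1 (a := a) ha) (Set.subset_insert a S)
  exact ha ⟨X ⟨a, h1 (Set.mem_insert a S)⟩, by simp⟩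

theorem exists_pBasis_mem (b : k) (hb : ∀ c : k, c ^ p ≠ b) :
    ∃ S : Set k, b ∈ S ∧ PIndep p (fun i : S => (i : k)) ∧
      Function.Surjective (eval₂Hom (frobenius k p) (fun i : S => (i : k))) := by
  have h1 : b ∉ twistedRange p (fun i : (∅ : Set k) => (i : k)) := by
    rintro ⟨P, hP⟩
    obtain ⟨c, rfl⟩ := C_surjective _ P
    exact hb c (by simpa [frobenius_def] using hP)
  obtain ⟨S, h, h'⟩ := exists_pBasis (PIndep.insert PIndep.empty h1)
  exact ⟨S, h (Set.mem_insert _ _), h'⟩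

end PBasis

/-! ### Adjoining `p`-power roots: monoid algebras with exponents in `ℕ[1/p]`. -/

section MonoidAlgebraFree

/-- If every element of `N` is uniquely `j m + b` with `b` in `B`, then `ℤ[N]` is a free module
over `ℤ[M]`. -/
theorem AddMonoidAlgebra.free_mapDomain {M N : Type*} [AddCommMonoid M] [AddCommMonoid N]
    (j : M →+ N) (B : Set N)
    (hB : Function.Bijective fun q : B × M => j q.2 + (q.1 : N)) :
    letI := (AddMonoidAlgebra.mapDomainRingHom ℤ j).toAlgebra
    Module.Free (AddMonoidAlgebra ℤ M) (AddMonoidAlgebra ℤ N) := by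
  let := (AddMonoidAlgebra.mapDomainRingHom ℤ j).toAlgebra
  let L : (B →₀ AddMonoidAlgebra ℤ M) →ₗ[AddMonoidAlgebra ℤ M] AddMonoidAlgebra ℤ N :=
    Finsupp.linearCombination _ fun b : B => AddMonoidAlgebra.single (b : N) 1
  -- The bijection `hB` regroups the coefficients of a family indexed by `B` into those of one
  -- element of `ℤ[N]`. As `L` agrees with this equivalence, it is bijective.
  let E : (B →₀ AddMonoidAlgebra ℤ M) ≃+ AddMonoidAlgebra ℤ N :=
    (((Finsupp.mapRange.addEquiv AddMonoidAlgebra.coeffAddEquiv).trans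
      (Finsupp.curryAddEquiv (α := B) (β := M) (M := ℤ)).symm).trans
      (Finsupp.domCongr (Equiv.ofBijective _ hB))).trans AddMonoidAlgebra.coeffAddEquiv.symm
  have hLE : L.toAddMonoidHom = E.toAddMonoidHom := by
    apply Finsupp.addHom_ext'
    intro b
    apply AddMonoidAlgebra.addMonoidHom_ext
    intro m r
    have h1 : L (Finsupp.single b (AddMonoidAlgebra.single m r)) =
        AddMonoidAlgebra.single (j m + (b : N)) r := by
      simp [L, Algebra.smul_def, RingHom.algebraMap_toAlgebra]
    have h2 : E (Finsupp.single b (AddMonoidAlgebra.single m r)) =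
        AddMonoidAlgebra.single (j m + (b : N)) r := by
      simp [E, Equiv.ofBijective]
    exact h1.trans h2.symm
  have hbij : Function.Bijective L := by
    have : (L : (B →₀ AddMonoidAlgebra ℤ M) → AddMonoidAlgebra ℤ N) = E :=
      funext fun x => congrArg (fun g : _ →+ _ => g x) hLE
    rw [this]
    exact E.bijective
  exact Module.Free.of_equiv (LinearEquiv.ofBijective L hbij)

end MonoidAlgebraFree

section PFrac

variable (p : ℕ)

/-- The additive monoid `ℕ[1/p]`. -/
def PFrac : AddSubmonoid ℚ≥0 where
  carrier := {h | ∃ n m : ℕ, h * p ^ n = m}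
  zero_mem' := ⟨0, 0, by simp⟩
  add_mem' := by
    rintro a b ⟨n, m, h⟩ ⟨n', m', h'⟩
    refine ⟨n + n', m * p ^ n' + m' * p ^ n, ?_⟩
    push_cast
    rw [← h, ← h']
    ring

theorem natCast_mem_PFrac (m : ℕ) : (m : ℚ≥0) ∈ PFrac p := ⟨0, m, by simp⟩

variable [Fact p.Prime]

theorem invPow_mem_PFrac (n : ℕ) : ((p : ℚ≥0) ^ n)⁻¹ ∈ PFrac p :=
  ⟨n, 1, by
    have : (p : ℚ≥0) ≠ 0 := Nat.cast_ne_zero.mpr (Fact.out : p.Prime).ne_zero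
    simp [this]⟩

/-- The inclusion `ℕ → ℕ[1/p]`. -/
def PFrac.ofNat : ℕ →+ PFrac p where
  toFun m := ⟨m, natCast_mem_PFrac p m⟩
  map_zero' := by ext; simp
  map_add' a b := by ext; simp

/-- The element `1 / p ^ n` of `ℕ[1/p]`. -/
def PFrac.invPow (n : ℕ) : PFrac p := ⟨((p : ℚ≥0) ^ n)⁻¹, invPow_mem_PFrac p n⟩

theorem PFrac.invPow_zero : PFrac.invPow p 0 = PFrac.ofNat p 1 := by
  ext; simp [PFrac.invPow, PFrac.ofNat]

theorem PFrac.nsmul_invPow_succ (n : ℕ) : p • PFrac.invPow p (n + 1) = PFrac.invPow p n := by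
  have : (p : ℚ≥0) ≠ 0 := Nat.cast_ne_zero.mpr (Fact.out : p.Prime).ne_zero
  apply Subtype.ext
  simp only [PFrac.invPow, AddSubmonoidClass.coe_nsmul, nsmul_eq_mul]
  field_simp
  ring

theorem PFrac.exists_nsmul_invPow (h : PFrac p) : ∃ n m : ℕ, h = m • PFrac.invPow p n := by
  have : (p : ℚ≥0) ≠ 0 := Nat.cast_ne_zero.mpr (Fact.out : p.Prime).ne_zero
  obtain ⟨h, n, m, hm⟩ := h
  refine ⟨n, m, ?_⟩
  apply Subtype.ext
  simp only [PFrac.invPow, AddSubmonoidClass.coe_nsmul, nsmul_eq_mul]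
  rw [← hm]
  field_simp

/-- A compatible system of `p`-power roots defines a homomorphism out of `ℕ[1/p]`. -/
theorem PFrac.exists_addMonoidHom {M : Type*} [AddCommMonoid M] (y : ℕ → M)
    (hy : ∀ n, p • y (n + 1) = y n) : ∃ φ : PFrac p →+ M, ∀ n, φ (PFrac.invPow p n) = y n := by
  have hp0 : (p : ℚ≥0) ≠ 0 := Nat.cast_ne_zero.mpr (Fact.out : p.Prime).ne_zero
  have hyd : ∀ n d, p ^ d • y (n + d) = y n := by
    intro n d
    induction d with
    | zero => simp
    | succ d ih => rw [pow_succ, mul_smul, ← add_assoc, hy, ih]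
  have key' : ∀ (n d m m' : ℕ), m • PFrac.invPow p n = m' • PFrac.invPow p (n + d) →
      m • y n = m' • y (n + d) := by
    intro n d m m' h
    have h1 := congrArg Subtype.val h
    simp only [PFrac.invPow, AddSubmonoidClass.coe_nsmul, nsmul_eq_mul] at h1
    have h2 : m' = m * p ^ d := by
      have : (m' : ℚ≥0) = m * p ^ d := by
        rw [pow_add] at h1
        field_simp at h1
        exact h1.symm
      exact_mod_cast this
    rw [h2, mul_smul, hyd]
  have key : ∀ (n n' m m' : ℕ), m • PFrac.invPow p n = m' • PFrac.invPow p n' →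
      m • y n = m' • y n' := by
    intro n n' m m' h
    rcases le_total n n' with hn | hn
    · obtain ⟨d, rfl⟩ := Nat.exists_eq_add_of_le hn
      exact key' n d m m' h
    · obtain ⟨d, rfl⟩ := Nat.exists_eq_add_of_le hn
      exact (key' n' d m' m h.symm).symm
  choose N K hNK using PFrac.exists_nsmul_invPow p
  have hinv : ∀ n d, PFrac.invPow p n = p ^ d • PFrac.invPow p (n + d) := by
    intro n d
    induction d with
    | zero => simp
    | succ d ih => rw [pow_succ, mul_smul, ← add_assoc, PFrac.nsmul_invPow_succ, ← ih]
  -- The value at `h = K h / p ^ N h` does not depend on this representation, by `key`.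
  refine ⟨{ toFun := fun h => K h • y (N h), map_zero' := ?_, map_add' := ?_ }, ?_⟩
  · rw [key (N 0) 0 (K 0) 0 (by rw [← hNK]; simp)]
    simp
  · intro a b
    have h1 : a + b = (K a * p ^ N b + K b * p ^ N a) • PFrac.invPow p (N a + N b) := by
      conv_lhs => rw [hNK a, hNK b, hinv (N a) (N b), hinv (N b) (N a), add_comm (N b) (N a)]
      rw [add_smul, mul_smul, mul_smul]
    rw [key (N (a + b)) _ (K (a + b)) _ ((hNK _).symm.trans h1), add_smul, mul_smul, mul_smul,
      hyd, add_comm (N a), hyd]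
  · intro n
    change K _ • y (N _) = y n
    rw [key _ n _ 1 (by rw [← hNK, one_smul]), one_smul]

end PFrac

section PFracExponents

variable (p : ℕ)

/-- The inclusion of exponents `ℕ^S → ℕ[1/p]^S`. -/
noncomputable def expIncl (S : Type u) : (S →₀ ℕ) →+ (S →₀ PFrac p) :=
  Finsupp.mapRange.addMonoidHom (PFrac.ofNat p)

/-- The splitting into integral and fractional parts. Monomials with exponents in `[0, 1)` thus form
a basis over the ordinary polynomial ring. -/
theorem expIncl_bijective (S : Type u) :
    Function.Bijective fun q : {b : S →₀ PFrac p | ∀ s, (b s : ℚ≥0) < 1} × (S →₀ ℕ) =>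
      expIncl p S q.2 + (q.1 : S →₀ PFrac p) := by
  have hval : ∀ (m : S →₀ ℕ) (b : S →₀ PFrac p) (s : S),
      (((expIncl p S m + b) s : PFrac p) : ℚ≥0) = m s + b s := by
    intro m b s
    simp [expIncl, PFrac.ofNat]
  constructor
  · rintro ⟨⟨b, hb⟩, m⟩ ⟨⟨b', hb'⟩, m'⟩ h
    have h1 : ∀ s, (m s : ℚ≥0) + b s = m' s + b' s := fun s => by
      rw [← hval, ← hval]; exact congrArg (fun f : S →₀ PFrac p => ((f s : PFrac p) : ℚ≥0)) h
    have h2 : m = m' := by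
      ext s
      have e1 : ⌊(m s : ℚ≥0) + b s⌋₊ = m s := by
        rw [Nat.floor_eq_iff zero_le]
        exact ⟨le_self_add, by gcongr; exact hb s⟩
      have e2 : ⌊(m' s : ℚ≥0) + b' s⌋₊ = m' s := by
        rw [Nat.floor_eq_iff zero_le]
        exact ⟨le_self_add, by gcongr; exact hb' s⟩
      rw [← e1, ← e2, h1]
    subst h2
    simp only [Prod.mk.injEq, Subtype.mk.injEq, and_true]
    exact Finsupp.ext fun s => Subtype.ext (add_left_cancel (h1 s))
  · intro h
    have hfr : ∀ a : PFrac p, (a : ℚ≥0) - ⌊(a : ℚ≥0)⌋₊ ∈ PFrac p := by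
      rintro ⟨a, n, m, ha⟩
      refine ⟨n, m - ⌊a⌋₊ * p ^ n, ?_⟩
      push_cast
      rw [tsub_mul, ha]
    let fr : PFrac p → PFrac p := fun a => ⟨(a : ℚ≥0) - ⌊(a : ℚ≥0)⌋₊, hfr a⟩
    let b : S →₀ PFrac p := h.mapRange fr (by ext; simp [fr])
    let m : S →₀ ℕ := h.mapRange (fun a : PFrac p => ⌊(a : ℚ≥0)⌋₊) (by simp)
    refine ⟨⟨⟨b, fun s => ?_⟩, m⟩, ?_⟩
    · simp only [b, fr, Finsupp.mapRange_apply]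
      rw [tsub_lt_iff_left (Nat.floor_le zero_le)]
      exact Nat.lt_floor_add_one _
    · refine Finsupp.ext fun s => Subtype.ext ?_
      rw [hval]
      simp only [b, m, fr, Finsupp.mapRange_apply]
      exact add_tsub_cancel_of_le (Nat.floor_le zero_le)

end PFracExponents

open AddMonoidAlgebra in
/-- The ring `ℤ[X_s ^ (1 / p ^ ∞)]`. -/
theorem exists_polynomial_roots (p : ℕ) [Fact p.Prime] (S : Type u) :
    ∃ (P' : Type u) (_ : CommRing P') (_ : Algebra (MvPolynomial S ℤ) P') (ζ : S → ℕ → P'),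
      Module.Free (MvPolynomial S ℤ) P' ∧ Nontrivial P' ∧
      (∀ s, algebraMap (MvPolynomial S ℤ) P' (MvPolynomial.X s) = ζ s 0) ∧
      (∀ s n, ζ s (n + 1) ^ p = ζ s n) ∧
      Subring.closure (Set.range fun q : S × ℕ => ζ q.1 q.2) = ⊤ ∧
      ∀ (R' : Type u) [CommRing R'] (y : S → ℕ → R'), (∀ s n, y s (n + 1) ^ p = y s n) →
        ∃ h : P' →+* R', ∀ s n, h (ζ s n) = y s n := by
  refine ⟨AddMonoidAlgebra ℤ (S →₀ PFrac p), inferInstance,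
    (mapDomainRingHom ℤ (expIncl p S)).toAlgebra,
    fun s n => single (Finsupp.single s (PFrac.invPow p n)) 1,
    AddMonoidAlgebra.free_mapDomain (expIncl p S) _ (expIncl_bijective p S), inferInstance,
    ?_, ?_, ?_, ?_⟩
  · intro s
    have h1 : (mapDomainRingHom ℤ (expIncl p S)) (single (Finsupp.single s 1) 1) =
        single (Finsupp.single s (PFrac.invPow p 0)) 1 := by
      rw [mapDomainRingHom_apply, mapDomain_single, PFrac.invPow_zero]
      simp [expIncl]
    exact h1
  · intro s n
    rw [AddMonoidAlgebra.single_pow, one_pow, Finsupp.smul_single, PFrac.nsmul_invPow_succ]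
  · rw [eq_top_iff]
    rintro f -
    induction f using AddMonoidAlgebra.induction_linear with
    | zero => exact zero_mem _
    | add f g hf hg => exact add_mem hf hg
    | single a r =>
      have h1 : (single a r : AddMonoidAlgebra ℤ (S →₀ PFrac p)) = r • single a 1 := by simp
      rw [h1]
      refine zsmul_mem ?_ r
      clear h1
      induction a using Finsupp.induction_linear with
      | zero => exact one_mem _
      | add a b ha hb =>
        have : (single (a + b) 1 : AddMonoidAlgebra ℤ (S →₀ PFrac p)) =
            single a 1 * single b 1 := by simp [single_mul_single]
        rw [this]
        exact mul_mem ha hb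
      | single s h =>
        obtain ⟨n, m, rfl⟩ := PFrac.exists_nsmul_invPow p h
        have : (single (Finsupp.single s (m • PFrac.invPow p n)) 1 :
            AddMonoidAlgebra ℤ (S →₀ PFrac p)) =
            single (Finsupp.single s (PFrac.invPow p n)) 1 ^ m := by
          rw [AddMonoidAlgebra.single_pow, one_pow, Finsupp.smul_single]
        rw [this]
        exact pow_mem (Subring.subset_closure (Set.mem_range_self (s, n))) m
  · intro R' _ y hy
    have hex : ∀ s, ∃ φ : PFrac p →+ Additive R', ∀ n,
        φ (PFrac.invPow p n) = Additive.ofMul (y s n) := fun s =>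
      PFrac.exists_addMonoidHom p (fun n => Additive.ofMul (y s n)) fun n => by
        rw [← ofMul_pow, hy]
    choose φ hφ using hex
    let Φ : Multiplicative (S →₀ PFrac p) →* R' :=
      AddMonoidHom.toMultiplicativeLeft (Finsupp.liftAddHom φ)
    refine ⟨(AddMonoidAlgebra.lift ℤ R' (S →₀ PFrac p) Φ).toRingHom, fun s n => ?_⟩
    simp only [AlgHom.toRingHom_eq_coe, RingHom.coe_coe]
    rw [AddMonoidAlgebra.lift_single, one_smul]
    simp [Φ, hφ]

/-- Adjoining all `p`-power roots of a family of elements of a ring. -/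
theorem exists_adjoin_roots (p : ℕ) [Fact p.Prime] {E : Type u} [CommRing E] {S : Type u}
    (z : S → E) :
    ∃ (R : Type u) (_ : CommRing R) (_ : Algebra E R) (Y : S → ℕ → R),
      Module.FaithfullyFlat E R ∧ (∀ s, Y s 0 = algebraMap E R (z s)) ∧
      (∀ s n, Y s (n + 1) ^ p = Y s n) ∧
      Algebra.adjoin E (Set.range fun q : S × ℕ => Y q.1 q.2) = ⊤ ∧
      ∀ (R' : Type u) [CommRing R'] (g : E →+* R') (y : S → ℕ → R'),
        (∀ s, y s 0 = g (z s)) → (∀ s n, y s (n + 1) ^ p = y s n) →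
        ∃ h : R →+* R', h.comp (algebraMap E R) = g ∧ ∀ s n, h (Y s n) = y s n := by
  obtain ⟨P', _, _, ζ, _, _, hζ0, hζ, hgen, huniv⟩ := exists_polynomial_roots p S
  -- The ring `E` receives `X s ↦ z s`, and the universal root ring is base changed along this map.
  -- It is free and nonzero, which gives faithful flatness.
  let : Algebra (MvPolynomial S ℤ) E :=
    (MvPolynomial.eval₂Hom (Int.castRingHom E) z).toAlgebra
  have hzE : ∀ s, algebraMap (MvPolynomial S ℤ) E (MvPolynomial.X s) = z s := fun s =>
    MvPolynomial.eval₂Hom_X' (Int.castRingHom E) z s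
  refine ⟨E ⊗[MvPolynomial S ℤ] P', inferInstance, inferInstance, fun s n => 1 ⊗ₜ ζ s n,
    inferInstance, ?_, ?_, ?_, ?_⟩
  · intro s
    change 1 ⊗ₜ ζ s 0 = _
    rw [← hζ0, ← hzE, Algebra.TensorProduct.algebraMap_apply, Algebra.algebraMap_self,
      RingHom.id_apply, Algebra.algebraMap_eq_smul_one, Algebra.algebraMap_eq_smul_one,
      TensorProduct.smul_tmul]
  · intro s n
    rw [Algebra.TensorProduct.tmul_pow, hζ, one_pow]
  · rw [eq_top_iff]
    rintro x -
    induction x using TensorProduct.induction_on with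
    | zero => exact zero_mem _
    | add x y hx hy => exact add_mem hx hy
    | tmul e f =>
      have h1 : e ⊗ₜ[MvPolynomial S ℤ] f = e • (1 ⊗ₜ f) := by
        rw [TensorProduct.smul_tmul', smul_eq_mul, mul_one]
      rw [h1]
      refine Subalgebra.smul_mem _ ?_ e
      have h2 : (⊤ : Subring P') ≤ (Algebra.adjoin E (Set.range fun q : S × ℕ =>
          (1 ⊗ₜ ζ q.1 q.2 : E ⊗[MvPolynomial S ℤ] P'))).toSubring.comap
            (Algebra.TensorProduct.includeRight :
              P' →ₐ[MvPolynomial S ℤ] E ⊗[MvPolynomial S ℤ] P').toRingHom := by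
        rw [← hgen, Subring.closure_le]
        rintro _ ⟨q, rfl⟩
        exact Algebra.subset_adjoin ⟨q, rfl⟩
      exact h2 (Subring.mem_top f)
  · intro R' _ g y h0 hy
    obtain ⟨f', hf'⟩ := huniv R' y hy
    let : Algebra (MvPolynomial S ℤ) R' := (g.comp (algebraMap _ E)).toAlgebra
    let gA : E →ₐ[MvPolynomial S ℤ] R' := AlgHom.mk g fun _ => rfl
    let fA : P' →ₐ[MvPolynomial S ℤ] R' := AlgHom.mk f' fun a => by
      change (f'.comp (algebraMap _ P')) a = (g.comp (algebraMap _ E)) a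
      refine congrArg (fun h : MvPolynomial S ℤ →+* R' => h a)
        (MvPolynomial.ringHom_ext (fun n => by simp) fun s => ?_)
      simp only [RingHom.comp_apply]
      rw [hζ0, hf', hzE, h0]
    refine ⟨(Algebra.TensorProduct.lift gA fA fun _ _ => Commute.all _ _).toRingHom, ?_, ?_⟩
    · ext e
      simp [gA]
    · intro s n
      simp only [AlgHom.toRingHom_eq_coe, RingHom.coe_coe, Algebra.TensorProduct.lift_tmul,
        map_one, one_mul]
      exact hf' s n

/-! ### A versal algebra with perfect reduction. -/

section ResidueMap

variable (A : Type u) [CommRing A] [IsLocalRing A] (R : Type v) [CommRing R] [Algebra A R]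

/-- The structure map of the reduction of an `A`-algebra over the residue field of `A`. -/
def residueMap : ResidueField A →+* R ⧸ extIdeal A R :=
  Ideal.Quotient.lift (maximalIdeal A) ((Ideal.Quotient.mk (extIdeal A R)).comp (algebraMap A R))
    fun _ ha => Ideal.Quotient.eq_zero_iff_mem.mpr (Ideal.mem_map_of_mem _ ha)

theorem residueMap_residue (a : A) :
    residueMap A R (residue A a) = Ideal.Quotient.mk (extIdeal A R) (algebraMap A R a) := rfl

variable {A R}

theorem redMap_residueMap {R' : Type v} [CommRing R'] [Algebra A R'] (f : R →ₐ[A] R')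
    (x : ResidueField A) : redMap f (residueMap A R x) = residueMap A R' x := by
  obtain ⟨a, rfl⟩ := residue_surjective x
  rw [residueMap_residue, residueMap_residue, redMap, Ideal.quotientMap_mk]
  simp

theorem redMap_mk {R' : Type v} [CommRing R'] [Algebra A R'] (f : R →ₐ[A] R') (x : R) :
    redMap f (Ideal.Quotient.mk _ x) = Ideal.Quotient.mk _ (f x) := rfl

theorem extIdeal_eq_span {t : A} (ht : maximalIdeal A = Ideal.span {t}) :
    extIdeal A R = Ideal.span {algebraMap A R t} := by
  rw [extIdeal, ht, Ideal.map_span, Set.image_singleton]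

theorem charP_quotient_extIdeal {p : ℕ} [CharP (ResidueField A) p]
    [Nontrivial (R ⧸ extIdeal A R)] : CharP (R ⧸ extIdeal A R) p :=
  charP_of_injective_ringHom (residueMap A R).injective p

end ResidueMap

section Versal

open MvPolynomial

variable {p : ℕ} [Fact p.Prime] {A : Type u} [CommRing A] [IsLocalRing A]
  [CharP (ResidueField A) p]

/-- A versal algebra with perfect reduction, attached to lifts of a `p`-basis of the residue
field. -/
theorem exists_versal {t : A} (ht : maximalIdeal A = Ideal.span {t}) {S : Set (ResidueField A)}
    (hind : PIndep p (fun i : S => (i : ResidueField A)))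
    (hgen : Function.Surjective
      (eval₂Hom (frobenius (ResidueField A) p) (fun i : S => (i : ResidueField A))))
    (x : S → A) (hx : ∀ s, residue A (x s) = s) :
    ∃ (R : Type u) (_ : CommRing R) (_ : Algebra A R) (W : S × ℕ → R) (Y : S × ℕ → ℕ → R),
      Module.Flat A R ∧
      (∀ s, Y (s, 0) 0 = algebraMap A R (x s) - algebraMap A R t * W (s, 0)) ∧
      (∀ s j, Y (s, j + 1) 0 = W (s, j) - algebraMap A R t * W (s, j + 1)) ∧
      (∀ q n, Y q (n + 1) ^ p = Y q n) ∧
      Function.Bijective (fun q : R ⧸ extIdeal A R => q ^ p) ∧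
      Function.Injective (eval₂Hom (residueMap A R) fun q => Ideal.Quotient.mk (extIdeal A R) (W q)) ∧
      (∀ r : R ⧸ extIdeal A R, ∃ n : ℕ, r ^ p ^ n ∈
        (eval₂Hom (residueMap A R) fun q => Ideal.Quotient.mk (extIdeal A R) (W q)).range) ∧
      ∀ (R' : Type u) [CommRing R'] [Algebra A R'] (w : S × ℕ → R') (y : S × ℕ → ℕ → R'),
        (∀ s, y (s, 0) 0 = algebraMap A R' (x s) - algebraMap A R' t * w (s, 0)) →
        (∀ s j, y (s, j + 1) 0 = w (s, j) - algebraMap A R' t * w (s, j + 1)) →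
        (∀ q n, y q (n + 1) ^ p = y q n) → Nonempty (R →ₐ[A] R') := by
  -- Here `W (s, j)` is the remainder left after digit `j` of `x s`, and `z (s, j)` is that digit.
  -- Modulo `t`, the digit `z (s, 0)` is `s`, and `z (s, j + 1)` is `W (s, j)`.
  let z : S × ℕ → MvPolynomial (S × ℕ) A := fun q =>
    match q with
    | (s, 0) => C (x s) - C t * X (s, 0)
    | (s, j + 1) => X (s, j) - C t * X (s, j + 1)
  obtain ⟨R, _, algER, Y, _, hY0, hY, hadj, huniv⟩ := exists_adjoin_roots p z
  let algAR : Algebra A R := ((algebraMap (MvPolynomial (S × ℕ) A) R).comp C).toAlgebra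
  have : IsScalarTower A (MvPolynomial (S × ℕ) A) R := IsScalarTower.of_algebraMap_eq fun _ => rfl
  let W : S × ℕ → R := fun q => algebraMap (MvPolynomial (S × ℕ) A) R (X q)
  have hCt : ∀ a, algebraMap (MvPolynomial (S × ℕ) A) R (C a) = algebraMap A R a := fun a => rfl
  let Q := R ⧸ extIdeal A R
  let π : R →+* Q := Ideal.Quotient.mk (extIdeal A R)
  have hπt : π (algebraMap A R t) = 0 := by
    rw [Ideal.Quotient.eq_zero_iff_mem, extIdeal_eq_span ht]
    exact Ideal.mem_span_singleton_self _
  have hYz : ∀ s, Y (s, 0) 0 = algebraMap A R (x s) - algebraMap A R t * W (s, 0) := fun s => by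
    rw [hY0]; simp [z, W, hCt]
  have hYs : ∀ s j, Y (s, j + 1) 0 = W (s, j) - algebraMap A R t * W (s, j + 1) := fun s j => by
    rw [hY0]; simp [z, W, hCt]
  -- By faithful flatness no new polynomial becomes divisible by `t`, so `k[W]` embeds into the
  -- reduction of `R`.
  have hcomap : (extIdeal A R).comap (algebraMap (MvPolynomial (S × ℕ) A) R) =
      RingHom.ker (MvPolynomial.map (residue A) : MvPolynomial (S × ℕ) A →+* _) := by
    have h1 : extIdeal A R = (Ideal.map C (maximalIdeal A)).map
        (algebraMap (MvPolynomial (S × ℕ) A) R) := by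
      rw [Ideal.map_map]; rfl
    rw [h1, Ideal.comap_map_eq_self_of_faithfullyFlat, ker_map, ker_residue]
  have hιmap : ∀ P : MvPolynomial (S × ℕ) A,
      (eval₂Hom (residueMap A R) fun q => π (W q)) (MvPolynomial.map (residue A) P) =
        π (algebraMap _ R P) := by
    intro P
    refine congrArg (fun g : MvPolynomial (S × ℕ) A →+* Q => g P)
      (?_ : ((eval₂Hom (residueMap A R) fun q => π (W q)).comp
        (MvPolynomial.map (residue A))) = π.comp (algebraMap _ R))
    apply MvPolynomial.ringHom_ext
    · intro a; simp [residueMap_residue, hCt, π]; rfl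
    · intro q; simp [W]
  have hinj : Function.Injective (eval₂Hom (residueMap A R) fun q => π (W q)) := by
    rw [injective_iff_map_eq_zero]
    intro P hP
    obtain ⟨P, rfl⟩ := map_surjective (residue A) residue_surjective P
    rw [hιmap, Ideal.Quotient.eq_zero_iff_mem, ← Ideal.mem_comap, hcomap] at hP
    exact hP
  have : Nontrivial Q := hinj.nontrivial
  have : CharP Q p := charP_quotient_extIdeal
  let g : MvPolynomial S (ResidueField A) →+* Q :=
    eval₂Hom (residueMap A R) fun s => π (Y (s, 0) 1)
  have hπx : ∀ s : S, residueMap A R s = π (Y (s, 0) 0) := by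
    intro s
    rw [hYz, map_sub, map_mul, hπt, zero_mul, sub_zero, ← hx, residueMap_residue]
  have hker : RingHom.ker (eval₂Hom (frobenius (ResidueField A) p)
      (fun i : S => (i : ResidueField A))) ≤ RingHom.ker g := by
    refine hind.trans ?_
    rw [Ideal.span_le]
    rintro _ ⟨s, rfl⟩
    simp only [SetLike.mem_coe, RingHom.mem_ker, map_sub, map_pow, g, coe_eval₂Hom, eval₂_X,
      eval₂_C]
    rw [← map_pow, hY, hπx, sub_self]
  -- A `p`-th root map on `k`: by `p`-independence, sending `s` to the adjoined root of its digit
  -- respects all relations.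
  let ρk : ResidueField A →+* Q := RingHom.liftOfSurjective _ hgen ⟨g, hker⟩
  have hρk : ∀ P, ρk (eval₂Hom (frobenius (ResidueField A) p)
      (fun i : S => (i : ResidueField A)) P) = g P := fun P =>
    RingHom.liftOfRightInverse_comp_apply _ _ _ ⟨g, hker⟩ P
  have hρkp : ∀ a, ρk a ^ p = residueMap A R a := by
    intro a
    obtain ⟨P, rfl⟩ := hgen a
    rw [hρk]
    refine congrArg (fun h : MvPolynomial S (ResidueField A) →+* Q => h P)
      (?_ : (frobenius Q p).comp g = (residueMap A R).comp (eval₂Hom (frobenius (ResidueField A) p)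
      (fun i : S => (i : ResidueField A))))
    apply MvPolynomial.ringHom_ext
    · intro c; simp [g, frobenius_def]
    · intro s
      simp only [g, RingHom.comp_apply, coe_eval₂Hom, eval₂_X, frobenius_def, ← map_pow, hY, hπx]
  let ρ : MvPolynomial (S × ℕ) A →+* Q :=
    eval₂Hom (ρk.comp (residue A)) fun q => π (Y (q.1, q.2 + 1) 1)
  have hres : residue A t = 0 := by
    rw [residue_eq_zero_iff, ht]; exact Ideal.mem_span_singleton_self t
  have hρt : ρ (C t) = 0 := by simp [ρ, hres]
  have hρz : ∀ q, π (Y q 1) = ρ (z q) := by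
    rintro ⟨s, _ | j⟩
    · simp only [z, map_sub, map_mul, hρt, zero_mul, sub_zero]
      have := hρk (X s)
      simp only [coe_eval₂Hom, eval₂_X, g] at this
      simp [ρ, hx, this]
    · simp only [z, map_sub, map_mul, hρt, zero_mul, sub_zero]
      simp [ρ]
  -- Shifting all systems of roots by one step defines `θ` with `θ r ^ p = π r`. Since `θ` also
  -- kills `t`, it inverts Frobenius on the reduction.
  obtain ⟨θ, hθE, hθY⟩ := huniv Q ρ (fun q n => π (Y q (n + 1))) hρz
    fun q n => by rw [← map_pow, hY]
  have hθ : ∀ r, θ r ^ p = π r := by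
    intro r
    have hr : r ∈ Algebra.adjoin (MvPolynomial (S × ℕ) A)
      (Set.range fun q : (S × ℕ) × ℕ => Y q.1 q.2) := hadj ▸ trivial
    change (frobenius Q p).comp θ r = π r
    induction hr using Algebra.adjoin_induction with
    | mem r hr =>
      obtain ⟨q, rfl⟩ := hr
      simp only [RingHom.comp_apply, hθY, frobenius_def, ← map_pow, hY]
    | algebraMap e =>
      rw [RingHom.comp_apply, ← RingHom.comp_apply θ, hθE]
      refine congrArg (fun h : MvPolynomial (S × ℕ) A →+* Q => h e)
        (?_ : (frobenius Q p).comp ρ = π.comp (algebraMap _ R))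
      apply MvPolynomial.ringHom_ext
      · intro c
        simp only [ρ, RingHom.comp_apply, coe_eval₂Hom, eval₂_C, frobenius_def, hρkp,
          residueMap_residue, hCt]
        rfl
      · rintro ⟨s, j⟩
        simp only [ρ, RingHom.comp_apply, coe_eval₂Hom, eval₂_X, frobenius_def, ← map_pow, hY, hYs,
          map_sub, map_mul, hπt, zero_mul, sub_zero]
        rfl
    | add a b _ _ ha hb => rw [map_add, map_add, ha, hb]
    | mul a b _ _ ha hb => rw [map_mul, map_mul, ha, hb]
  have hθt : ∀ r ∈ extIdeal A R, θ r = 0 := by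
    intro r hr
    rw [extIdeal_eq_span ht, Ideal.mem_span_singleton] at hr
    obtain ⟨r, rfl⟩ := hr
    rw [map_mul, ← hCt, ← RingHom.comp_apply θ, hθE, hρt, zero_mul]
  have hbij : Function.Bijective (fun q : Q => q ^ p) := by
    constructor
    · intro a b hab
      obtain ⟨a, rfl⟩ := Ideal.Quotient.mk_surjective a
      obtain ⟨b, rfl⟩ := Ideal.Quotient.mk_surjective b
      have h1 : a ^ p - b ^ p ∈ extIdeal A R := by
        rw [← Ideal.Quotient.eq_zero_iff_mem, map_sub, map_pow, map_pow]
        exact sub_eq_zero.mpr hab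
      have h2 := hθt _ h1
      rw [map_sub, map_pow, map_pow, hθ, hθ, sub_eq_zero] at h2
      exact h2
    · intro a
      obtain ⟨a, rfl⟩ := Ideal.Quotient.mk_surjective a
      exact ⟨θ a, hθ a⟩
  refine ⟨R, inferInstance, algAR, W, Y, Module.Flat.trans A (MvPolynomial (S × ℕ) A) R, hYz, hYs,
    hY, hbij, hinj, ?_, ?_⟩
  · intro r
    obtain ⟨r, rfl⟩ := Ideal.Quotient.mk_surjective r
    have hr : r ∈ Algebra.adjoin (MvPolynomial (S × ℕ) A)
      (Set.range fun q : (S × ℕ) × ℕ => Y q.1 q.2) := hadj ▸ trivial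
    have hmono : ∀ {q : Q} {n m : ℕ}, n ≤ m →
        q ^ p ^ n ∈ (eval₂Hom (residueMap A R) fun q => π (W q)).range →
        q ^ p ^ m ∈ (eval₂Hom (residueMap A R) fun q => π (W q)).range := by
      intro q n m hnm hq
      obtain ⟨d, rfl⟩ := Nat.exists_eq_add_of_le hnm
      rw [pow_add, pow_mul]
      exact pow_mem hq _
    have hE : ∀ e, π (algebraMap (MvPolynomial (S × ℕ) A) R e) ∈
        (eval₂Hom (residueMap A R) fun q => π (W q)).range := fun e => ⟨_, hιmap e⟩
    change ∃ n : ℕ, (π r) ^ p ^ n ∈ (eval₂Hom (residueMap A R) fun q => π (W q)).range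
    induction hr using Algebra.adjoin_induction with
    | mem r hr =>
      obtain ⟨⟨q, n⟩, rfl⟩ := hr
      refine ⟨n, ?_⟩
      have : ∀ n, Y q n ^ p ^ n = Y q 0 := by
        intro n
        induction n with
        | zero => simp
        | succ n ih => rw [pow_succ', pow_mul, hY, ih]
      rw [← map_pow, this, hY0]
      exact hE _
    | algebraMap e => exact ⟨0, by simpa using hE e⟩
    | add a b _ _ ha hb =>
      obtain ⟨n, hn⟩ := ha
      obtain ⟨m, hm⟩ := hb
      refine ⟨max n m, ?_⟩
      rw [map_add, add_pow_char_pow]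
      exact add_mem (hmono (le_max_left _ _) hn) (hmono (le_max_right _ _) hm)
    | mul a b _ _ ha hb =>
      obtain ⟨n, hn⟩ := ha
      obtain ⟨m, hm⟩ := hb
      refine ⟨max n m, ?_⟩
      rw [map_mul, mul_pow]
      exact mul_mem (hmono (le_max_left _ _) hn) (hmono (le_max_right _ _) hm)
  · intro R' _ _ w y hy0 hys hy
    obtain ⟨h, hh, -⟩ := huniv R' (eval₂Hom (algebraMap A R') w) y
      (by
        rintro ⟨s, _ | j⟩
        · simp [z, hy0]
        · simp [z, hys]) hy
    exact ⟨AlgHom.mk h fun a => by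
      change h (algebraMap _ R (C a)) = _
      rw [← RingHom.comp_apply h, hh]
      simp⟩

end Versal

section Torsion

variable {A : Type u} [CommRing A] [IsDomain A] [IsDiscreteValuationRing A]

/-- Over a discrete valuation ring flatness is the regularity of the uniformizer. -/
theorem flat_of_uniformizer_smul {t : A} (ht : Irreducible t) {M : Type*} [AddCommGroup M]
    [Module A M] (h : ∀ x : M, t • x = 0 → x = 0) : Module.Flat A M := by
  have h' : ∀ n (x : M), t ^ n • x = 0 → x = 0 := by
    intro n
    induction n with
    | zero => intro x hx; simpa using hx
    | succ n ih =>
      intro x hx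
      rw [pow_succ, mul_smul] at hx
      exact h x (ih _ hx)
  have : Module.IsTorsionFree A M := by
    rw [Module.isTorsionFree_iff_smul_eq_zero]
    intro r x hr
    by_cases hr0 : r = 0
    · exact Or.inl hr0
    · right
      obtain ⟨n, u, rfl⟩ := IsDiscreteValuationRing.eq_unit_mul_pow_irreducible hr0 ht
      rw [mul_smul] at hr
      have := (u.isUnit.smul_eq_zero).mp hr
      exact h' n x this
  infer_instance

end Torsion

theorem algebraMap_mul_cancel {A : Type*} [CommRing A] [IsDomain A] {t : A} (ht : t ≠ 0) {R : Type*} [CommRing R] [Algebra A R]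
    [Module.Flat A R] {x y : R} (h : algebraMap A R t * x = algebraMap A R t * y) : x = y := by
  rw [← Algebra.smul_def, ← Algebra.smul_def] at h
  exact smul_right_injective R ht h

/-! ### Completion, root expansions and versality. -/

section Completion

variable {p : ℕ} {A : Type u} [CommRing A] [IsDomain A] [IsDiscreteValuationRing A]

theorem factorPow_evalₐ {R : Type*} [CommRing R] (I : Ideal R) {m n : ℕ} (hmn : m ≤ n)
    (x : AdicCompletion I R) : Ideal.Quotient.factorPow I hmn (AdicCompletion.evalₐ I n x) =
      AdicCompletion.evalₐ I m x := by
  obtain ⟨f, rfl⟩ := AdicCompletion.mk_surjective I R x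
  rw [AdicCompletion.evalₐ_mk, AdicCompletion.evalₐ_mk, Ideal.Quotient.factorPow,
    Ideal.Quotient.factor_mk]
  exact AdicCompletion.Ideal.mk_eq_mk I hmn f

theorem extIdeal_le_comap {R U : Type*} [CommRing R] [Algebra A R] [CommRing U] [Algebra A U]
    (h : R →ₐ[A] U) : extIdeal A R ≤ (extIdeal A U).comap h.toRingHom := by
  rw [← Ideal.map_le_iff_le_comap, extIdeal, Ideal.map_map, AlgHom.toRingHom_eq_coe,
    h.comp_algebraMap]

/-- If `t x = 0`, a representative `r` of `x` modulo `t ^ (n + 1)` satisfies `t r ∈ (t ^ (n + 1))`,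
and cancelling `t` gives `r ∈ (t ^ n)`. One level is lost, which is harmless as `n` is arbitrary. -/
theorem flat_adicCompletion {t : A} (ht : Irreducible t) {R : Type v} [CommRing R] [Algebra A R]
    [Module.Flat A R] : Module.Flat A (AdicCompletion (extIdeal A R) R) := by
  have hI : extIdeal A R = Ideal.span {algebraMap A R t} := extIdeal_eq_span ht.maximalIdeal_eq
  refine flat_of_uniformizer_smul ht fun x hx => ?_
  refine AdicCompletion.ext_evalₐ fun n => ?_
  rw [map_zero]
  obtain ⟨r, hr⟩ := Ideal.Quotient.mk_surjective (AdicCompletion.evalₐ (extIdeal A R) (n + 1) x)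
  have h1 : Ideal.Quotient.mk (extIdeal A R ^ (n + 1)) (algebraMap A R t * r) = 0 := by
    have h2 := congrArg (AdicCompletion.evalₐ (extIdeal A R) (n + 1)) hx
    rw [map_zero, ← algebraMap_smul R, map_smul, ← hr] at h2
    exact h2
  rw [Ideal.Quotient.eq_zero_iff_mem, hI, Ideal.span_singleton_pow,
    Ideal.mem_span_singleton] at h1
  obtain ⟨s, hs⟩ := h1
  rw [pow_succ', mul_assoc] at hs
  have h3 := algebraMap_mul_cancel ht.ne_zero hs
  have h4 := (factorPow_evalₐ (extIdeal A R) (Nat.le_succ n) x).symm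
  rw [h4, ← hr, Ideal.Quotient.factorPow, Ideal.Quotient.factor_mk, Ideal.Quotient.eq_zero_iff_mem, h3, hI,
    Ideal.span_singleton_pow, Ideal.mem_span_singleton]
  exact Dvd.intro _ rfl

/-- The map from the reduction of an algebra to the reduction of its completion. -/
theorem bijective_reduction_adicCompletion {t : A} (ht : Irreducible t) {R : Type v} [CommRing R]
    [Algebra A R] : Function.Bijective (redMap (IsScalarTower.toAlgHom A R
      (AdicCompletion (extIdeal A R) R))) := by
  have hfg : (extIdeal A R).FG := by
    rw [extIdeal_eq_span ht.maximalIdeal_eq]; exact (Submodule.fg_span_singleton _)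
  have hext : extIdeal A (AdicCompletion (extIdeal A R) R) =
      RingHom.ker (AdicCompletion.evalOneₐ (extIdeal A R)).toRingHom := by
    rw [AdicCompletion.ker_evalOneₐ_eq_map _ hfg]
    change _ = Ideal.map _ (Ideal.map _ _)
    rw [Ideal.map_map, ← IsScalarTower.algebraMap_eq]
  constructor
  · rw [injective_iff_map_eq_zero]
    intro a ha
    obtain ⟨a, rfl⟩ := Ideal.Quotient.mk_surjective a
    rw [redMap_mk, Ideal.Quotient.eq_zero_iff_mem, hext, RingHom.mem_ker] at ha
    exact ha
  · intro a
    obtain ⟨a, rfl⟩ := Ideal.Quotient.mk_surjective a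
    obtain ⟨r, hr⟩ := Ideal.Quotient.mk_surjective (AdicCompletion.evalOneₐ (extIdeal A R) a)
    refine ⟨Ideal.Quotient.mk _ r, ?_⟩
    rw [redMap_mk, Ideal.Quotient.mk_eq_mk_iff_sub_mem, hext, RingHom.mem_ker, map_sub,
      sub_eq_zero]
    exact hr

theorem isCompleteResidualPerfection_adicCompletion {t : A} (ht : Irreducible t) {R : Type v}
    [CommRing R] [Algebra A R] [Module.Flat A R]
    (hR : Function.Bijective fun q : R ⧸ extIdeal A R => q ^ p) :
    IsCompleteResidualPerfection p A (AdicCompletion (extIdeal A R) R) where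
  flat := flat_adicCompletion ht
  complete := by
    have hfg : (extIdeal A R).FG := by
      rw [extIdeal_eq_span ht.maximalIdeal_eq]; exact (Submodule.fg_span_singleton _)
    have := AdicCompletion.isAdicComplete (M := R) hfg
    have h2 := (IsAdicComplete.map_algebraMap_iff (I := extIdeal A R)
      (M := AdicCompletion (extIdeal A R) R) (S := AdicCompletion (extIdeal A R) R)).mpr this
    rwa [extIdeal, Ideal.map_map, ← IsScalarTower.algebraMap_eq] at h2
  perfect := by
    let e := RingEquiv.ofBijective _ (bijective_reduction_adicCompletion ht (R := R))
    have h1 : (fun q : _ ⧸ extIdeal A (AdicCompletion (extIdeal A R) R) => q ^ p) =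
        e ∘ (fun q => q ^ p) ∘ e.symm := by
      ext q; simp
    rw [h1]
    exact e.bijective.comp (hR.comp e.symm.bijective)

theorem exists_algHom_adicCompletion {R : Type v} [CommRing R] [Algebra A R] {U : Type v}
    [CommRing U] [Algebra A U] [IsAdicComplete (extIdeal A U) U] (h : R →ₐ[A] U) :
    Nonempty (AdicCompletion (extIdeal A R) R →ₐ[A] U) := by
  have hle : ∀ n, extIdeal A R ^ n ≤ (extIdeal A U ^ n).comap h := fun n =>
    (Ideal.pow_right_mono (extIdeal_le_comap h) n).trans (Ideal.le_comap_pow h.toRingHom n)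
  refine ⟨IsAdicComplete.liftAlgHom (extIdeal A U)
    (fun n => (Ideal.quotientMapₐ (extIdeal A U ^ n) h (hle n)).comp
      ((AdicCompletion.evalₐ (extIdeal A R) n).restrictScalars A)) ?_⟩
  intro m n hmn
  ext x
  have h1 := factorPow_evalₐ (extIdeal A R) hmn x
  obtain ⟨r, hr⟩ := Ideal.Quotient.mk_surjective (AdicCompletion.evalₐ (extIdeal A R) n x)
  rw [← hr] at h1
  change Ideal.Quotient.factorPow (extIdeal A U) hmn
    (Ideal.quotientMapₐ (extIdeal A U ^ n) h (hle n) (AdicCompletion.evalₐ (extIdeal A R) n x)) =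
    Ideal.quotientMapₐ (extIdeal A U ^ m) h (hle m) (AdicCompletion.evalₐ (extIdeal A R) m x)
  rw [← hr, ← h1]
  rfl

end Completion

section Teichmuller

variable {p : ℕ} [Fact p.Prime]

/-- Multiplicative lifts with compatible `p`-power roots. -/
theorem exists_root_lift {U : Type u} [CommRing U] (I : Ideal U) [IsAdicComplete I U]
    [CharP (U ⧸ I) p] (hperf : Function.Surjective fun x : U ⧸ I => x ^ p) (d : U) :
    ∃ y : ℕ → U, (∀ n, y (n + 1) ^ p = y n) ∧ Ideal.Quotient.mk I (y 0) = Ideal.Quotient.mk I d := by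
  choose r hr using hperf
  -- Since `p ∈ I` and `U` is `I`-adically complete, systems of `p`-power roots lift uniquely from
  -- `U ⧸ I` to `U`.
  let q : ℕ → U ⧸ I := fun n => r^[n] (Ideal.Quotient.mk I d)
  have hq : ∀ n, q (n + 1) ^ p = q n := fun n => by
    simp only [q, Function.iterate_succ_apply']
    exact hr _
  let x : Perfection U p := (Perfection.quotientMulEquiv p I).symm ⟨q, hq⟩
  refine ⟨x.1, x.2, ?_⟩
  have := Perfection.coeff_quotientMulEquiv (I := I) x 0
  rw [show Perfection.quotientMulEquiv p I x = ⟨q, hq⟩ from MulEquiv.apply_symm_apply _ _] at this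
  exact this.symm

end Teichmuller

section VersalComplete

open MvPolynomial

variable {p : ℕ} [Fact p.Prime] {A : Type u} [CommRing A] [IsDomain A] [IsDiscreteValuationRing A]
  [CharP (ResidueField A) p]

/-- Splitting off a multiplicative lift gives `d = τ d 0 + t * next d`. The iterates of `next` at `x
s` are the remainders `w (s, j)`, and their lifts are the digits. -/
theorem exists_root_expansion {t : A} (ht : Irreducible t) {U : Type u} [CommRing U] [Algebra A U]
    (hU : IsCompleteResidualPerfection p A U) [Nontrivial (U ⧸ extIdeal A U)] {S : Type u}
    (x : S → A) :
    ∃ (w : S × ℕ → U) (y : S × ℕ → ℕ → U),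
      (∀ s, y (s, 0) 0 = algebraMap A U (x s) - algebraMap A U t * w (s, 0)) ∧
      (∀ s j, y (s, j + 1) 0 = w (s, j) - algebraMap A U t * w (s, j + 1)) ∧
      (∀ q n, y q (n + 1) ^ p = y q n) := by
  have := hU.complete
  have : CharP (U ⧸ extIdeal A U) p := charP_quotient_extIdeal
  choose τ hτ hτ0 using exists_root_lift (p := p) (extIdeal A U) hU.perfect.2
  have hex : ∀ d : U, ∃ d', d - τ d 0 = algebraMap A U t * d' := by
    intro d
    have h1 : d - τ d 0 ∈ extIdeal A U := by
      rw [← Ideal.Quotient.eq_zero_iff_mem, map_sub, hτ0, sub_self]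
    rw [extIdeal_eq_span ht.maximalIdeal_eq, Ideal.mem_span_singleton] at h1
    exact h1
  choose next hnext using hex
  refine ⟨fun q => next^[q.2 + 1] (algebraMap A U (x q.1)),
    fun q => τ (next^[q.2] (algebraMap A U (x q.1))), ?_, ?_, fun q n => hτ _ n⟩
  · intro s
    simp only [Function.iterate_succ_apply']
    rw [← hnext]
    simp
  · intro s j
    simp only [Function.iterate_succ_apply' next (j + 1)]
    rw [← hnext]
    simp

/-- Existence of a map to `U` without uniqueness suffices, as it only serves to make the universal
residual perfection a retract of `C`. The element `V s` is a `p`-th root of the first digit of `x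
s`. -/
theorem exists_versal_complete {t : A} (ht : Irreducible t) {S : Set (ResidueField A)}
    (hind : PIndep p (fun i : S => (i : ResidueField A)))
    (hgen : Function.Surjective
      (eval₂Hom (frobenius (ResidueField A) p) (fun i : S => (i : ResidueField A))))
    (x : S → A) (hx : ∀ s, residue A (x s) = s) :
    ∃ (C : Type u) (_ : CommRing C) (_ : Algebra A C) (W : S × ℕ → C) (V : S → C),
      IsCompleteResidualPerfection p A C ∧
      (∀ s, algebraMap A C (x s) = V s ^ p + algebraMap A C t * W (s, 0)) ∧
      Function.Injective (eval₂Hom (residueMap A C) fun q => Ideal.Quotient.mk (extIdeal A C) (W q)) ∧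
      (∀ r : C ⧸ extIdeal A C, ∃ n : ℕ, r ^ p ^ n ∈
        (eval₂Hom (residueMap A C) fun q => Ideal.Quotient.mk (extIdeal A C) (W q)).range) ∧
      ∀ (U : Type u) [CommRing U] [Algebra A U], IsCompleteResidualPerfection p A U →
        Nontrivial (U ⧸ extIdeal A U) → Nonempty (C →ₐ[A] U) := by
  obtain ⟨R, _, _, W, Y, hflat, hY0, -, hY, hbij, hinj, hrad, huniv⟩ :=
    exists_versal ht.maximalIdeal_eq hind hgen x hx
  let C := AdicCompletion (extIdeal A R) R
  let f : R →ₐ[A] C := IsScalarTower.toAlgHom A R C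
  let e := RingEquiv.ofBijective (redMap f) (bijective_reduction_adicCompletion ht)
  have he : ((eval₂Hom (residueMap A C) fun q => Ideal.Quotient.mk (extIdeal A C) (f (W q)))) =
      e.toRingHom.comp (eval₂Hom (residueMap A R) fun q => Ideal.Quotient.mk (extIdeal A R) (W q))
      := by
    apply MvPolynomial.ringHom_ext
    · intro c
      simp only [coe_eval₂Hom, eval₂_C, RingHom.comp_apply]
      exact (redMap_residueMap f c).symm
    · intro q
      simp only [coe_eval₂Hom, eval₂_X, RingHom.comp_apply]
      rfl
  refine ⟨C, inferInstance, inferInstance, f ∘ W, fun s => f (Y (s, 0) 1),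
    isCompleteResidualPerfection_adicCompletion ht hbij, ?_, ?_, ?_, ?_⟩
  · intro s
    rw [← map_pow, hY, hY0, map_sub, map_mul, f.commutes, f.commutes]
    simp
  · change Function.Injective
      (eval₂Hom (residueMap A C) fun q => Ideal.Quotient.mk (extIdeal A C) (f (W q)))
    rw [he]
    exact e.injective.comp hinj
  · intro r
    obtain ⟨r, rfl⟩ := e.surjective r
    obtain ⟨n, P, hP⟩ := hrad r
    refine ⟨n, P, ?_⟩
    change (eval₂Hom (residueMap A C) fun q => Ideal.Quotient.mk (extIdeal A C) (f (W q))) P = _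
    rw [he, RingHom.comp_apply, hP]
    exact map_pow e.toRingHom _ _
  · intro U _ _ hU hnt
    obtain ⟨w, y, h0, h1, h2⟩ := exists_root_expansion ht hU x
    obtain ⟨h⟩ := huniv U w y h0 h1 h2
    have := hU.complete
    exact exists_algHom_adicCompletion h

/-- A perfect ring which is radicial over a subring that is a domain is a domain. -/
theorem isDomain_of_radicial {E Q : Type*} [CommRing E] [IsDomain E] [CommRing Q] (i : E →+* Q)
    (hi : Function.Injective i) (hperf : Function.Injective fun q : Q => q ^ p)
    (hrad : ∀ q : Q, ∃ n : ℕ, q ^ p ^ n ∈ i.range) : IsDomain Q := by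
  have hp := (Fact.out : p.Prime)
  have hinj : ∀ (n : ℕ) (q : Q), q ^ p ^ n = 0 → q = 0 := by
    intro n
    induction n with
    | zero => intro q hq; simpa using hq
    | succ n ih =>
      intro q hq
      rw [pow_succ, pow_mul] at hq
      refine ih q (hperf ?_)
      simpa [hp.ne_zero] using hq
  have : Nontrivial Q := hi.nontrivial
  have : NoZeroDivisors Q := by
    constructor
    intro a b hab
    obtain ⟨n, c, hc⟩ := hrad a
    obtain ⟨m, d, hd⟩ := hrad b
    have h1 : c ^ p ^ m * d ^ p ^ n = 0 := by
      apply hi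
      rw [map_mul, map_pow, map_pow, hc, hd, ← pow_mul, ← pow_mul, mul_comm (p ^ m), ← mul_pow,
        hab, zero_pow (by positivity [hp.pos]), map_zero]
    rcases mul_eq_zero.mp h1 with h | h
    · left
      have h2 := pow_eq_zero_iff (pow_pos hp.pos m).ne' |>.mp h
      rw [h2, map_zero] at hc
      exact hinj n a hc.symm
    · right
      have h2 := pow_eq_zero_iff (pow_pos hp.pos n).ne' |>.mp h
      rw [h2, map_zero] at hd
      exact hinj m b hd.symm
  exact NoZeroDivisors.to_isDomain Q

theorem exists_lift_fractionRing {R F Q : Type*} [CommRing R] [IsDomain R] [CommRing F]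
    [CommRing Q] [IsDomain Q] (f : R →+* F)
    (hf : letI : Algebra R F := f.toAlgebra; IsFractionRing R F) {i : R →+* Q}
    (hi : Function.Injective i) :
    IsField F ∧ ∃ j : F →+* FractionRing Q, ∀ r, j (f r) = algebraMap Q (FractionRing Q) (i r) := by
  let : Algebra R F := f.toAlgebra
  have hfr : IsFractionRing R F := hf
  have hinj : Function.Injective ((algebraMap Q (FractionRing Q)).comp i) :=
    (IsFractionRing.injective Q (FractionRing Q)).comp hi
  refine ⟨(IsFractionRing.toField R : Field F).toIsField, ?_⟩
  have hunit : ∀ y : nonZeroDivisors R, IsUnit (((algebraMap Q (FractionRing Q)).comp i) y) :=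
    fun y => IsUnit.mk0 _ fun h => nonZeroDivisors.ne_zero y.2 (hinj (h.trans (map_zero _).symm))
  exact ⟨IsLocalization.lift hunit, fun r => IsLocalization.lift_eq hunit r⟩

/-- The reduction of the generic residual perfection is a field, which embeds into a field
containing the reduction of any versal complete residual perfection. -/
theorem IsGenericResidualPerfection.exists_embedding {G : Type u} [CommRing G] [Algebra A G]
    (hG : IsGenericResidualPerfection p A G)
    {C : Type u} [CommRing C] [Algebra A C] (hC : IsCompleteResidualPerfection p A C)
    [IsDomain (C ⧸ extIdeal A C)]
    (huniv : ∀ (U : Type u) [CommRing U] [Algebra A U], IsCompleteResidualPerfection p A U →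
      Nontrivial (U ⧸ extIdeal A U) → Nonempty (C →ₐ[A] U)) :
    IsField (G ⧸ extIdeal A G) ∧
    ∃ (U : Type u) (_ : CommRing U) (_ : Algebra A U), IsCompleteResidualPerfection p A U ∧
      ∃ (φ : U →ₐ[A] G) (g : U →ₐ[A] C)
        (j : G ⧸ extIdeal A G →+* FractionRing (C ⧸ extIdeal A C)),
        ∀ r, j (redMap φ r) = algebraMap _ _ (redMap g r) := by
  obtain ⟨-, U, _, _, hU, φ, hφ⟩ := hG
  obtain ⟨g, -, -⟩ := hU.initial C hC
  have hnt : Nontrivial (U ⧸ extIdeal A U) := (redMap g).domain_nontrivial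
  obtain ⟨h⟩ := huniv U hU.isCompleteResidualPerfection hnt
  obtain ⟨i, -, hi⟩ := hU.initial U hU.isCompleteResidualPerfection
  -- Initiality forces the composite to be the identity, so the reduction of `U` is a subring of the
  -- domain `C ⧸ extIdeal A C`.
  have hgh : h.comp g = AlgHom.id A U := (hi _ trivial).trans (hi _ trivial).symm
  have hinj : Function.Injective (redMap g) := by
    refine Function.LeftInverse.injective (g := redMap h) fun r => ?_
    obtain ⟨r, rfl⟩ := Ideal.Quotient.mk_surjective r
    rw [redMap_mk, redMap_mk, ← AlgHom.comp_apply, hgh, AlgHom.id_apply]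
  have hdom : IsDomain (U ⧸ extIdeal A U) := hinj.isDomain (redMap g)
  obtain ⟨hfield, j, hj⟩ := exists_lift_fractionRing (redMap φ) hφ hinj
  exact ⟨hfield, U, inferInstance, inferInstance, hU.isCompleteResidualPerfection, φ, g, j, hj⟩

end VersalComplete

/-! ### Tracking one remainder `w` in `a = c ^ p + t h`. -/

section RootExpansion

variable (p : ℕ) [Fact p.Prime] {A : Type u} [CommRing A] [IsLocalRing A]
  {C : Type v} [CommRing C] [Algebra A C] {F : Type*} [Field F]

/-- The element `a` of `A` is `c ^ p + t * h` in `C`, where the image of `c` in `F` lies in a given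
subring `R₀` and that of `h` is `u * w` up to an element of `R₀`. -/
def HasRootExpansion (t : A) (π : C →+* F) (ι : ResidueField A →+* F) (R₀ : Subring F) (w : F)
    (a : A) (u : ResidueField A) : Prop :=
  ∃ c h : C, algebraMap A C a = c ^ p + algebraMap A C t * h ∧ π c ∈ R₀ ∧ π h - ι u * w ∈ R₀

variable {p} {t : A} (ht : maximalIdeal A = Ideal.span {t}) {π : C →+* F}
  {ι : ResidueField A →+* F} (hπ : ∀ a, π (algebraMap A C a) = ι (residue A a)) {R₀ : Subring F}
  (hι : ∀ x, ι x ∈ R₀) {w : F} [CharP (ResidueField A) p]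

include ht in
theorem exists_natCast_eq_mul : ∃ p', (p : A) = t * p' := by
  have : (p : A) ∈ maximalIdeal A := by
    rw [← residue_eq_zero_iff, map_natCast, CharP.cast_eq_zero]
  rw [ht, Ideal.mem_span_singleton] at this
  exact this

include ht in
theorem residue_uniformizer : residue A t = 0 := by
  rw [residue_eq_zero_iff, ht]; exact Ideal.mem_span_singleton_self t

include ht hι hπ in
-- The discrepancy between `c ^ p + c' ^ p` and `(c + c') ^ p` is a multiple of `p`, hence of `t`.
-- It only changes `h` by an element that maps into `R₀`.
theorem HasRootExpansion.add {a b : A} {u v : ResidueField A}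
    (ha : HasRootExpansion p t π ι R₀ w a u) (hb : HasRootExpansion p t π ι R₀ w b v) :
    HasRootExpansion p t π ι R₀ w (a + b) (u + v) := by
  obtain ⟨c, h, e, hc, hh⟩ := ha
  obtain ⟨c', h', e', hc', hh'⟩ := hb
  obtain ⟨p', hp'⟩ := exists_natCast_eq_mul (p := p) ht
  obtain ⟨r, hr⟩ := exists_add_pow_prime_eq (Fact.out : p.Prime)
    (⟨c, hc⟩ : R₀.comap π) (⟨c', hc'⟩ : R₀.comap π)
  have hr' := congrArg (Subtype.val : R₀.comap π → C) hr
  simp only [Subring.coe_pow, Subring.coe_add, Subring.coe_mul, Subring.coe_natCast] at hr'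
  have hp'' : (p : C) = algebraMap A C t * algebraMap A C p' := by
    rw [← map_mul, ← hp', map_natCast]
  refine ⟨c + c', h + h' - algebraMap A C p' * (c * c' * r), ?_, ?_, ?_⟩
  · rw [map_add, e, e', hr', hp'']
    ring
  · rw [map_add]; exact add_mem hc hc'
  · have h1 : π (h + h' - algebraMap A C p' * (c * c' * r)) - ι (u + v) * w =
        (π h - ι u * w) + (π h' - ι v * w) - ι (residue A p') * π (c * c' * r) := by
      rw [map_sub, map_add, map_mul, hπ, map_add]; ring
    rw [h1]
    rw [map_mul, map_mul]
    exact sub_mem (add_mem hh hh') (mul_mem (hι _) (mul_mem (mul_mem hc hc') r.2))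

include ht hι hπ in
-- The coefficient `u` of `w` obeys the Leibniz rule, as `c ^ p` and `c' ^ p` reduce to the residues
-- of `a` and `b`; the cross term `t ^ 2 h h'` is invisible modulo `t` after one division by `t`.
theorem HasRootExpansion.mul {a b : A} {u v : ResidueField A}
    (ha : HasRootExpansion p t π ι R₀ w a u) (hb : HasRootExpansion p t π ι R₀ w b v) :
    HasRootExpansion p t π ι R₀ w (a * b) (u * residue A b + v * residue A a) := by
  obtain ⟨c, h, e, hc, hh⟩ := ha
  obtain ⟨c', h', e', hc', hh'⟩ := hb
  have hπt : π (algebraMap A C t) = 0 := by rw [hπ, residue_uniformizer ht, map_zero]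
  have h1 : ι (residue A a) = π c ^ p := by
    rw [← hπ, e, map_add, map_mul, hπt, zero_mul, add_zero, map_pow]
  have h2 : ι (residue A b) = π c' ^ p := by
    rw [← hπ, e', map_add, map_mul, hπt, zero_mul, add_zero, map_pow]
  refine ⟨c * c', h * c' ^ p + h' * c ^ p + algebraMap A C t * h * h', ?_, ?_, ?_⟩
  · rw [map_mul, e, e']
    ring
  · rw [map_mul]; exact mul_mem hc hc'
  · have h3 : π (h * c' ^ p + h' * c ^ p + algebraMap A C t * h * h') -
        ι (u * residue A b + v * residue A a) * w =
        (π h - ι u * w) * ι (residue A b) + (π h' - ι v * w) * ι (residue A a) := by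
      simp only [map_add, map_mul, hπt, map_pow, h1, h2]
      ring
    rw [h3]
    exact add_mem (mul_mem hh (hι _)) (mul_mem hh' (hι _))

include hι hπ in
theorem hasRootExpansion_mul_uniformizer (a : A) :
    HasRootExpansion p t π ι R₀ w (t * a) 0 :=
  ⟨0, algebraMap A C a, by simp [(Fact.out : p.Prime).ne_zero], by simp, by simpa [hπ] using hι _⟩

include hι hπ in
theorem hasRootExpansion_pow (a : A) : HasRootExpansion p t π ι R₀ w (a ^ p) 0 :=
  ⟨algebraMap A C a, 0, by simp, by rw [hπ]; exact hι _, by simp⟩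

open MvPolynomial in
include ht hι hπ in
/-- Root expansions exist as soon as they exist for lifts of `p`-generators. -/
theorem exists_hasRootExpansion {S : Set (ResidueField A)}
    (hgen : Function.Surjective
      (eval₂Hom (frobenius (ResidueField A) p) (fun i : S => (i : ResidueField A))))
    (x : S → A) (hx : ∀ s, residue A (x s) = s)
    (hS : ∀ s, ∃ u, HasRootExpansion p t π ι R₀ w (x s) u) (a : A) :
    ∃ u, HasRootExpansion p t π ι R₀ w a u := by
  have key : ∀ P : MvPolynomial S (ResidueField A), ∃ b u,
      residue A b = eval₂Hom (frobenius (ResidueField A) p) (fun i : S => (i : ResidueField A)) P ∧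
      HasRootExpansion p t π ι R₀ w b u := by
    intro P
    induction P using MvPolynomial.induction_on with
    | C c =>
      obtain ⟨c, rfl⟩ := residue_surjective c
      exact ⟨c ^ p, 0, by simp [frobenius_def], hasRootExpansion_pow hπ hι c⟩
    | add P Q hP hQ =>
      obtain ⟨b, u, hb, hu⟩ := hP
      obtain ⟨b', u', hb', hu'⟩ := hQ
      exact ⟨b + b', _, by rw [map_add, hb, hb', map_add], hu.add ht hπ hι hu'⟩
    | mul_X P s hP =>
      obtain ⟨b, u, hb, hu⟩ := hP
      obtain ⟨u', hu'⟩ := hS s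
      exact ⟨b * x s, _, by rw [map_mul, hb, hx, map_mul]; simp, hu.mul ht hπ hι hu'⟩
  obtain ⟨P, hP⟩ := hgen (residue A a)
  obtain ⟨b, u, hb, hu⟩ := key P
  have h1 : a - b ∈ maximalIdeal A := by
    rw [← residue_eq_zero_iff, map_sub, hb, hP, sub_self]
  rw [ht, Ideal.mem_span_singleton] at h1
  obtain ⟨d, hd⟩ := h1
  refine ⟨u + 0, ?_⟩
  rw [show a = b + t * d by rw [← hd]; ring]
  exact hu.add ht hπ hι (hasRootExpansion_mul_uniformizer hπ hι d)

theorem exists_sum_pow_prime_eq {R : Type*} [CommRing R] {κ : Type*} (s : Finset κ) (y : κ → R) :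
    ∃ r, ∑ i ∈ s, y i ^ p = (∑ i ∈ s, y i) ^ p + p * r := by
  classical
  induction s using Finset.induction_on with
  | empty => exact ⟨0, by simp [(Fact.out : p.Prime).ne_zero]⟩
  | insert i s hi ih =>
    obtain ⟨r, hr⟩ := ih
    obtain ⟨r', hr'⟩ := exists_add_pow_prime_eq (Fact.out : p.Prime) (y i) (∑ i ∈ s, y i)
    exact ⟨r - y i * (∑ i ∈ s, y i) * r', by rw [Finset.sum_insert hi, Finset.sum_insert hi, hr, hr']; ring⟩

open Polynomial in
include ht hι hπ in
/-- A monic polynomial over `A` whose reduction is a polynomial in `X ^ p` is, up to a multiple of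
`t`, a `p`-th power over `C`, with control over that multiple. -/
theorem exists_polynomial_expansion {f : A[X]} (hf : f.Monic)
    (hf' : ∀ m, ¬ p ∣ m → residue A (f.coeff m) = 0)
    (hexp : ∀ a : A, ∃ u, HasRootExpansion p t π ι R₀ w a u) {m₀ : ℕ}
    (hm₀ : HasRootExpansion p t π ι R₀ w (f.coeff m₀) 1) (hpm₀ : p ∣ m₀)
    (hm₀' : m₀ < f.natDegree) :
    ∃ (T H : C[X]) (H₀ : F[X]) (H₁ : (ResidueField A)[X]),
      f.map (algebraMap A C) = T ^ p + Polynomial.C (algebraMap A C t) * H ∧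
      H.map π = H₀ + Polynomial.C w * H₁.map ι ∧ (∀ m, H₀.coeff m ∈ R₀) ∧ H₁.coeff m₀ = 1 ∧
      H₁.degree < f.natDegree := by
  have hp := (Fact.out : p.Prime)
  -- The leading coefficient is expanded as `1 = 1 ^ p + t * 0`, so it contributes nothing to `H₁`.
  -- Where `p` does not divide `m`, the coefficient is a multiple of `t` and `c = 0`.
  have key : ∀ m, ∃ (c h : C) (u : ResidueField A),
      algebraMap A C (f.coeff m) = c ^ p + algebraMap A C t * h ∧ π c ∈ R₀ ∧
      π h - ι u * w ∈ R₀ ∧ (m = m₀ → u = 1) ∧ (f.natDegree ≤ m → u = 0) ∧ (¬ p ∣ m → c = 0) := by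
    intro m
    by_cases h1 : m = f.natDegree
    · by_cases h2 : p ∣ m
      · refine ⟨1, 0, 0, ?_, ?_, ?_, fun h => absurd (h ▸ h1) hm₀'.ne, fun _ => rfl,
          fun h => absurd h2 h⟩
        · rw [h1, hf.coeff_natDegree]; simp
        · simp
        · simp
      · exact absurd (hf' m h2) (by rw [h1, hf.coeff_natDegree]; simp)
    · by_cases h2 : m = m₀
      · subst h2
        obtain ⟨c, h, e, hc, hh⟩ := hm₀
        exact ⟨c, h, 1, e, hc, hh, fun _ => rfl, fun h => absurd h hm₀'.not_ge,
          fun h => absurd hpm₀ h⟩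
      by_cases h5 : f.natDegree < m
      · exact ⟨0, 0, 0, by simp [Polynomial.coeff_eq_zero_of_natDegree_lt h5, hp.ne_zero], by simp,
          by simp, fun h => absurd h h2, fun _ => rfl, fun _ => rfl⟩
      · by_cases h3 : p ∣ m
        · obtain ⟨u, c, h, e, hc, hh⟩ := hexp (f.coeff m)
          exact ⟨c, h, u, e, hc, hh, fun h => absurd h h2, fun h => absurd (h.antisymm (not_lt.mp h5)).symm h1,
            fun h => absurd h3 h⟩
        · have h4 := hf' m h3
          rw [residue_eq_zero_iff, ht, Ideal.mem_span_singleton] at h4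
          obtain ⟨a, ha⟩ := h4
          refine ⟨0, algebraMap A C a, 0, ?_, ?_, ?_, fun h => absurd h h2, fun _ => rfl,
            fun _ => rfl⟩
          · rw [ha]; simp [hp.ne_zero]
          · simp
          · simpa [hπ] using hι _
  choose c h u e hc hh hu1 hu0 hc0 using key
  let 𝓡 : Subring C := R₀.comap π
  let y : ℕ → 𝓡[X] := fun m => Polynomial.C (⟨c m, hc m⟩ : 𝓡) * X ^ (m / p)
  -- The sum is formed over the preimage `𝓡` of `R₀`, so that the correction `r` has coefficients
  -- mapping into `R₀`.
  obtain ⟨r, hr⟩ := exists_sum_pow_prime_eq (p := p) (Finset.range (f.natDegree + 1)) y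
  obtain ⟨p', hp'⟩ := exists_natCast_eq_mul (p := p) ht
  have hp'' : (p : C[X]) = Polynomial.C (algebraMap A C t) * Polynomial.C (algebraMap A C p') := by
    rw [← Polynomial.C_mul, ← map_mul, ← hp', map_natCast, map_natCast]
  have hr' := congrArg (Polynomial.map 𝓡.subtype) hr
  have hy : ∀ m, ((y m).map 𝓡.subtype) ^ p = Polynomial.C (c m ^ p) * X ^ m := by
    intro m
    simp only [y, Polynomial.map_mul, Polynomial.map_C, Polynomial.map_pow, Polynomial.map_X,
      Subring.subtype_apply, mul_pow, ← pow_mul, ← Polynomial.C_pow]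
    by_cases h : p ∣ m
    · rw [Nat.div_mul_cancel h]
    · simp [hc0 m h, hp.ne_zero]
  simp only [Polynomial.map_add, Polynomial.map_mul, Polynomial.map_pow, Polynomial.map_sum,
    Polynomial.map_natCast, hy] at hr'
  have hf1 : f.map (algebraMap A C) = ∑ m ∈ Finset.range (f.natDegree + 1),
      Polynomial.C (c m ^ p) * X ^ m +
      Polynomial.C (algebraMap A C t) *
        ∑ m ∈ Finset.range (f.natDegree + 1), Polynomial.C (h m) * X ^ m := by
    conv_lhs => rw [f.as_sum_range_C_mul_X_pow]
    rw [Polynomial.map_sum, Finset.mul_sum, ← Finset.sum_add_distrib]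
    refine Finset.sum_congr rfl fun m _ => ?_
    simp only [Polynomial.map_mul, Polynomial.map_C, Polynomial.map_pow, Polynomial.map_X, e,
      Polynomial.C_add, Polynomial.C_mul]
    ring
  refine ⟨∑ m ∈ Finset.range (f.natDegree + 1), (y m).map 𝓡.subtype,
    ∑ m ∈ Finset.range (f.natDegree + 1), Polynomial.C (h m) * X ^ m +
      Polynomial.C (algebraMap A C p') * r.map 𝓡.subtype,
    ∑ m ∈ Finset.range (f.natDegree + 1), Polynomial.C (π (h m) - ι (u m) * w) * X ^ m +
      Polynomial.C (ι (residue A p')) * (r.map 𝓡.subtype).map π,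
    ∑ m ∈ Finset.range (f.natDegree + 1), Polynomial.C (u m) * X ^ m, ?_, ?_, ?_, ?_, ?_⟩
  · rw [hf1, hr', hp'']
    ring
  · simp only [Polynomial.map_add, Polynomial.map_mul, Polynomial.map_sum, Polynomial.map_C,
      Polynomial.map_pow, Polynomial.map_X, hπ]
    rw [Finset.mul_sum, add_right_comm, ← Finset.sum_add_distrib]
    congr 1
    refine Finset.sum_congr rfl fun m _ => ?_
    simp only [Polynomial.C_sub, Polynomial.C_mul]
    ring
  · intro m
    rw [Polynomial.coeff_add, Polynomial.finsetSum_coeff]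
    refine add_mem (sum_mem fun i _ => ?_) ?_
    · rw [Polynomial.coeff_C_mul_X_pow]
      split_ifs
      · exact hh i
      · exact zero_mem _
    · rw [Polynomial.coeff_C_mul, Polynomial.coeff_map, Polynomial.coeff_map]
      exact mul_mem (hι _) (r.coeff m).2
  · rw [Polynomial.finsetSum_coeff]
    simp only [Polynomial.coeff_C_mul_X_pow]
    rw [Finset.sum_ite_eq, if_pos, hu1 m₀ rfl]
    exact Finset.mem_range.mpr (by omega)
  · rw [Polynomial.degree_lt_iff_coeff_zero]
    intro m hm
    rw [Polynomial.finsetSum_coeff]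
    simp only [Polynomial.coeff_C_mul_X_pow]
    rw [Finset.sum_ite_eq]
    split_ifs with h1
    · rw [Finset.mem_range] at h1
      exact hu0 m (by omega)
    · rfl

end RootExpansion

/-! ### Algebraic independence of the remainders. -/

section Transcendence

open Polynomial

variable {k F κ : Type*} [Field k] [Field F] [Algebra k F] {W : κ → F}

/-- The family stays independent over the algebraic closure of `k` in `F`. Comparing one nonzero
coefficient in `b P' = P` exhibits `b` as a quotient of elements of `k`. -/
theorem AlgebraicIndependent.mem_range_of_isAlgebraic (hW : AlgebraicIndependent k W) {b : F}
    (hb : IsAlgebraic k b) {P P' : MvPolynomial κ k} (hP' : MvPolynomial.aeval W P' ≠ 0)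
    (h : b * MvPolynomial.aeval W P' = MvPolynomial.aeval W P) : b ∈ (algebraMap k F).range := by
  have hW' := hW.algebraicClosure
  let b' : algebraicClosure k F := ⟨b, mem_algebraicClosure_iff.mpr hb⟩
  have hmap : ∀ P : MvPolynomial κ k, MvPolynomial.aeval W
      (P.map (algebraMap k (algebraicClosure k F))) = MvPolynomial.aeval W P :=
    fun P => MvPolynomial.aeval_map_algebraMap _ _ _
  have h1 : MvPolynomial.C b' * P'.map (algebraMap k (algebraicClosure k F)) =
      P.map (algebraMap k (algebraicClosure k F)) := by
    apply hW'
    rw [map_mul, hmap, hmap, MvPolynomial.aeval_C]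
    exact h
  have h2 : P' ≠ 0 := fun h => hP' (by rw [h, map_zero])
  obtain ⟨m, hm⟩ := MvPolynomial.ne_zero_iff.mp h2
  have h3 := congrArg (fun Q => ((MvPolynomial.coeff m Q : algebraicClosure k F) : F)) h1
  simp only [MvPolynomial.coeff_C_mul, MvPolynomial.coeff_map] at h3
  have h4 : b * algebraMap k F (P'.coeff m) = algebraMap k F (P.coeff m) := h3
  refine ⟨P.coeff m / P'.coeff m, ?_⟩
  rw [map_div₀, ← h4, mul_div_cancel_right₀]
  exact (_root_.map_ne_zero _).mpr hm

/-- The subring of elements algebraic over the field generated by all `W q` with `q ≠ q₀`. -/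
noncomputable def algebraicOver (k : Type*) {F κ : Type*} [Field k] [Field F] [Algebra k F]
    (W : κ → F) (q₀ : κ) : Subring F :=
  (Subalgebra.algebraicClosure (Algebra.adjoin k (W '' {q | q ≠ q₀})) F).toSubring

theorem mem_algebraicOver {q₀ : κ} {b : F} : b ∈ algebraicOver k W q₀ ↔
    IsAlgebraic (Algebra.adjoin k (W '' {q | q ≠ q₀})) b := Iff.rfl

theorem mem_algebraicOver_of_isAlgebraic {q₀ : κ} {b : F} (hb : IsAlgebraic k b) :
    b ∈ algebraicOver k W q₀ :=
  mem_algebraicOver.mpr (hb.extendScalars (algebraMap k _).injective)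

theorem mem_algebraicOver_of_ne {q₀ q : κ} (h : q ≠ q₀) : W q ∈ algebraicOver k W q₀ :=
  mem_algebraicOver.mpr (isAlgebraic_algebraMap
    (⟨W q, Algebra.subset_adjoin ⟨q, h, rfl⟩⟩ : Algebra.adjoin k (W '' {q | q ≠ q₀})))

theorem AlgebraicIndependent.notMem_algebraicOver (hW : AlgebraicIndependent k W) (q₀ : κ) :
    W q₀ ∉ algebraicOver k W q₀ := fun h =>
  hW.transcendental_adjoin (s := {q | q ≠ q₀}) (by simp) (mem_algebraicOver.mp h)

/-- A polynomial linear in a transcendental element has no common root with an irreducible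
polynomial over the ground field. -/
theorem AlgebraicIndependent.eval_ne_zero (hW : AlgebraicIndependent k W) (q₀ : κ) {f : k[X]}
    (hf : Irreducible f) {H₀ : Polynomial F} (hH₀ : ∀ m, H₀.coeff m ∈ algebraicOver k W q₀)
    {H₁ : k[X]} (hH₁ : H₁ ≠ 0) (hdeg : H₁.degree < f.degree) {a : F} (ha : aeval a f = 0) :
    (H₀ + C (W q₀) * H₁.map (algebraMap k F)).eval a ≠ 0 := by
  intro h
  have haalg : IsAlgebraic k a := ⟨f, hf.ne_zero, ha⟩
  have h1 : aeval a H₁ ≠ 0 := by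
    intro h2
    have hcop : IsCoprime f H₁ := hf.coprime_iff_not_dvd.mpr fun hd =>
      absurd (degree_le_of_dvd hd hH₁) (not_le.mpr hdeg)
    obtain ⟨u, v, huv⟩ := hcop
    have := congrArg (aeval a) huv
    simp [ha, h2] at this
  have h2 : IsAlgebraic k (aeval a H₁) := by
    have h3 : Algebra.adjoin k {a} ≤ (algebraicClosure k F).toSubalgebra :=
      Algebra.adjoin_le (by simpa using mem_algebraicClosure_iff.mpr haalg)
    exact mem_algebraicClosure_iff.mp (h3 (aeval_mem_adjoin_singleton k a))
  have h3 : H₀.eval a ∈ algebraicOver k W q₀ := by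
    rw [eval_eq_sum]
    exact sum_mem fun i _ =>
      mul_mem (hH₀ i) (pow_mem (mem_algebraicOver_of_isAlgebraic haalg) i)
  refine hW.notMem_algebraicOver q₀ ?_
  rw [eval_add, eval_mul, eval_C, eval_map_algebraMap] at h
  -- A common root `a` expresses `W q₀` through elements algebraic over the remaining `W q`.
  have h4 : W q₀ = -(H₀.eval a) * (aeval a H₁)⁻¹ := by
    field_simp
    linear_combination h
  rw [h4]
  exact mul_mem (neg_mem h3) (mem_algebraicOver_of_isAlgebraic h2.inv)

end Transcendence

/-! ### Embedding the residue field of the generic residual perfection. -/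

section Model

open MvPolynomial

variable {p : ℕ} [Fact p.Prime] {A : Type u} [CommRing A] [IsDomain A] [IsDiscreteValuationRing A]
  [CharP (ResidueField A) p]

/-- The reduction of the generic residual perfection embeds into the algebraic closure of the
fraction field of the reduction of a versal complete residual perfection. -/
theorem IsGenericResidualPerfection.exists_model {G : Type u} [CommRing G] [Algebra A G]
    (hG : IsGenericResidualPerfection p A G) {t : A} (ht : Irreducible t)
    {S : Set (ResidueField A)}
    (hind : PIndep p (fun i : S => (i : ResidueField A)))
    (hgen : Function.Surjective
      (eval₂Hom (frobenius (ResidueField A) p) (fun i : S => (i : ResidueField A))))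
    (x : S → A) (hx : ∀ s, residue A (x s) = s) :
    IsField (G ⧸ extIdeal A G) ∧
    ∃ (F : Type u) (_ : Field F) (_ : IsAlgClosed F) (_ : Algebra (ResidueField A) F)
      (C : Type u) (_ : CommRing C) (_ : Algebra A C) (W : S × ℕ → C) (V : S → C) (π : C →+* F)
      (j : G ⧸ extIdeal A G →+* F),
      Module.Flat A C ∧
      (∀ s, algebraMap A C (x s) = V s ^ p + algebraMap A C t * W (s, 0)) ∧
      RingHom.ker π = extIdeal A C ∧
      (∀ a, π (algebraMap A C a) = algebraMap _ F (residue A a)) ∧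
      (∀ a, j (residueMap A G a) = algebraMap _ F a) ∧
      AlgebraicIndependent (ResidueField A) (fun q => π (W q)) ∧
      (∀ r : G ⧸ extIdeal A G, ∃ (n : ℕ) (P P' : MvPolynomial (S × ℕ) (ResidueField A)),
        aeval (fun q => π (W q)) P' ≠ 0 ∧
        j r ^ p ^ n * aeval (fun q => π (W q)) P' = aeval (fun q => π (W q)) P) ∧
      ∃ (U : Type u) (_ : CommRing U) (_ : Algebra A U) (φ : U →ₐ[A] G) (g : U →ₐ[A] C),
        IsCompleteResidualPerfection p A U ∧
        ∀ r, j (Ideal.Quotient.mk _ (φ r)) = π (g r) := by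
  obtain ⟨C, _, _, W, V, hC, hVW, hinj, hrad, huniv⟩ := exists_versal_complete ht hind hgen x hx
  have hdom : IsDomain (C ⧸ extIdeal A C) := isDomain_of_radicial _ hinj hC.perfect.1 hrad
  obtain ⟨hfield, U, _, _, hU, φ, g, j, hj⟩ := hG.exists_embedding hC huniv
  let K := FractionRing (C ⧸ extIdeal A C)
  let F := AlgebraicClosure K
  let i : C ⧸ extIdeal A C →+* F := (algebraMap K F).comp (algebraMap _ K)
  have hi : Function.Injective i :=
    (algebraMap K F).injective.comp (IsFractionRing.injective _ K)
  let alg : Algebra (ResidueField A) F := (i.comp (residueMap A C)).toAlgebra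
  have halg : ∀ a, algebraMap (ResidueField A) F a = i (residueMap A C a) := fun _ => rfl
  have haev : ∀ P, aeval (R := ResidueField A) (fun q => i (Ideal.Quotient.mk _ (W q))) P =
      i (eval₂Hom (residueMap A C) (fun q => Ideal.Quotient.mk (extIdeal A C) (W q)) P) := by
    intro P
    refine congrArg (fun h : MvPolynomial (S × ℕ) (ResidueField A) →+* F => h P)
      (?_ : (aeval (R := ResidueField A) (fun q => i (Ideal.Quotient.mk _ (W q)))).toRingHom =
        i.comp (eval₂Hom (residueMap A C) (fun q => Ideal.Quotient.mk (extIdeal A C) (W q))))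
    apply MvPolynomial.ringHom_ext
    · intro r; simp [halg]
    · intro q; simp
  refine ⟨hfield, F, inferInstance, inferInstance, alg, C, inferInstance, inferInstance, W, V,
    i.comp (Ideal.Quotient.mk _), (algebraMap K F).comp j, hC.flat, hVW, ?_, ?_, ?_, ?_, ?_, U,
    inferInstance, inferInstance, φ, g, hU, ?_⟩
  · rw [← RingHom.comap_ker, (RingHom.injective_iff_ker_eq_bot i).mp hi, ← RingHom.ker_eq_comap_bot,
      Ideal.mk_ker]
  · intro a
    rfl
  · intro a
    obtain ⟨a, rfl⟩ := residue_surjective a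
    rw [residueMap_residue, ← φ.commutes, ← redMap_mk, RingHom.comp_apply, hj, halg,
      residueMap_residue, redMap_mk, g.commutes]
    rfl
  · change Function.Injective _
    intro P P' h
    exact hinj (hi ((haev P).symm.trans (h.trans (haev P'))))
  · intro r
    obtain ⟨a, b, hb, hab⟩ := IsFractionRing.div_surjective (A := C ⧸ extIdeal A C) (j r)
    obtain ⟨n, P, hP⟩ := hrad a
    obtain ⟨m, P', hP'⟩ := hrad b
    have hb0 : i b ≠ 0 := fun h => nonZeroDivisors.ne_zero hb (hi (h.trans (map_zero i).symm))
    have hjr : algebraMap K F (j r) = i a / i b := by rw [← hab, map_div₀]; rfl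
    have h1 := haev (P' ^ p ^ n)
    have h2 := haev (P ^ p ^ m)
    rw [(map_pow (eval₂Hom _ _) P' _).trans (congrArg (· ^ p ^ n) hP'), ← pow_mul, ← pow_add,
      map_pow i, add_comm m n] at h1
    rw [(map_pow (eval₂Hom _ _) P _).trans (congrArg (· ^ p ^ m) hP), ← pow_mul, ← pow_add,
      map_pow i] at h2
    -- For `j r = a / b`, the powers `a ^ p ^ n` and `b ^ p ^ m` are polynomials in the remainders.
    -- The exponent `p ^ (n + m)` serves both.
    refine ⟨n + m, P ^ p ^ m, P' ^ p ^ n, fun h => pow_ne_zero _ hb0 (h1.symm.trans h), ?_⟩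
    refine Eq.trans (congrArg₂ (· * ·) (congrArg (· ^ p ^ (n + m)) hjr) h1) (Eq.trans ?_ h2.symm)
    rw [div_pow, div_mul_cancel₀ _ (pow_ne_zero _ hb0)]
  · intro r
    have := congrArg (algebraMap K F) (hj (Ideal.Quotient.mk _ r))
    exact this

end Model

/-- Separatedness stops the extraction of factors `π`, so each nonzero element is `π ^ n` times a
unit. Regularity of `π` then excludes zero divisors. -/
theorem isDVR_of_regular_generator {R : Type u} [CommRing R] {π : R}
    (hreg : ∀ x, π * x = 0 → x = 0) (hunit : ∀ x, ¬ π ∣ x → IsUnit x) (hπ : ¬ IsUnit π)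
    (hsep : ∀ x, (∀ n, π ^ n ∣ x) → x = 0) :
    ∃ _ : IsDomain R, IsDiscreteValuationRing R ∧ Irreducible π := by
  have hnt : Nontrivial R := by
    by_contra h
    rw [not_nontrivial_iff_subsingleton] at h
    exact hπ (isUnit_of_subsingleton π)
  have hpow : ∀ n x, π ^ n * x = 0 → x = 0 := by
    intro n
    induction n with
    | zero => intro x h; simpa using h
    | succ n ih => intro x h; exact ih _ (hreg _ (by rw [← h]; ring))
  have hπ0 : π ≠ 0 := fun h => one_ne_zero (hreg 1 (by rw [h, zero_mul]))
  have hfac : ∀ x, x ≠ 0 → ∃ n u, IsUnit u ∧ x = π ^ n * u := by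
    intro x hx
    by_contra! hcon
    refine hx (hsep x fun n => ?_)
    induction n with
    | zero => simp
    | succ n ih =>
      obtain ⟨y, rfl⟩ := ih
      by_cases hy : π ∣ y
      · obtain ⟨z, rfl⟩ := hy
        exact ⟨z, by ring⟩
      · exact absurd rfl (hcon n y (hunit y hy))
  have hdom : IsDomain R := by
    have : NoZeroDivisors R := by
      refine ⟨fun {a b} hab => ?_⟩
      by_contra! h
      obtain ⟨n, u, hu, rfl⟩ := hfac a h.1
      obtain ⟨m, v, hv, rfl⟩ := hfac b h.2
      have : (u * v) = 0 := hpow (n + m) _ (by rw [← hab]; ring)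
      exact (hu.mul hv).ne_zero this
    exact NoZeroDivisors.to_isDomain R
  have hirr : Irreducible π := by
    refine ⟨hπ, fun a b hab => ?_⟩
    by_contra! h
    have ha : π ∣ a := by by_contra h1; exact h.1 (hunit a h1)
    have hb : π ∣ b := by by_contra h1; exact h.2 (hunit b h1)
    obtain ⟨a, rfl⟩ := ha
    obtain ⟨b, rfl⟩ := hb
    refine hπ (IsUnit.of_mul_eq_one (a * b) ?_)
    have : π * (1 - π * (a * b)) = 0 := by linear_combination hab
    have := hreg _ this
    linear_combination -this
  refine ⟨hdom, IsDiscreteValuationRing.ofHasUnitMulPowIrreducibleFactorization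
    ⟨π, hirr, fun {x} hx => ?_⟩, hirr⟩
  obtain ⟨n, u, hu, rfl⟩ := hfac x hx
  exact ⟨n, hu.unit, rfl⟩

/-! ### The generic residual perfection as a discrete valuation ring. -/

section Generic

variable {p : ℕ} [Fact p.Prime] {A : Type u} [CommRing A] [IsDomain A] [IsDiscreteValuationRing A]
  [CharP (ResidueField A) p] {G : Type u} [CommRing G] [Algebra A G]

theorem IsGenericResidualPerfection.isField (hG : IsGenericResidualPerfection p A G) :
    IsField (G ⧸ extIdeal A G) := by
  obtain ⟨t, ht⟩ := IsDiscreteValuationRing.exists_irreducible A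
  obtain ⟨S, -, hind, hgen⟩ := exists_pBasis (PIndep.empty (p := p) (k := ResidueField A))
  choose x hx using fun s : S => residue_surjective (s : ResidueField A)
  exact (hG.exists_model ht hind hgen x hx).1

/-- Flatness makes `t` regular. Completeness puts `t` in the Jacobson radical, so elements nonzero
in the residue field are units, and it also gives separatedness. -/
theorem IsGenericResidualPerfection.exists_isDiscreteValuationRing
    (hG : IsGenericResidualPerfection p A G) {t : A} (ht : Irreducible t) :
    ∃ _ : IsDomain G, IsDiscreteValuationRing G ∧ Irreducible (algebraMap A G t) := by
  have htm := ht.maximalIdeal_eq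
  have hflat := hG.1.flat
  have hcomp := hG.1.complete
  have hmax : (extIdeal A G).IsMaximal := Ideal.Quotient.maximal_of_isField _ hG.isField
  have hspan : extIdeal A G = Ideal.span {algebraMap A G t} := extIdeal_eq_span htm
  have hjac := IsAdicComplete.le_jacobson_bot (extIdeal A G)
  apply isDVR_of_regular_generator
  · intro x hx
    exact algebraMap_mul_cancel ht.ne_zero (by rw [hx, mul_zero])
  · intro x hx
    have hx' : x ∉ extIdeal A G := by rwa [hspan, Ideal.mem_span_singleton]
    obtain ⟨y, i, hi, hy⟩ := hmax.exists_inv hx'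
    have h1 : IsUnit (y * x) := by
      have := (Ideal.mem_jacobson_bot.mp (hjac hi)) (-1)
      rwa [show i * -1 + 1 = y * x by linear_combination -hy] at this
    exact isUnit_of_mul_isUnit_right h1
  · intro h
    refine hmax.ne_top ?_
    rw [hspan, Ideal.span_singleton_eq_top]
    exact h
  · intro x hx
    refine IsHausdorff.haus hcomp.toIsHausdorff x fun n => ?_
    rw [SModEq.zero, smul_eq_mul, Ideal.mul_top, hspan, Ideal.span_singleton_pow,
      Ideal.mem_span_singleton]
    exact hx n

end Generic

/-! ### Polynomials of the form `T ^ p + t H`, and genericity. -/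

section Digits

open Polynomial

variable {p : ℕ} [Fact p.Prime] {A : Type u} [CommRing A]

/-- If `f = T ^ p + t * H` then the reduction of `H` only depends on `f`. -/
theorem map_eq_of_pow_add_eq [IsDomain A] [IsLocalRing A] [CharP (ResidueField A) p] {t : A}
    (ht : maximalIdeal A = Ideal.span {t}) (ht0 : t ≠ 0)
    {C : Type v} [CommRing C] [Algebra A C] [Module.Flat A C] {F : Type*} [Field F] {π : C →+* F}
    (hker : RingHom.ker π = extIdeal A C) {T T' H H' : C[X]}
    (h : T ^ p + Polynomial.C (algebraMap A C t) * H =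
      T' ^ p + Polynomial.C (algebraMap A C t) * H') : H.map π = H'.map π := by
  obtain ⟨p', hp'⟩ := exists_natCast_eq_mul (p := p) ht
  have hπt : π (algebraMap A C t) = 0 := by
    rw [← RingHom.mem_ker, hker, extIdeal_eq_span ht]
    exact Ideal.mem_span_singleton_self _
  have hp'' : (p : C) = algebraMap A C t * algebraMap A C p' := by
    rw [← map_mul, ← hp', map_natCast]
  have hp3 : (p : C[X]) = Polynomial.C (algebraMap A C t) * Polynomial.C (algebraMap A C p') := by
    rw [← Polynomial.C_mul, ← hp'', map_natCast]
  have hchar : CharP F p := by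
    have h0 : (p : F) = 0 := by
      rw [← map_natCast π, hp'', map_mul, hπt, zero_mul]
    exact (CharP.charP_iff_prime_eq_zero Fact.out).mpr h0
  -- Frobenius is injective on `F[X]`, so `t` divides `T - T'`. As `t` divides `p` and `p ≥ 2`, the
  -- `p`-th powers then agree modulo `t ^ 2`.
  have h1 : T.map π = T'.map π := by
    have := congrArg (Polynomial.map π) h
    simp only [Polynomial.map_add, Polynomial.map_pow, Polynomial.map_mul, Polynomial.map_C, hπt,
      map_zero, zero_mul, add_zero] at this
    exact frobenius_inj F[X] p this
  obtain ⟨D, hD⟩ : Polynomial.C (algebraMap A C t) ∣ T - T' := by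
    rw [Polynomial.C_dvd_iff_dvd_coeff]
    intro i
    rw [← Ideal.mem_span_singleton, ← extIdeal_eq_span ht, ← hker, RingHom.mem_ker,
      ← Polynomial.coeff_map, Polynomial.map_sub, h1, sub_self, Polynomial.coeff_zero]
  obtain ⟨r, hr⟩ := exists_add_pow_prime_eq (Fact.out : p.Prime) T' (T - T')
  rw [add_sub_cancel, hp3, hD] at hr
  obtain ⟨q, hq⟩ : ∃ q, p = q + 2 := ⟨p - 2, by have := (Fact.out : p.Prime).two_le; omega⟩
  have h2 : ∃ E, H' - H = Polynomial.C (algebraMap A C t) * E := by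
    refine ⟨(Polynomial.C (algebraMap A C t) * D) ^ q * D ^ 2 +
      Polynomial.C (algebraMap A C p') * T' * D * r, ?_⟩
    have h3 : Polynomial.C (algebraMap A C t) * (H' - H) = Polynomial.C (algebraMap A C t) *
        (Polynomial.C (algebraMap A C t) * ((Polynomial.C (algebraMap A C t) * D) ^ q * D ^ 2 +
      Polynomial.C (algebraMap A C p') * T' * D * r)) := by
      have h4 : (Polynomial.C (algebraMap A C t) * D) ^ p =
        (Polynomial.C (algebraMap A C t) * D) ^ q * (Polynomial.C (algebraMap A C t) * D) ^ 2 := by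
        rw [← pow_add, ← hq]
      rw [h4] at hr
      linear_combination hr - h
    ext i
    have h5 := congrArg (fun P => P.coeff i) h3
    simp only [Polynomial.coeff_C_mul] at h5
    rw [Polynomial.coeff_C_mul]
    exact algebraMap_mul_cancel ht0 h5
  obtain ⟨E, hE⟩ := h2
  have := congrArg (Polynomial.map π) hE
  simp only [Polynomial.map_sub, Polynomial.map_mul, Polynomial.map_C, hπt, map_zero,
    zero_mul] at this
  exact (sub_eq_zero.mp this).symm

omit [Fact p.Prime] in
theorem eq_expand_of_coeff {R : Type*} [CommRing R] (f : R[X]) (hp : p ≠ 0)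
    (hf : ∀ m, ¬ p ∣ m → f.coeff m = 0) : f = expand R p (contract p f) := by
  ext m
  rw [coeff_expand (Nat.pos_of_ne_zero hp), coeff_contract hp]
  split_ifs with h
  · rw [Nat.div_mul_cancel h]
  · exact hf m h

theorem exists_pow_eq_of_perfect {R : Type*} [CommRing R] [CharP R p]
    (hR : ∀ r : R, ∃ s, s ^ p = r) (f : R[X]) (hf : ∀ m, ¬ p ∣ m → f.coeff m = 0) :
    ∃ g, f = g ^ p := by
  obtain ⟨g, hg⟩ := Polynomial.map_surjective (frobenius R p) hR (contract p f)
  refine ⟨g, ?_⟩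
  rw [← Polynomial.map_frobenius_expand, map_expand, hg]
  exact eq_expand_of_coeff f (Fact.out : p.Prime).ne_zero hf

theorem IsCompleteResidualPerfection.exists_eq_pow_add [IsLocalRing A] [CharP (ResidueField A) p]
    {t : A} (ht : maximalIdeal A = Ideal.span {t})
    {U : Type v} [CommRing U] [Algebra A U] [Nontrivial (U ⧸ extIdeal A U)]
    (hU : IsCompleteResidualPerfection p A U)
    (f : A[X]) (hf : ∀ m, ¬ p ∣ m → residue A (f.coeff m) = 0) :
    ∃ T H : U[X], f.map (algebraMap A U) = T ^ p + C (algebraMap A U t) * H := by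
  have hchar : CharP (U ⧸ extIdeal A U) p := charP_quotient_extIdeal
  obtain ⟨g, hg⟩ := exists_pow_eq_of_perfect (p := p) hU.perfect.2
    ((f.map (algebraMap A U)).map (Ideal.Quotient.mk (extIdeal A U))) (fun m hm => by
      rw [coeff_map, coeff_map, ← residueMap_residue, hf m hm, map_zero])
  obtain ⟨T, rfl⟩ := Polynomial.map_surjective (Ideal.Quotient.mk (extIdeal A U))
    Ideal.Quotient.mk_surjective g
  obtain ⟨H, hH⟩ : C (algebraMap A U t) ∣ f.map (algebraMap A U) - T ^ p := by
    rw [C_dvd_iff_dvd_coeff]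
    intro i
    rw [← Ideal.mem_span_singleton, ← extIdeal_eq_span ht, ← Ideal.Quotient.eq_zero_iff_mem,
      ← coeff_map, Polynomial.map_sub, Polynomial.map_pow, hg, sub_self, coeff_zero]
  exact ⟨T, H, by rw [← hH]; ring⟩

/-- An inseparable irreducible polynomial has a coefficient that is not a `p`-th power. -/
theorem exists_coeff_not_pow {k : Type*} [Field k] [CharP k p] {f : k[X]} (hf : Irreducible f)
    (hs : ¬ f.Separable) : (∀ m, ¬ p ∣ m → f.coeff m = 0) ∧
    ∃ m, p ∣ m ∧ ∀ c : k, c ^ p ≠ f.coeff m := by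
  have hp := (Fact.out : p.Prime)
  rw [separable_iff_derivative_ne_zero hf, not_not] at hs
  have h1 : ∀ m, ¬ p ∣ m → f.coeff m = 0 := by
    intro m hm
    rw [← expand_contract p hs hp.ne_zero, coeff_expand hp.pos, if_neg hm]
  refine ⟨h1, ?_⟩
  by_contra! hcon
  choose! c hc using hcon
  obtain ⟨g, hg⟩ : ∃ g : k[X], g.map (frobenius k p) = f.contract p := by
    rw [← Polynomial.mem_lifts, Polynomial.lifts_iff_coeff_lifts]
    intro n
    refine ⟨c (n * p), ?_⟩
    rw [coeff_contract hp.ne_zero]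
    exact hc _ (dvd_mul_left _ _)
  have h2 : f = g ^ p := by
    rw [← map_frobenius_expand, map_expand, hg, expand_contract p hs hp.ne_zero]
  rw [h2] at hf
  exact not_irreducible_pow hp.ne_one hf

end Digits

section Generic

open Polynomial

variable {p : ℕ} [Fact p.Prime] {A : Type u} [CommRing A] [IsDomain A] [IsDiscreteValuationRing A]
  [CharP (ResidueField A) p] {G : Type u} [CommRing G] [Algebra A G]

theorem exists_residue_factor [IsLocalRing G] (hext : extIdeal A G = maximalIdeal G) {F : Type*}
    [Field F] (j : G ⧸ extIdeal A G →+* F) :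
    ∃ j' : ResidueField G →+* F, ∀ g, j' (residue G g) = j (Ideal.Quotient.mk _ g) :=
  ⟨Ideal.Quotient.lift (maximalIdeal G) (j.comp (Ideal.Quotient.mk (extIdeal A G))) (fun a ha => by
    rw [RingHom.comp_apply, Ideal.Quotient.eq_zero_iff_mem.mpr (hext ▸ ha), map_zero]),
    fun _ => rfl⟩

variable [IsLocalRing G] [IsLocalHom (algebraMap A G)]

/-- The residue field of the generic residual perfection contains only purely inseparable algebraic
extensions of the residue field of `A`. -/
theorem IsGenericResidualPerfection.exists_pow_mem_range (hG : IsGenericResidualPerfection p A G)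
    (hext : extIdeal A G = maximalIdeal G) {r : ResidueField G}
    (hr : IsAlgebraic (ResidueField A) r) :
    ∃ n c, r ^ p ^ n = algebraMap (ResidueField A) (ResidueField G) c := by
  obtain ⟨t, ht⟩ := IsDiscreteValuationRing.exists_irreducible A
  obtain ⟨S, -, hind, hgen⟩ := exists_pBasis (PIndep.empty (p := p) (k := ResidueField A))
  choose x hx using fun s : S => residue_surjective (s : ResidueField A)
  obtain ⟨-, F, _, _, _, C, _, _, W, V, π, j, -, -, -, -, hj, hW, hrad, -⟩ :=
    hG.exists_model ht hind hgen x hx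
  obtain ⟨j', hj'⟩ := exists_residue_factor hext j
  have hjk : ∀ c, j' (algebraMap (ResidueField A) (ResidueField G) c) = algebraMap _ F c := by
    intro c
    obtain ⟨a, rfl⟩ := residue_surjective c
    rw [ResidueField.algebraMap_residue, hj', ← hj, residueMap_residue]
  let f' : ResidueField G →ₐ[ResidueField A] F := { j' with commutes' := hjk }
  have halg : IsAlgebraic (ResidueField A) (j' r) := hr.algHom f'
  obtain ⟨g, rfl⟩ := residue_surjective r
  obtain ⟨n, P, P', hP', h⟩ := hrad (Ideal.Quotient.mk _ g)
  rw [← hj', ← map_pow] at h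
  obtain ⟨c, hc⟩ := hW.mem_range_of_isAlgebraic (by rw [map_pow]; exact halg.pow _) hP' h
  exact ⟨n, c, j'.injective (by rw [hjk, ← hc])⟩

/-- Genericity: a lift of an inseparable irreducible polynomial is, over the generic residual
perfection, a `p`-th power up to a multiple of the uniformizer by a coprime polynomial. -/
theorem IsGenericResidualPerfection.exists_isCoprime (hG : IsGenericResidualPerfection p A G)
    (hext : extIdeal A G = maximalIdeal G) {t : A} (ht : Irreducible t) {f : A[X]} (hf : f.Monic)
    (hirr : Irreducible (f.map (residue A))) (hsep : ¬ (f.map (residue A)).Separable) :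
    ∃ T H : G[X], f.map (algebraMap A G) = T ^ p + C (algebraMap A G t) * H ∧
      IsCoprime ((f.map (residue A)).map (algebraMap (ResidueField A) (ResidueField G)))
        (H.map (residue G)) := by
  have htm := ht.maximalIdeal_eq
  obtain ⟨hf', m₀, hpm₀, hm₀⟩ := exists_coeff_not_pow (p := p) hirr hsep
  simp only [coeff_map] at hf' hm₀
  have hm₀' : m₀ < f.natDegree := by
    by_contra! h
    rcases h.eq_or_lt with h | h
    · exact hm₀ 1 (by rw [← h, hf.coeff_natDegree]; simp)
    · exact hm₀ 0 (by rw [coeff_eq_zero_of_natDegree_lt h]; simp [(Fact.out : p.Prime).ne_zero])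
  -- The residue of this coefficient joins the `p`-basis, and the coefficient itself is taken as its
  -- lift. Its first remainder `W q₀` is the element to be isolated.
  obtain ⟨S, hbS, hind, hgen⟩ := exists_pBasis_mem _ hm₀
  have hlift : ∀ s : S, ∃ a, residue A a = s ∧
      ((s : ResidueField A) = residue A (f.coeff m₀) → a = f.coeff m₀) := by
    intro s
    by_cases h : (s : ResidueField A) = residue A (f.coeff m₀)
    · exact ⟨f.coeff m₀, h.symm, fun _ => rfl⟩
    · obtain ⟨a, ha⟩ := residue_surjective (s : ResidueField A)
      exact ⟨a, ha, fun h' => absurd h' h⟩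
  choose x hx hxb using hlift
  obtain ⟨-, F, _, _, _, C, _, _, W, V, π, j, hflat, hVW, hker, hπ, hj, hW, -, U, _, _, φ, g, hU,
    hφg⟩ := hG.exists_model ht hind hgen x hx
  let q₀ : S × ℕ := (⟨_, hbS⟩, 0)
  let R₀ := algebraicOver (ResidueField A) (fun q => π (W q)) q₀
  have hι : ∀ c, algebraMap (ResidueField A) F c ∈ R₀ := fun c =>
    mem_algebraicOver_of_isAlgebraic (isAlgebraic_algebraMap c)
  have hπt : π (algebraMap A C t) = 0 := by rw [hπ, residue_uniformizer htm, map_zero]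
  have hV : ∀ s, π (V s) ∈ R₀ := by
    intro s
    refine mem_algebraicOver_of_isAlgebraic (IsAlgebraic.of_pow (Fact.out : p.Prime).pos ?_)
    have := congrArg π (hVW s)
    rw [hπ, map_add, map_mul, hπt, zero_mul, add_zero, map_pow] at this
    rw [← this]
    exact isAlgebraic_algebraMap _
  have hb : HasRootExpansion p t π (algebraMap (ResidueField A) F) R₀ (π (W q₀)) (f.coeff m₀) 1 := by
    refine ⟨V q₀.1, W q₀, ?_, hV _, by simp⟩
    rw [← hxb q₀.1 rfl]
    exact hVW q₀.1
  have hS : ∀ s, ∃ u, HasRootExpansion p t π (algebraMap (ResidueField A) F) R₀ (π (W q₀)) (x s) u := by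
    intro s
    by_cases h : (s : ResidueField A) = residue A (f.coeff m₀)
    · rw [hxb s h]
      exact ⟨1, hb⟩
    · refine ⟨0, V s, W (s, 0), hVW s, hV s, ?_⟩
      rw [map_zero, zero_mul, sub_zero]
      exact mem_algebraicOver_of_ne (W := fun q => π (W q)) (q₀ := q₀) (q := (s, 0)) fun h' =>
        h (congrArg (fun q : S × ℕ => (q.1 : ResidueField A)) h')
  obtain ⟨T, H, H₀, H₁, hTH, hH, hH₀, hH₁, hdeg⟩ := exists_polynomial_expansion htm hπ hι hf hf'
    (exists_hasRootExpansion htm hπ hι hgen x hx hS) hb hpm₀ hm₀'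
  have hnt : Nontrivial (U ⧸ extIdeal A U) := by
    refine ⟨0, 1, fun h => ?_⟩
    have h1 : (1 : U) ∈ extIdeal A U := Ideal.Quotient.eq_zero_iff_mem.mp h.symm
    have h2 : (1 : G) ∈ extIdeal A G := by
      have := Ideal.mem_map_of_mem φ.toRingHom h1
      rw [extIdeal, Ideal.map_map, AlgHom.toRingHom_eq_coe, φ.comp_algebraMap] at this
      simpa using this
    rw [hext] at h2
    exact (maximalIdeal.isMaximal G).ne_top (Ideal.eq_top_of_isUnit_mem _ h2 isUnit_one)
  -- The universal residual perfection links `G` and `C`: an expansion over `U` maps to both. Over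
  -- `C` its `H` may differ from the one computed explicitly, but not modulo `t`.
  obtain ⟨TU, HU, hTHU⟩ := hU.exists_eq_pow_add htm f hf'
  have hmapU : ∀ {D : Type u} [CommRing D] [Algebra A D] (ψ : U →ₐ[A] D),
      f.map (algebraMap A D) = (TU.map ψ.toRingHom) ^ p +
        Polynomial.C (algebraMap A D t) * HU.map ψ.toRingHom := by
    intro D _ _ ψ
    have := congrArg (Polynomial.map ψ.toRingHom) hTHU
    rw [Polynomial.map_map, AlgHom.toRingHom_eq_coe, ψ.comp_algebraMap] at this
    rw [this]
    simp
  have hHg := map_eq_of_pow_add_eq htm ht.ne_zero hker ((hmapU g).symm.trans hTH)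
  refine ⟨TU.map φ.toRingHom, HU.map φ.toRingHom, hmapU φ, ?_⟩
  obtain ⟨j', hj'⟩ := exists_residue_factor hext j
  have hjk : j'.comp (algebraMap (ResidueField A) (ResidueField G)) = algebraMap _ F := by
    ext c
    obtain ⟨a, rfl⟩ := residue_surjective c
    rw [RingHom.comp_apply, ResidueField.algebraMap_residue, hj', ← hj, residueMap_residue]
  have hjf : ((f.map (residue A)).map (algebraMap (ResidueField A) (ResidueField G))).map j' =
      (f.map (residue A)).map (algebraMap _ F) :=
    (Polynomial.map_map _ _ _).trans (by rw [hjk])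
  have hjH : ((HU.map φ.toRingHom).map (residue G)).map j' = H.map π := by
    rw [← hHg, Polynomial.map_map, Polynomial.map_map, Polynomial.map_map]
    congr 1
    ext r
    exact (hj' _).trans (hφg r)
  rw [← Polynomial.isCoprime_map j', hjf, hjH, hH,
    Polynomial.isCoprime_iff_aeval_ne_zero_of_isAlgClosed F F]
  intro a
  by_cases ha : aeval a (f.map (residue A)) = 0
  · right
    rw [coe_aeval_eq_eval]
    refine hW.eval_ne_zero q₀ hirr hH₀ (fun h => by simp [h] at hH₁) ?_ ha
    rwa [hf.degree_map, degree_eq_natDegree hf.ne_zero]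
  · left
    rwa [coe_aeval_eq_eval, eval_map_algebraMap]

end Generic

/-! ### Minimal polynomials under extensions with only radicial algebraic elements. -/

section Radicial

open Polynomial

variable {p : ℕ} [Fact p.Prime] {k κ : Type*} [Field k] [Field κ] [Algebra k κ]

theorem exists_uniform_pow_mem_range {s : κ[X]}
    (hs : ∀ m, ∃ n c, s.coeff m ^ p ^ n = algebraMap k κ c) :
    ∃ N, ∀ m, s.coeff m ^ p ^ N ∈ (algebraMap k κ).range := by
  choose n c hc using hs
  obtain ⟨N, hnN⟩ : ∃ N, ∀ m ∈ Finset.range (s.natDegree + 1), n m ≤ N :=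
    ⟨_, fun m hm => Finset.le_sup (f := n) hm⟩
  refine ⟨N, fun m => ?_⟩
  by_cases hm : m ∈ Finset.range (s.natDegree + 1)
  · obtain ⟨d, hd⟩ := Nat.exists_eq_add_of_le (hnN m hm)
    rw [hd, pow_add, pow_mul, hc]
    exact pow_mem ((algebraMap k κ).mem_range_self _) _
  · rw [coeff_eq_zero_of_natDegree_lt (by simpa using hm),
      zero_pow (pow_ne_zero _ (Fact.out : p.Prime).ne_zero)]
    exact zero_mem _

/-- In characteristic `p`, raising `s` to the power `p ^ N` raises its coefficients to that power
and replaces `X` by `X ^ p ^ N`. -/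
theorem exists_map_eq_pow [CharP κ p] {s : κ[X]} {N : ℕ}
    (hN : ∀ m, s.coeff m ^ p ^ N ∈ (algebraMap k κ).range) :
    ∃ r : k[X], r.map (algebraMap k κ) = s ^ p ^ N := by
  rw [← map_iterateFrobenius_expand, ← mem_lifts, lifts_iff_coeff_lifts]
  intro m
  rw [coeff_map, coeff_expand (pow_pos (Fact.out : p.Prime).pos N)]
  split_ifs
  · rw [iterateFrobenius_def]
    exact hN _
  · rw [map_zero]
    exact zero_mem (algebraMap k κ).range

/-- The coefficients of a monic factor of `g` are algebraic over `k`, hence radicial, so some `s ^ p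
^ N` descends to `k[X]`. If `g` did not divide the descended polynomial, it would be coprime to it,
although both are divisible by `s`. -/
theorem exists_dvd_pow_of_dvd_map [CharP k p]
    (hrad : ∀ r : κ, IsAlgebraic k r → ∃ n c, r ^ p ^ n = algebraMap k κ c)
    {g : k[X]} (hg : Irreducible g) (hgm : g.Monic) {s : κ[X]} (hs : s.Monic)
    (hs1 : ¬ IsUnit s) (hsg : s ∣ g.map (algebraMap k κ)) :
    ∃ N, N ≠ 0 ∧ g.map (algebraMap k κ) ∣ s ^ N := by
  have hchar : CharP κ p := charP_of_injective_algebraMap (algebraMap k κ).injective p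
  have hcoeff : ∀ m, IsAlgebraic k (s.coeff m) := by
    intro m
    have := integralClosure.mem_lifts_of_monic_of_dvd_map κ hgm hs hsg
    rw [lifts_iff_coeff_lifts] at this
    obtain ⟨y, hy⟩ := this m
    rw [← hy]
    exact IsIntegral.isAlgebraic y.2
  obtain ⟨N, hN⟩ := exists_uniform_pow_mem_range fun m => hrad _ (hcoeff m)
  have hpN : p ^ N ≠ 0 := pow_ne_zero _ (Fact.out : p.Prime).ne_zero
  obtain ⟨r, hr⟩ := exists_map_eq_pow hN
  refine ⟨p ^ N, hpN, ?_⟩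
  rw [← hr]
  refine map_dvd (mapRingHom (algebraMap k κ)) ?_
  by_contra h
  have h1 := (hg.coprime_iff_not_dvd.mpr h).map (mapRingHom (algebraMap k κ))
  simp only [coe_mapRingHom, hr] at h1
  exact hs1 (h1.isUnit_of_dvd' hsg (dvd_pow_self s hpN))

theorem natSepDegree_eq_of_dvd_pow {s : κ[X]} {g : k[X]} (hg0 : g ≠ 0) (hs0 : s ≠ 0)
    (hsg : s ∣ g.map (algebraMap k κ)) {N : ℕ} (hN : N ≠ 0)
    (hgs : g.map (algebraMap k κ) ∣ s ^ N) : s.natSepDegree = g.natSepDegree := by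
  rw [← natSepDegree_map κ g (algebraMap k κ)]
  refine le_antisymm (natSepDegree_le_of_dvd _ _ hsg ?_) ?_
  · exact (Polynomial.map_ne_zero_iff (algebraMap k κ).injective).mpr hg0
  · rw [← natSepDegree_pow_of_ne_zero s hN]
    exact natSepDegree_le_of_dvd _ _ hgs (pow_ne_zero _ hs0)

end Radicial

theorem IsDiscreteValuationRing.exists_dvd_pow {B : Type*} [CommRing B] [IsDomain B]
    [IsDiscreteValuationRing B] {t : B} (ht : t ≠ 0) {b : B} (hb : b ∈ IsLocalRing.maximalIdeal B) :
    ∃ N, t ∣ b ^ N := by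
  obtain ⟨ϖ, hϖ⟩ := IsDiscreteValuationRing.exists_irreducible B
  obtain ⟨n, hn⟩ := IsDiscreteValuationRing.associated_pow_irreducible ht hϖ
  rw [hϖ.maximalIdeal_eq, Ideal.mem_span_singleton] at hb
  exact ⟨n, hn.dvd.trans (pow_dvd_pow_of_dvd hb n)⟩

/-! ### The base change of a monogenic extension. -/

section Fibre

set_option linter.unusedSectionVars false

open Polynomial

variable {p : ℕ} [Fact p.Prime] {A B G R : Type*} [CommRing A] [IsLocalRing A]
  [CharP (ResidueField A) p]
  [CommRing B] [IsDomain B] [IsDiscreteValuationRing B] [Algebra A B] [Module.Finite A B]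
  [FaithfulSMul A B] [IsLocalHom (algebraMap A B)]
  [CommRing G] [IsLocalRing G] [Algebra A G] [IsLocalHom (algebraMap A G)]
  [CommRing R] [Algebra A R] [Algebra B R] [Algebra G R] [IsScalarTower A B R] [IsScalarTower A G R]
  {t : A} {x : B}

theorem aeval_sub_mem_span (htG : maximalIdeal G = Ideal.span {algebraMap A G t}) {P Q : G[X]}
    (h : P.map (residue G) = Q.map (residue G)) (y : R) :
    aeval y P - aeval y Q ∈ Ideal.span {algebraMap A R t} := by
  obtain ⟨D, hD⟩ : C (algebraMap A G t) ∣ P - Q := by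
    rw [C_dvd_iff_dvd_coeff]
    intro i
    rw [← Ideal.mem_span_singleton, ← htG, ← residue_eq_zero_iff, ← coeff_map, Polynomial.map_sub,
      h, sub_self, coeff_zero]
  rw [← map_sub, hD, map_mul, aeval_C, ← IsScalarTower.algebraMap_apply, Ideal.mem_span_singleton]
  exact dvd_mul_right _ _

theorem exists_monic_lift {A : Type*} [CommRing A] [IsLocalRing A] {g : (ResidueField A)[X]}
    (hg : g.Monic) : ∃ f : A[X], f.map (residue A) = g ∧ f.Monic := by
  obtain ⟨f, hf, -, hf'⟩ := lifts_and_natDegree_eq_and_monic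
    (mem_lifts g |>.mpr (map_surjective _ residue_surjective g)) hg
  exact ⟨f, hf, hf'⟩

variable (htG : maximalIdeal G = Ideal.span {algebraMap A G t}) (ht0 : t ≠ 0)
  (hrad : ∀ r : ResidueField G, IsAlgebraic (ResidueField A) r →
    ∃ n c, r ^ p ^ n = algebraMap (ResidueField A) (ResidueField G) c)
  (hgen : Algebra.adjoin G {algebraMap B R x} = ⊤)
  {E : Type*} [Field E] [Algebra (ResidueField A) E] [Algebra (ResidueField G) E]
  [IsScalarTower (ResidueField A) (ResidueField G) E] {ρ : R →+* E}
  (hρ : ∀ g, ρ (algebraMap G R g) = algebraMap _ E (residue G g))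

include hρ in
theorem map_algebraMap_eq (a : A) : ρ (algebraMap A R a) = algebraMap _ E (residue A a) := by
  rw [IsScalarTower.algebraMap_apply A G R, hρ, ← ResidueField.algebraMap_residue,
    ← IsScalarTower.algebraMap_apply]

include hρ htG in
theorem span_le_ker : Ideal.span {algebraMap A R t} ≤ RingHom.ker ρ := by
  rw [Ideal.span_singleton_le_iff_mem, RingHom.mem_ker, IsScalarTower.algebraMap_apply A G R, hρ,
    (residue_eq_zero_iff _).mpr (htG ▸ Ideal.mem_span_singleton_self _), map_zero]

include hρ in
theorem map_aeval_eq (P : G[X]) (y : R) :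
    ρ (aeval y P) = aeval (ρ y) (P.map (residue G)) :=
  map_aeval_eq_aeval_map (RingHom.ext fun g => (hρ g).symm) P y

include ht0 in
theorem map_mem_radical_span {b : B} (hb : b ∈ maximalIdeal B) :
    algebraMap B R b ∈ (Ideal.span {algebraMap A R t}).radical := by
  have htB : algebraMap A B t ≠ 0 := fun h =>
    ht0 (FaithfulSMul.algebraMap_injective A B (h.trans (map_zero _).symm))
  obtain ⟨N, hN⟩ := IsDiscreteValuationRing.exists_dvd_pow htB hb
  refine ⟨N, ?_⟩
  rw [← map_pow, Ideal.mem_span_singleton, IsScalarTower.algebraMap_apply A B R]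
  exact map_dvd _ hN

include ht0 in
theorem aeval_mem_radical_span {g : A[X]} (hg : aeval (residue B x) (g.map (residue A)) = 0) :
    aeval (algebraMap B R x) g ∈ (Ideal.span {algebraMap A R t}).radical := by
  rw [aeval_algebraMap_apply]
  refine map_mem_radical_span ht0 ?_
  rw [← residue_eq_zero_iff, map_aeval_eq_aeval_map (φ := residue A), hg]
  exact RingHom.ext fun a => ResidueField.algebraMap_residue a

include htG ht0 hρ in
-- For a lift `g` of the minimal polynomial over `k`, the value `g(x)` lies in the maximal ideal of
-- `B`. It is therefore nilpotent modulo `t` and killed by `ρ`.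
theorem minpoly_dvd_map : minpoly (ResidueField G) (ρ (algebraMap B R x)) ∣
    (minpoly (ResidueField A) (residue B x)).map (algebraMap _ _) := by
  have hint : IsIntegral (ResidueField A) (residue B x) :=
    (Algebra.IsIntegral.isIntegral (R := A) x).map_of_comp_eq (residue A) (residue B)
      (RingHom.ext fun a => ResidueField.algebraMap_residue a)
  obtain ⟨g, hg, -⟩ := exists_monic_lift (minpoly.monic hint)
  apply minpoly.dvd
  have h := aeval_mem_radical_span (R := R) ht0 (by rw [hg, minpoly.aeval] : aeval (residue B x) (g.map (residue A)) = 0)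
  have h2 : ρ (aeval (algebraMap B R x) g) = 0 := by
    have : (Ideal.span {algebraMap A R t}).radical ≤ RingHom.ker ρ :=
      (Ideal.IsRadical.radical_le_iff (RingHom.ker_isPrime ρ).isRadical).mpr (span_le_ker htG hρ)
    exact this h
  rw [aeval_map_algebraMap, ← hg, ← h2]
  exact (map_aeval_eq_aeval_map (φ := residue A) (ψ := ρ)
    (RingHom.ext fun a => (map_algebraMap_eq hρ a).symm) g _).symm

include htG ht0 hρ hrad in
theorem minpoly_dvd_pow : ∃ N, N ≠ 0 ∧
    (minpoly (ResidueField A) (residue B x)).map (algebraMap _ _) ∣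
      minpoly (ResidueField G) (ρ (algebraMap B R x)) ^ N := by
  have hint : IsIntegral (ResidueField A) (residue B x) :=
    (Algebra.IsIntegral.isIntegral (R := A) x).map_of_comp_eq (residue A) (residue B)
      (RingHom.ext fun a => ResidueField.algebraMap_residue a)
  have hd := minpoly_dvd_map (x := x) htG ht0 hρ
  have hint' : IsIntegral (ResidueField G) (ρ (algebraMap B R x)) := by
    by_contra h
    rw [minpoly.eq_zero h, zero_dvd_iff, Polynomial.map_eq_zero] at hd
    exact minpoly.ne_zero hint hd
  exact exists_dvd_pow_of_dvd_map hrad (minpoly.irreducible hint) (minpoly.monic hint)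
    (minpoly.monic hint') (minpoly.not_isUnit _ _) hd

include htG hgen hρ in
-- Since `R = G[x]`, write `z = P(x)`. The reduction of `P` is a multiple of the minimal polynomial,
-- and lifting the cofactor costs a multiple of `t`.
theorem exists_eq_of_map_eq_zero {S : G[X]}
    (hS : S.map (residue G) = minpoly (ResidueField G) (ρ (algebraMap B R x))) {z : R}
    (hz : ρ z = 0) : z ∈ Ideal.span {algebraMap A R t, aeval (algebraMap B R x) S} := by
  have h1 : z ∈ Algebra.adjoin G {algebraMap B R x} := hgen ▸ Algebra.mem_top
  rw [Algebra.adjoin_singleton_eq_range_aeval] at h1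
  obtain ⟨P, rfl⟩ := h1
  have h2 : ρ (aeval (algebraMap B R x) P) = 0 := hz
  rw [map_aeval_eq hρ] at h2
  obtain ⟨Q, hQ⟩ := minpoly.dvd _ _ h2
  obtain ⟨Q, rfl⟩ := map_surjective (residue G) residue_surjective Q
  rw [← hS, ← Polynomial.map_mul] at hQ
  have h3 := aeval_sub_mem_span htG hQ (algebraMap B R x)
  rw [Ideal.span_insert]
  change aeval (algebraMap B R x) P ∈ _
  rw [← sub_add_cancel (aeval (algebraMap B R x) P) (aeval (algebraMap B R x) (S * Q))]
  refine add_mem (Ideal.mem_sup_left h3) (Ideal.mem_sup_right ?_)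
  rw [map_mul, Ideal.mem_span_singleton]
  exact dvd_mul_right _ _

include htG ht0 hrad hgen hρ in
-- Modulo `t`, a power of `S(x)` is a multiple of `g(x)`, which is nilpotent modulo `t`. So both
-- generators of the kernel of `ρ` are nilpotent modulo `t`.
theorem mem_radical_of_map_eq_zero {z : R} (hz : ρ z = 0) :
    z ∈ (Ideal.span {algebraMap A R t}).radical := by
  obtain ⟨S, hS⟩ := map_surjective (residue G) residue_surjective
    (minpoly (ResidueField G) (ρ (algebraMap B R x)))
  have h1 := exists_eq_of_map_eq_zero htG hgen hρ hS hz
  have h2 : Ideal.span {algebraMap A R t, aeval (algebraMap B R x) S} ≤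
      (Ideal.span {algebraMap A R t}).radical := by
    rw [Ideal.span_insert, sup_le_iff, Ideal.span_singleton_le_iff_mem _ (x := aeval _ _)]
    refine ⟨Ideal.le_radical, ?_⟩
    obtain ⟨N, -, hN⟩ := minpoly_dvd_pow (x := x) htG ht0 hrad hρ
    obtain ⟨g, hg⟩ := map_surjective (residue A) residue_surjective
      (minpoly (ResidueField A) (residue B x))
    have h3 := aeval_mem_radical_span (R := R) ht0
      (by rw [hg, minpoly.aeval] : aeval (residue B x) (g.map (residue A)) = 0)
    have h4 : (g.map (algebraMap A G)).map (residue G) =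
        (minpoly (ResidueField A) (residue B x)).map (algebraMap _ _) := by
      rw [← hg, Polynomial.map_map, Polynomial.map_map]
      congr 1
    obtain ⟨Q, hQ⟩ := hN
    obtain ⟨Q, rfl⟩ := map_surjective (residue G) residue_surjective Q
    rw [← h4, ← hS, ← Polynomial.map_pow, ← Polynomial.map_mul] at hQ
    have h5 := Ideal.le_radical (aeval_sub_mem_span htG hQ (algebraMap B R x))
    rw [map_mul, aeval_map_algebraMap] at h5
    have h6 := add_mem h5 (Ideal.mul_mem_right (aeval (algebraMap B R x) Q) _ h3)
    rw [sub_add_cancel, map_pow] at h6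
    exact (Ideal.radical_isRadical _) ⟨N, h6⟩
  exact h2 h1

end Fibre

theorem isDVR_of_maximalIdeal_eq_span {R : Type u} [CommRing R] [IsLocalRing R] [IsNoetherianRing R]
    {t y : R} (ht : ∀ z, t * z = 0 → z = 0) (htm : t ∈ maximalIdeal R)
    (hy : maximalIdeal R = Ideal.span {y}) : IsDVR R := by
  have hm : ∀ z, z ∈ maximalIdeal R ↔ y ∣ z := fun z => by rw [hy, Ideal.mem_span_singleton]
  obtain ⟨c, rfl⟩ := (hm t).mp htm
  obtain ⟨h1, h2, -⟩ := isDVR_of_regular_generator (R := R) (π := y)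
    (fun z hz => ht z (by rw [mul_right_comm, hz, zero_mul]))
    (fun z hz => by rwa [← hm, mem_maximalIdeal, mem_nonunits_iff, not_not] at hz)
    (by rw [← mem_nonunits_iff, ← mem_maximalIdeal, hm])
    (fun z hz => by
      have : z ∈ ⨅ i, Ideal.span {y} ^ i := by
        rw [Ideal.mem_iInf]
        intro i
        rw [Ideal.span_singleton_pow, Ideal.mem_span_singleton]
        exact hz i
      rwa [Ideal.iInf_pow_eq_bot_of_isLocalRing _ (hy ▸ (maximalIdeal.isMaximal R).ne_top)] at this)
  exact ⟨h1, h2⟩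

/-- Nakayama: `y` generates the maximal ideal modulo its square. -/
theorem maximalIdeal_eq_span_of_mem_sq {R : Type*} [CommRing R] [IsLocalRing R] [IsNoetherianRing R]
    {t y : R} (hm : maximalIdeal R = Ideal.span {t, y}) (ht : t ∈ maximalIdeal R ^ 2) :
    maximalIdeal R = Ideal.span {y} := by
  refine le_antisymm ?_ (hm ▸ Ideal.span_mono (by simp))
  refine Submodule.le_of_le_smul_of_le_jacobson_bot (I := maximalIdeal R) (IsNoetherian.noetherian _)
    (maximalIdeal_le_jacobson _) ?_
  conv_lhs => rw [hm]
  rw [Ideal.span_insert, sup_comm]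
  refine sup_le_sup le_rfl ?_
  rw [Ideal.span_singleton_le_iff_mem, smul_eq_mul, ← sq]
  exact ht

section Fibre

set_option linter.unusedSectionVars false

open Polynomial

variable {p : ℕ} [Fact p.Prime] {A B G : Type*} {R : Type u} [CommRing A] [IsLocalRing A]
  [CharP (ResidueField A) p]
  [CommRing B] [IsDomain B] [IsDiscreteValuationRing B] [Algebra A B] [Module.Finite A B]
  [FaithfulSMul A B] [IsLocalHom (algebraMap A B)]
  [CommRing G] [IsLocalRing G] [Algebra A G] [IsLocalHom (algebraMap A G)]
  [CommRing R] [Algebra A R] [Algebra B R] [Algebra G R] [IsScalarTower A B R] [IsScalarTower A G R]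
  {t : A} {x : B}
  (htG : maximalIdeal G = Ideal.span {algebraMap A G t}) (ht0 : t ≠ 0)
  (hrad : ∀ r : ResidueField G, IsAlgebraic (ResidueField A) r →
    ∃ n c, r ^ p ^ n = algebraMap (ResidueField A) (ResidueField G) c)

include htG ht0 hrad in
-- By integrality every maximal ideal of `R` lies over that of `G`, and by
-- `mem_radical_of_map_eq_zero` it equals the radical of `(t)`.
theorem isLocalRing_of_adjoin_eq_top [Algebra.IsIntegral G R] [Nontrivial R]
    (hgen : Algebra.adjoin G {algebraMap B R x} = ⊤) : IsLocalRing R := by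
  have hcomap : ∀ M : Ideal R, M.IsMaximal → M.comap (algebraMap G R) = maximalIdeal G :=
    fun M hM => eq_maximalIdeal (Ideal.isMaximal_comap_of_isIntegral_of_isMaximal M)
  have key : ∀ M : Ideal R, M.IsMaximal → M ≤ (Ideal.span {algebraMap A R t}).radical := by
    intro M hM z hz
    let fE : Field (R ⧸ M) := Ideal.Quotient.field M
    let κE : Algebra (ResidueField G) (R ⧸ M) := (Ideal.Quotient.lift (maximalIdeal G)
      ((Ideal.Quotient.mk M).comp (algebraMap G R)) (fun a ha => by
        rw [← hcomap M hM, Ideal.mem_comap] at ha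
        exact Ideal.Quotient.eq_zero_iff_mem.mpr ha)).toAlgebra
    let kE : Algebra (ResidueField A) (R ⧸ M) := ((algebraMap (ResidueField G) (R ⧸ M)).comp
      (algebraMap (ResidueField A) (ResidueField G))).toAlgebra
    have tower : IsScalarTower (ResidueField A) (ResidueField G) (R ⧸ M) :=
      IsScalarTower.of_algebraMap_eq fun _ => rfl
    exact mem_radical_of_map_eq_zero (E := R ⧸ M) (ρ := Ideal.Quotient.mk M) htG ht0 hrad hgen
      (fun g => rfl) (Ideal.Quotient.eq_zero_iff_mem.mpr hz)
  have hle : ∀ M : Ideal R, M.IsMaximal → (Ideal.span {algebraMap A R t}).radical ≤ M := by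
    intro M hM
    rw [Ideal.IsRadical.radical_le_iff hM.isPrime.isRadical, Ideal.span_singleton_le_iff_mem,
      IsScalarTower.algebraMap_apply A G R, ← Ideal.mem_comap, hcomap M hM, htG]
    exact Ideal.mem_span_singleton_self _
  obtain ⟨M, hM⟩ := Ideal.exists_maximal R
  exact IsLocalRing.of_unique_max_ideal ⟨M, hM, fun M' hM' =>
    (hM.eq_of_le hM'.ne_top ((key M hM).trans (hle M' hM'))).symm⟩

/-- If `g(x) = t b` with `b = P(x)`, subtracting `t (P %ₘ g)` leaves the value `t g(x) Q(x) = t ^ 2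
b Q(x)`, where `Q = P /ₘ g`. Using the remainder rather than `P` keeps the polynomial monic. -/
theorem exists_monic_aeval_eq (htA : maximalIdeal A = Ideal.span {t})
    (htB : maximalIdeal B = Ideal.span {algebraMap A B t}) (hx : Algebra.adjoin A {x} = ⊤) :
    ∃ (f : A[X]) (b : B), f.Monic ∧
      f.map (residue A) = minpoly (ResidueField A) (residue B x) ∧
      aeval x f = algebraMap A B t ^ 2 * b := by
  have hint : IsIntegral (ResidueField A) (residue B x) :=
    (Algebra.IsIntegral.isIntegral (R := A) x).map_of_comp_eq (residue A) (residue B)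
      (RingHom.ext fun a => ResidueField.algebraMap_residue a)
  obtain ⟨g, hg, hgm⟩ := exists_monic_lift (minpoly.monic hint)
  have h1 : aeval x g ∈ maximalIdeal B := by
    rw [← residue_eq_zero_iff, map_aeval_eq_aeval_map (φ := residue A), hg, minpoly.aeval]
    exact RingHom.ext fun a => ResidueField.algebraMap_residue a
  rw [htB, Ideal.mem_span_singleton] at h1
  obtain ⟨b, hb⟩ := h1
  have h2 : b ∈ Algebra.adjoin A {x} := hx ▸ Algebra.mem_top
  rw [Algebra.adjoin_singleton_eq_range_aeval] at h2
  obtain ⟨P, hP⟩ := h2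
  replace hP : aeval x P = b := hP
  have hdeg : (C t * (P %ₘ g)).degree < g.degree :=
    (smul_eq_C_mul (p := P %ₘ g) t ▸ degree_smul_le t (P %ₘ g)).trans_lt (degree_modByMonic_lt P hgm)
  refine ⟨g - C t * (P %ₘ g), b * aeval x (P /ₘ g), hgm.sub_of_left hdeg, ?_, ?_⟩
  · rw [Polynomial.map_sub, Polynomial.map_mul, Polynomial.map_C, residue_uniformizer htA, hg,
      Polynomial.C_0, zero_mul, sub_zero]
  · have h3 := congrArg (aeval x) (modByMonic_add_div P g)
    rw [map_add, map_mul, hb, hP] at h3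
    rw [map_sub, map_mul, aeval_C, hb]
    linear_combination (-algebraMap A B t) * h3

variable [IsLocalRing R] [IsLocalHom (algebraMap G R)] [IsLocalHom (algebraMap A R)]

include htG ht0 hrad in
theorem mem_sq_or_maximalIdeal_eq
    (hcop : ∀ f : A[X], f.Monic → Irreducible (f.map (residue A)) →
      ¬ (f.map (residue A)).Separable → ∃ T H : G[X],
        f.map (algebraMap A G) = T ^ p + C (algebraMap A G t) * H ∧
        IsCoprime ((f.map (residue A)).map (algebraMap (ResidueField A) (ResidueField G)))
          (H.map (residue G)))
    (htA : maximalIdeal A = Ideal.span {t})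
    (hx : Algebra.adjoin A {x} = ⊤) (hgen : Algebra.adjoin G {algebraMap B R x} = ⊤) :
    algebraMap A R t ∈ maximalIdeal R ^ 2 ∨ maximalIdeal R = Ideal.span {algebraMap A R t} := by
  have hρ : ∀ g, residue R (algebraMap G R g) = algebraMap _ (ResidueField R) (residue G g) :=
    fun g => (ResidueField.algebraMap_residue g).symm
  have hspan : Ideal.span {algebraMap A R t} ≤ maximalIdeal R :=
    (span_le_ker htG hρ).trans ker_residue.le
  have hsrad : (Ideal.span {algebraMap A R t}).radical ≤ maximalIdeal R :=
    (Ideal.IsRadical.radical_le_iff (maximalIdeal.isMaximal R).isPrime.isRadical).mpr hspan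
  have htR : algebraMap A R t ∈ maximalIdeal R := hspan (Ideal.mem_span_singleton_self _)
  by_cases hB : maximalIdeal B = Ideal.span {algebraMap A B t}
  · obtain ⟨f, b, hf, hfg, hfb⟩ := exists_monic_aeval_eq htA hB hx
    have hint : IsIntegral (ResidueField A) (residue B x) :=
      (Algebra.IsIntegral.isIntegral (R := A) x).map_of_comp_eq (residue A) (residue B)
        (RingHom.ext fun a => ResidueField.algebraMap_residue a)
    have hirr := minpoly.irreducible hint
    have hd := minpoly_dvd_map (x := x) htG ht0 hρ
    have hfb' : aeval (algebraMap B R x) f = algebraMap A R t ^ 2 * algebraMap B R b := by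
      rw [aeval_algebraMap_apply, hfb, map_mul, map_pow, ← IsScalarTower.algebraMap_apply]
    by_cases hsep : (minpoly (ResidueField A) (residue B x)).Separable
    · right
      obtain ⟨N, -, hN⟩ := minpoly_dvd_pow (x := x) htG ht0 hrad hρ
      -- A separable polynomial is squarefree, so it divides `S` itself modulo `t`. Hence `S(x)` is
      -- a multiple of `f(x)` modulo `t`, that is, zero.
      have hdvd := (hsep.map (f := algebraMap (ResidueField A) (ResidueField G))).squarefree.isRadical
        _ _ hN
      obtain ⟨S, hS⟩ := map_surjective (residue G) residue_surjective
        (minpoly (ResidueField G) (residue R (algebraMap B R x)))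
      obtain ⟨Q, hQ⟩ := hdvd
      obtain ⟨Q, rfl⟩ := map_surjective (residue G) residue_surjective Q
      have h4 : (f.map (algebraMap A G)).map (residue G) =
          (minpoly (ResidueField A) (residue B x)).map (algebraMap _ _) := by
        rw [← hfg, Polynomial.map_map, Polynomial.map_map]
        congr 1
      rw [← h4, ← hS, ← Polynomial.map_mul] at hQ
      have h5 := aeval_sub_mem_span htG hQ (algebraMap B R x)
      rw [map_mul, aeval_map_algebraMap, hfb'] at h5
      have h6 : aeval (algebraMap B R x) S ∈ Ideal.span {algebraMap A R t} := by
        rw [← sub_add_cancel (aeval (algebraMap B R x) S)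
          (algebraMap A R t ^ 2 * algebraMap B R b * aeval (algebraMap B R x) Q)]
        refine add_mem h5 (Ideal.mem_span_singleton.mpr ⟨algebraMap A R t * algebraMap B R b *
          aeval (algebraMap B R x) Q, by ring⟩)
      refine le_antisymm (fun z hz => ?_) hspan
      have h7 := exists_eq_of_map_eq_zero htG hgen hρ hS ((residue_eq_zero_iff z).mpr hz)
      have h8 : Ideal.span {algebraMap A R t, aeval (algebraMap B R x) S} ≤
          Ideal.span {algebraMap A R t} := by
        rw [Ideal.span_insert, sup_le_iff, Ideal.span_singleton_le_iff_mem _ (x := aeval _ _)]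
        exact ⟨le_rfl, h6⟩
      exact h8 h7
    · left
      -- From `t ^ 2 b = f(x) = T(x) ^ p + t H(x)` and coprimality, `H(x) - t b` is a unit. Thus `t`
      -- is a unit times `T(x) ^ p` with `T(x)` in the maximal ideal, and `p ≥ 2`.
      obtain ⟨T, H, hTH, hTH'⟩ := hcop f hf (hfg ▸ hirr) (hfg ▸ hsep)
      have h1 := congrArg (aeval (algebraMap B R x)) hTH
      rw [aeval_map_algebraMap, hfb', map_add, map_pow, map_mul, aeval_C,
        ← IsScalarTower.algebraMap_apply] at h1
      have h2 : residue R (aeval (algebraMap B R x) H) ≠ 0 := by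
        rw [map_aeval_eq hρ]
        intro h0
        obtain ⟨u, v, huv⟩ := hTH'
        have h3 := congrArg (aeval (residue R (algebraMap B R x))) huv
        rw [hfg, map_add, map_mul, map_mul, h0, mul_zero, add_zero, map_one] at h3
        obtain ⟨q, hq⟩ := hd
        rw [hq, map_mul, minpoly.aeval, zero_mul, mul_zero] at h3
        exact zero_ne_one h3
      have h4 : residue R (aeval (algebraMap B R x) H - algebraMap A R t * algebraMap B R b) ≠ 0 := by
        rwa [map_sub, map_mul, (residue_eq_zero_iff _).mpr htR, zero_mul, sub_zero]
      rw [residue_ne_zero_iff_isUnit] at h4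
      obtain ⟨w, hw⟩ := h4.exists_left_inv
      have h5 : aeval (algebraMap B R x) T ∈ maximalIdeal R := by
        refine (maximalIdeal.isMaximal R).isPrime.mem_of_pow_mem p ?_
        rw [show aeval (algebraMap B R x) T ^ p = algebraMap A R t * (algebraMap A R t *
          algebraMap B R b - aeval (algebraMap B R x) H) by linear_combination -h1]
        exact Ideal.mul_mem_right _ _ htR
      have h6 : algebraMap A R t = -w * aeval (algebraMap B R x) T ^ p := by
        linear_combination (-algebraMap A R t) * hw - w * h1
      rw [h6]
      exact Ideal.mul_mem_left _ _ (Ideal.pow_le_pow_right (Fact.out : p.Prime).two_le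
        (Ideal.pow_mem_pow h5 p))
  · left
    obtain ⟨ϖ, hϖ⟩ := IsDiscreteValuationRing.exists_irreducible B
    have htB : algebraMap A B t ≠ 0 := fun h =>
      ht0 (FaithfulSMul.algebraMap_injective A B (h.trans (map_zero _).symm))
    obtain ⟨n, hn⟩ := IsDiscreteValuationRing.associated_pow_irreducible htB hϖ
    -- This is the ramified case: `t` is neither a unit nor a uniformizer of `B`.
    have hn2 : 2 ≤ n := by
      by_contra! h
      interval_cases n
      · have h1 : IsUnit (algebraMap A B t) := by simpa using hn.isUnit_iff.mpr (by simp)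
        have h2 := isUnit_of_map_unit (algebraMap A B) t h1
        refine (mem_nonunits_iff.mp ((mem_maximalIdeal t).mp ?_)) h2
        rw [htA]
        exact Ideal.mem_span_singleton_self _
      · refine hB ?_
        rw [hϖ.maximalIdeal_eq, Ideal.span_singleton_eq_span_singleton]
        simpa using hn.symm
    have hϖR : algebraMap B R ϖ ∈ maximalIdeal R := hsrad
      (map_mem_radical_span ht0 (hϖ.maximalIdeal_eq ▸ Ideal.mem_span_singleton_self _))
    obtain ⟨c, hc⟩ := (pow_dvd_pow ϖ hn2).trans hn.symm.dvd
    rw [IsScalarTower.algebraMap_apply A B R, hc, map_mul, map_pow]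
    exact Ideal.mul_mem_right _ _ (Ideal.pow_mem_pow hϖR 2)

include htG ht0 hrad in
theorem isDVR_of_adjoin_eq_top [IsNoetherianRing R]
    (hcop : ∀ f : A[X], f.Monic → Irreducible (f.map (residue A)) →
      ¬ (f.map (residue A)).Separable → ∃ T H : G[X],
        f.map (algebraMap A G) = T ^ p + C (algebraMap A G t) * H ∧
        IsCoprime ((f.map (residue A)).map (algebraMap (ResidueField A) (ResidueField G)))
          (H.map (residue G)))
    (htA : maximalIdeal A = Ideal.span {t})
    (hx : Algebra.adjoin A {x} = ⊤) (hgen : Algebra.adjoin G {algebraMap B R x} = ⊤)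
    (hreg : ∀ z : R, algebraMap A R t * z = 0 → z = 0) : IsDVR R := by
  have hρ : ∀ g, residue R (algebraMap G R g) = algebraMap _ (ResidueField R) (residue G g) :=
    fun g => (ResidueField.algebraMap_residue g).symm
  have htR : algebraMap A R t ∈ maximalIdeal R :=
    (span_le_ker htG hρ).trans ker_residue.le (Ideal.mem_span_singleton_self _)
  obtain ⟨S, hS⟩ := map_surjective (residue G) residue_surjective
    (minpoly (ResidueField G) (residue R (algebraMap B R x)))
  rcases mem_sq_or_maximalIdeal_eq htG ht0 hrad hcop htA hx hgen with h | h
  · refine isDVR_of_maximalIdeal_eq_span hreg htR (maximalIdeal_eq_span_of_mem_sq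
      (y := aeval (algebraMap B R x) S) (le_antisymm (fun z hz => ?_) ?_) h)
    · exact exists_eq_of_map_eq_zero htG hgen hρ hS ((residue_eq_zero_iff z).mpr hz)
    · rw [Ideal.span_insert, sup_le_iff, Ideal.span_singleton_le_iff_mem,
        Ideal.span_singleton_le_iff_mem, ← residue_eq_zero_iff (aeval (algebraMap B R x) S),
        map_aeval_eq hρ, hS, minpoly.aeval]
      exact ⟨htR, rfl⟩
  · exact isDVR_of_maximalIdeal_eq_span hreg htR h

end Fibre

/-! ### Separable residue degrees and the forward implication. -/

theorem sepResidueDegree_algebraMap {R : Type u} {S : Type v} [CommRing R] [CommRing S]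
    [IsLocalRing R] [IsLocalRing S] [Algebra R S] [IsLocalHom (algebraMap R S)]
    (h : IsDVRExtension (algebraMap R S)) :
    sepResidueDegree (algebraMap R S) h =
      Field.finSepDegree (ResidueField R) (ResidueField S) := by
  have : (ResidueField.map (algebraMap R S)).toAlgebra =
      (inferInstance : Algebra (ResidueField R) (ResidueField S)) :=
    Algebra.algebra_ext _ _ fun _ => rfl
  exact congrArg (fun i => @Field.finSepDegree (ResidueField R) (ResidueField S) _ _ i) this

theorem finSepDegree_eq_natSepDegree_of_adjoin_eq_top {F E : Type*} [Field F] [Field E]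
    [Algebra F E] {α : E} (hα : IsAlgebraic F α) (h : IntermediateField.adjoin F {α} = ⊤) :
    Field.finSepDegree F E = (minpoly F α).natSepDegree := by
  rw [← IntermediateField.finSepDegree_adjoin_simple_eq_natSepDegree F E hα, h]
  exact (Field.finSepDegree_eq_of_equiv _ _ _ IntermediateField.topEquiv).symm

open Polynomial in
theorem adjoin_residue_eq_top {R S : Type*} [CommRing R] [CommRing S]
    [IsLocalRing R] [IsLocalRing S] [Algebra R S] [IsLocalHom (algebraMap R S)] {x : S}
    (hx : Algebra.adjoin R {x} = ⊤) :
    IntermediateField.adjoin (ResidueField R) {residue S x} = ⊤ := by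
  rw [eq_top_iff]
  intro z _
  obtain ⟨y, rfl⟩ := residue_surjective z
  have hy : y ∈ Algebra.adjoin R {x} := hx ▸ Algebra.mem_top
  rw [Algebra.adjoin_singleton_eq_range_aeval] at hy
  obtain ⟨P, rfl⟩ := hy
  change residue S (aeval x P) ∈ _
  rw [map_aeval_eq_aeval_map (φ := residue R) (RingHom.ext fun a => ResidueField.algebraMap_residue a)]
  exact IntermediateField.algebra_adjoin_le_adjoin _ _ (aeval_mem_adjoin_singleton _ _)

section BaseChange

attribute [local instance] Algebra.TensorProduct.rightAlgebra

variable {A B G : Type*} [CommRing A] [CommRing B] [CommRing G] [Algebra A B] [Algebra A G]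

variable (A B G) in
/-- The commutativity of the tensor product, linear over the second factor. -/
noncomputable def tensorCommRight : G ⊗[A] B ≃ₐ[G] B ⊗[A] G :=
  AlgEquiv.ofRingEquiv (f := (Algebra.TensorProduct.comm A G B).toRingEquiv) fun g => by
    change Algebra.TensorProduct.comm A G B (g ⊗ₜ[A] 1) = 1 ⊗ₜ[A] g
    simp

theorem finite_tensorProduct_right [Module.Finite A B] : Module.Finite G (B ⊗[A] G) :=
  Module.Finite.equiv (tensorCommRight A B G).toLinearEquiv

theorem adjoin_tensorProduct_right {x : B} (hx : Algebra.adjoin A {x} = ⊤) :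
    Algebra.adjoin G {algebraMap B (B ⊗[A] G) x} = ⊤ := by
  rw [eq_top_iff]
  intro z _
  induction z using TensorProduct.induction_on with
  | zero => exact zero_mem _
  | add y z hy hz => exact add_mem (hy trivial) (hz trivial)
  | tmul b g =>
    have hb : b ∈ Algebra.adjoin A {x} := hx ▸ Algebra.mem_top
    rw [Algebra.adjoin_singleton_eq_range_aeval] at hb
    obtain ⟨P, rfl⟩ := hb
    have h1 : (Polynomial.aeval x P) ⊗ₜ[A] g = algebraMap G (B ⊗[A] G) g *
        algebraMap B (B ⊗[A] G) (Polynomial.aeval x P) := by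
      change _ = (1 ⊗ₜ[A] g) * ((Polynomial.aeval x P) ⊗ₜ[A] 1)
      rw [Algebra.TensorProduct.tmul_mul_tmul, one_mul, mul_one]
    change (Polynomial.aeval x P) ⊗ₜ[A] g ∈ _
    rw [h1, ← Polynomial.aeval_algebraMap_apply,
      ← Polynomial.aeval_map_algebraMap (A := G)]
    exact mul_mem (Subalgebra.algebraMap_mem _ _) (Polynomial.aeval_mem_adjoin_singleton _ _)

end BaseChange

section Generic

variable {p : ℕ} [Fact p.Prime] {A : Type u} [CommRing A] [IsDomain A] [IsDiscreteValuationRing A]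
  [CharP (ResidueField A) p] {G : Type u} [CommRing G] [Algebra A G]

theorem isLocalHom_of_irreducible [IsLocalRing G] {t : A} (ht : Irreducible t)
    (htG : maximalIdeal G = Ideal.span {algebraMap A G t}) : IsLocalHom (algebraMap A G) := by
  refine ⟨fun a ha => ?_⟩
  by_contra h
  have h1 : a ∈ maximalIdeal A := h
  rw [ht.maximalIdeal_eq, Ideal.mem_span_singleton] at h1
  have h2 : algebraMap A G a ∈ maximalIdeal G := by
    rw [htG, Ideal.mem_span_singleton]
    exact map_dvd _ h1
  exact h2 ha

attribute [local instance] Algebra.TensorProduct.rightAlgebra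

variable {B : Type v} [CommRing B] [IsDomain B] [IsDiscreteValuationRing B] [Algebra A B]
  [Module.Finite A B] [FaithfulSMul A B] [IsLocalHom (algebraMap A B)]

/-- The base change of a monogenic extension of discrete valuation rings to the generic residual
perfection. -/
theorem isDVRExtension_of_isMonogenic (hG : IsGenericResidualPerfection p A G)
    (h : IsMonogenic A B) (hB : IsDVRExtension (algebraMap A B)) :
    ∃ h' : IsDVRExtension (algebraMap G (B ⊗[A] G)),
      sepResidueDegree _ h' = sepResidueDegree (algebraMap A B) hB := by
  obtain ⟨x, hx⟩ := h
  obtain ⟨t, ht⟩ := IsDiscreteValuationRing.exists_irreducible A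
  obtain ⟨hdom, hdvr, htG'⟩ := hG.exists_isDiscreteValuationRing ht
  have htG : maximalIdeal G = Ideal.span {algebraMap A G t} := htG'.maximalIdeal_eq
  have hlG : IsLocalHom (algebraMap A G) := isLocalHom_of_irreducible ht htG
  have hext : extIdeal A G = maximalIdeal G := (extIdeal_eq_span ht.maximalIdeal_eq).trans htG.symm
  have hflat := hG.1.flat
  have hrad := fun r => hG.exists_pow_mem_range hext (r := r)
  have hfin : Module.Finite G (B ⊗[A] G) := finite_tensorProduct_right
  have hgen := adjoin_tensorProduct_right (G := G) hx
  have hinj : Function.Injective (algebraMap G (B ⊗[A] G)) :=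
    Algebra.TensorProduct.includeRight_injective (FaithfulSMul.algebraMap_injective A B)
  have hnt : Nontrivial (B ⊗[A] G) := hinj.nontrivial
  have hloc : IsLocalRing (B ⊗[A] G) := isLocalRing_of_adjoin_eq_top htG ht.ne_zero hrad hgen
  have hlGR : IsLocalHom (algebraMap G (B ⊗[A] G)) :=
    RingHom.IsIntegral.isLocalHom (algebraMap_isIntegral_iff.mpr inferInstance) hinj
  have hlAR : IsLocalHom (algebraMap A (B ⊗[A] G)) := by
    rw [IsScalarTower.algebraMap_eq A G]
    infer_instance
  have hnoeth : IsNoetherianRing (B ⊗[A] G) := IsNoetherianRing.of_finite G _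
  have hdvr' : IsDVR (B ⊗[A] G) := isDVR_of_adjoin_eq_top htG ht.ne_zero hrad
    (fun f hf hirr hsep => hG.exists_isCoprime hext ht hf hirr hsep) ht.maximalIdeal_eq hx hgen
    fun z hz => algebraMap_mul_cancel ht.ne_zero (hz.trans (mul_zero _).symm)
  refine ⟨⟨⟨hdom, hdvr⟩, hdvr', hinj, hlGR⟩, ?_⟩
  rw [sepResidueDegree_algebraMap, sepResidueDegree_algebraMap]
  have hρ : ∀ g, residue (B ⊗[A] G) (algebraMap G (B ⊗[A] G) g) =
      algebraMap _ (ResidueField (B ⊗[A] G)) (residue G g) :=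
    fun g => (ResidueField.algebraMap_residue g).symm
  have hint : IsIntegral (ResidueField A) (residue B x) :=
    (Algebra.IsIntegral.isIntegral (R := A) x).map_of_comp_eq (residue A) (residue B)
      (RingHom.ext fun a => ResidueField.algebraMap_residue a)
  have hint' : IsIntegral (ResidueField G) (residue (B ⊗[A] G) (algebraMap B _ x)) :=
    (Algebra.IsIntegral.isIntegral (R := G) (algebraMap B (B ⊗[A] G) x)).map_of_comp_eq (residue G)
      (residue _) (RingHom.ext fun a => ResidueField.algebraMap_residue a)
  rw [finSepDegree_eq_natSepDegree_of_adjoin_eq_top hint.isAlgebraic (adjoin_residue_eq_top hx),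
    finSepDegree_eq_natSepDegree_of_adjoin_eq_top hint'.isAlgebraic (adjoin_residue_eq_top hgen)]
  obtain ⟨N, hN, hd⟩ := minpoly_dvd_pow (x := x) htG ht.ne_zero hrad hρ
  exact natSepDegree_eq_of_dvd_pow (minpoly.ne_zero hint) (minpoly.ne_zero hint')
    (minpoly_dvd_map (x := x) htG ht.ne_zero hρ) hN hd

end Generic

/-! ### Monogenicity under separable residue extensions. -/

section Separable

open Polynomial

theorem exists_mem_pow_dvd_sub {A B : Type*} [CommRing A] [CommRing B] [Algebra A B]
    {N : Subalgebra A B} {y : B} (hy : y ∈ N)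
    (hN : ∀ b, ∃ c ∈ N, y ∣ b - c) (n : ℕ) (b : B) : ∃ c ∈ N, y ^ n ∣ b - c := by
  induction n with
  | zero => exact ⟨0, zero_mem _, by simp⟩
  | succ n ih =>
    obtain ⟨c, hc, d, hd⟩ := ih
    obtain ⟨c', hc', d', hd'⟩ := hN d
    refine ⟨c + y ^ n * c', add_mem hc (mul_mem (pow_mem hy _) hc'), d', ?_⟩
    rw [pow_succ]
    linear_combination hd + y ^ n * hd'

variable {A B : Type*} [CommRing A] [IsDomain A] [IsDiscreteValuationRing A] [CommRing B]
  [IsDomain B] [IsDiscreteValuationRing B] [Algebra A B] [IsLocalHom (algebraMap A B)]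
  [Module.Finite A B]

omit [IsDomain A] [IsDiscreteValuationRing A] [Module.Finite A B] in
/-- A uniformizer that is a value of a lift of the minimal polynomial of a generator of the residue
field extension. -/
theorem exists_irreducible_aeval [IsLocalRing A] {α : ResidueField B}
    (hα : IsSeparable (ResidueField A) α) :
    ∃ (y : B) (g : A[X]), residue B y = α ∧ Irreducible (aeval y g) := by
  obtain ⟨g, hg, hgm⟩ := exists_monic_lift (minpoly.monic hα.isIntegral)
  have hcomm : (algebraMap (ResidueField A) (ResidueField B)).comp (residue A) =
      (residue B).comp (algebraMap A B) :=
    RingHom.ext fun a => ResidueField.algebraMap_residue a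
  have hroot : ∀ y : B, residue B y = α → aeval y g ∈ maximalIdeal B := by
    intro y hy
    rw [← residue_eq_zero_iff, map_aeval_eq_aeval_map hcomm, hg, hy, minpoly.aeval]
  obtain ⟨ϖ, hϖ⟩ := IsDiscreteValuationRing.exists_irreducible B
  have hirr : ∀ z : B, z ∈ maximalIdeal B → ¬ ϖ ^ 2 ∣ z → Irreducible z := by
    intro z hz hz'
    rw [hϖ.maximalIdeal_eq, Ideal.mem_span_singleton] at hz
    obtain ⟨c, rfl⟩ := hz
    have hc : IsUnit c := by
      by_contra h
      have h1 : c ∈ maximalIdeal B := h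
      rw [hϖ.maximalIdeal_eq, Ideal.mem_span_singleton] at h1
      exact hz' (by rw [sq]; exact mul_dvd_mul_left _ h1)
    exact (irreducible_mul_isUnit hc).mpr hϖ
  obtain ⟨y, hy⟩ := residue_surjective α
  by_cases h : ϖ ^ 2 ∣ aeval y g
  · have hϖ0 : residue B ϖ = 0 :=
      (residue_eq_zero_iff _).mpr (hϖ.maximalIdeal_eq ▸ Ideal.mem_span_singleton_self _)
    have hy' : residue B (y + ϖ) = α := by rw [map_add, hϖ0, add_zero, hy]
    refine ⟨y + ϖ, g, hy', hirr _ (hroot _ hy') fun h' => ?_⟩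
    -- By Taylor expansion, if `ϖ ^ 2` divided both `g(y)` and `g(y + ϖ)`, then `g'(y)` would vanish
    -- in the residue field, against the separability of `α`.
    obtain ⟨k, hk⟩ := (g.map (algebraMap A B)).binomExpansion y ϖ
    rw [eval_map_algebraMap, eval_map_algebraMap, derivative_map, eval_map_algebraMap] at hk
    have h1 : ϖ ^ 2 ∣ aeval y (derivative g) * ϖ := by
      have : aeval y (derivative g) * ϖ = aeval (y + ϖ) g - aeval y g - k * ϖ ^ 2 := by
        rw [hk]; ring
      rw [this]
      exact dvd_sub (dvd_sub h' h) (dvd_mul_left _ _)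
    rw [sq] at h1
    have h2 : ϖ ∣ aeval y (derivative g) := (mul_dvd_mul_iff_right hϖ.ne_zero).mp h1
    have h3 : residue B (aeval y (derivative g)) = 0 := by
      obtain ⟨c, hc⟩ := h2
      rw [hc, map_mul, hϖ0, zero_mul]
    rw [map_aeval_eq_aeval_map hcomm, ← derivative_map, hg, hy] at h3
    exact hα.aeval_derivative_ne_zero (minpoly.aeval _ _) h3
  · exact ⟨y, g, hy, hirr _ (hroot y hy) h⟩

/-- A finite extension of discrete valuation rings with separable residue field extension is
monogenic. -/
theorem isMonogenic_of_isSeparable [FaithfulSMul A B]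
    [Algebra.IsSeparable (ResidueField A) (ResidueField B)] :
    IsMonogenic A B := by
  obtain ⟨α, hα⟩ := Field.exists_primitive_element (ResidueField A) (ResidueField B)
  obtain ⟨y, g, hy, hg⟩ := exists_irreducible_aeval
    (Algebra.IsSeparable.isSeparable (ResidueField A) α)
  refine ⟨y, ?_⟩
  have hN : ∀ b, ∃ c ∈ Algebra.adjoin A {y}, aeval y g ∣ b - c := by
    intro b
    have h1 : residue B b ∈ IntermediateField.adjoin (ResidueField A) {α} := hα ▸ trivial
    rw [← IntermediateField.mem_toSubalgebra,
      IntermediateField.adjoin_simple_toSubalgebra_of_isAlgebraic (Algebra.IsAlgebraic.isAlgebraic α),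
      Algebra.adjoin_singleton_eq_range_aeval] at h1
    obtain ⟨P, hP⟩ := h1
    obtain ⟨P, rfl⟩ := map_surjective (residue A) residue_surjective P
    refine ⟨aeval y P, aeval_mem_adjoin_singleton _ _, ?_⟩
    rw [← Ideal.mem_span_singleton, ← hg.maximalIdeal_eq, ← residue_eq_zero_iff, map_sub, ← hP, ← hy,
      map_aeval_eq_aeval_map (φ := residue A)
        (RingHom.ext fun a => ResidueField.algebraMap_residue a)]
    exact sub_self _
  obtain ⟨t, ht⟩ := IsDiscreteValuationRing.exists_irreducible A
  have htB : algebraMap A B t ≠ 0 := fun h =>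
    ht.ne_zero (FaithfulSMul.algebraMap_injective A B (h.trans (map_zero _).symm))
  obtain ⟨n, hn⟩ := IsDiscreteValuationRing.associated_pow_irreducible htB hg
  -- Every element of `B` is approximated in `A[y]` modulo `g(y) ^ n`, an associate of `t`. So `B =
  -- A[y] + t B`, and Nakayama applies.
  have htop : (⊤ : Submodule A B) ≤ Subalgebra.toSubmodule (Algebra.adjoin A {y}) := by
    refine Submodule.le_of_le_smul_of_le_jacobson_bot (I := maximalIdeal A) Module.Finite.fg_top
      (maximalIdeal_le_jacobson _) fun b _ => ?_
    obtain ⟨c, hc, hd⟩ := exists_mem_pow_dvd_sub (aeval_mem_adjoin_singleton A y) hN n b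
    obtain ⟨d, hd⟩ := hn.dvd.trans hd
    rw [← add_sub_cancel c b]
    refine Submodule.add_mem_sup hc ?_
    rw [hd, ← Algebra.smul_def]
    exact Submodule.smul_mem_smul (ht.maximalIdeal_eq ▸ Ideal.mem_span_singleton_self _) trivial
  exact top_le_iff.mp fun b hb => htop hb

end Separable

/-! ### The generic generator and its determinant. -/

section PowerCoordinates

variable {A B G R κ : Type*} [CommRing A] [CommRing B] [Algebra A B] [Fintype κ]
  [CommRing G] [Algebra A G] [CommRing R] [Algebra A R] [Algebra B R] [Algebra G R]
  [IsScalarTower A B R] [IsScalarTower A G R]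

/-- The coordinates of the powers of a generic element with respect to a basis. -/
noncomputable def powerCoordinate (b : Module.Basis κ A B) : ℕ → κ → MvPolynomial κ A
  | 0, i => MvPolynomial.C (b.repr 1 i)
  | j + 1, i => ∑ l, ∑ m,
      MvPolynomial.C (b.repr (b l * b m) i) * powerCoordinate b j l * MvPolynomial.X m

/-- The structure constants come from `A`, so the same polynomials compute powers after base change.
-/
theorem sum_smul_pow_eq (b : Module.Basis κ A B) (y : κ → G) (j : ℕ) :
    (∑ i, y i • algebraMap B R (b i)) ^ j =
      ∑ i, MvPolynomial.aeval y (powerCoordinate b j i) • algebraMap B R (b i) := by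
  have hrepr : ∀ z : B, algebraMap B R z = ∑ i, algebraMap A G (b.repr z i) • algebraMap B R (b i) := by
    intro z
    conv_lhs => rw [← b.sum_repr z, map_sum]
    refine Finset.sum_congr rfl fun i _ => ?_
    rw [Algebra.smul_def, map_mul, ← IsScalarTower.algebraMap_apply, Algebra.smul_def,
      ← IsScalarTower.algebraMap_apply]
  induction j with
  | zero => simp only [pow_zero, powerCoordinate, MvPolynomial.aeval_C]; rw [← hrepr, map_one]
  | succ j ih =>
    rw [pow_succ, ih, Finset.sum_mul_sum]
    simp only [powerCoordinate, map_sum, map_mul, MvPolynomial.aeval_C, MvPolynomial.aeval_X,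
      Finset.sum_smul]
    symm
    rw [Finset.sum_comm]
    refine Finset.sum_congr rfl fun l _ => ?_
    rw [Finset.sum_comm]
    refine Finset.sum_congr rfl fun m _ => ?_
    rw [smul_mul_smul_comm, ← map_mul (algebraMap B R), hrepr (b l * b m), Finset.smul_sum]
    refine Finset.sum_congr rfl fun i _ => ?_
    rw [smul_smul]
    congr 1
    ring

variable [DecidableEq κ]

/-- The determinant of the coordinates of the first powers of a generic element. -/
noncomputable def powerDet (b : Module.Basis κ A B) (e : κ → ℕ) : MvPolynomial κ A :=
  (Matrix.of fun i j => powerCoordinate b (e j) i).det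

theorem aeval_powerDet (b : Module.Basis κ A B) (e : κ → ℕ) (y : κ → G) :
    MvPolynomial.aeval y (powerDet b e) =
      (Matrix.of fun i j => MvPolynomial.aeval y (powerCoordinate b (e j) i)).det := by
  rw [powerDet, AlgHom.map_det]
  rfl

theorem adjoin_eq_top_of_isUnit_powerDet (b : Module.Basis κ A B) (e : κ → ℕ) (c : κ → A)
    (h : IsUnit (MvPolynomial.aeval c (powerDet b e))) :
    Algebra.adjoin A {∑ i, c i • b i} = ⊤ := by
  rw [aeval_powerDet] at h
  set M : Matrix κ κ A := Matrix.of fun i j => MvPolynomial.aeval c (powerCoordinate b (e j) i)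
    with hM
  have hMN : M * M⁻¹ = 1 := Matrix.mul_nonsing_inv _ h
  have hb : ∀ l, b l ∈ Algebra.adjoin A {∑ i, c i • b i} := by
    intro l
    have : b l = ∑ j, M⁻¹ j l • (∑ i, c i • b i) ^ e j := by
      have h1 : ∀ j, (∑ i, c i • b i) ^ e j = ∑ i, M i j • b i := fun j =>
        sum_smul_pow_eq (G := A) (R := B) b c (e j)
      simp only [h1, Finset.smul_sum, smul_smul]
      rw [Finset.sum_comm]
      have h2 : ∀ i, ∑ j, (M⁻¹ j l * M i j) • b i = (1 : Matrix κ κ A) i l • b i := by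
        intro i
        rw [← Finset.sum_smul, ← hMN, Matrix.mul_apply]
        simp only [mul_comm]
      simp only [h2, Matrix.one_apply, ite_smul, one_smul, zero_smul]
      simp
    rw [this]
    exact sum_mem fun j _ => Subalgebra.smul_mem _ (pow_mem (Algebra.self_mem_adjoin_singleton _ _) _) _
  rw [eq_top_iff]
  intro z _
  rw [← b.sum_repr z]
  exact sum_mem fun i _ => Subalgebra.smul_mem _ (hb i) _

open Polynomial in
-- By Cayley-Hamilton a monic polynomial of degree the rank kills `y`, so the powers of `y` below
-- the rank span `R`. Expressing the basis through them gives a right inverse of the coordinate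
-- matrix.
theorem isUnit_powerDet_of_adjoin_eq_top [Nontrivial G] (b : Module.Basis κ A B)
    (b' : Module.Basis κ G R)
    (hb : ∀ i, b' i = algebraMap B R (b i)) (e : κ ≃ Fin (Fintype.card κ)) {y : R}
    (hy : Algebra.adjoin G {y} = ⊤) :
    IsUnit (MvPolynomial.aeval (fun i => b'.repr y i) (powerDet b fun j => e j)) := by
  have hfree : Module.Free G R := Module.Free.of_basis b'
  have hfin : Module.Finite G R := Module.Finite.of_basis b'
  obtain ⟨f, hf, hdeg, hfy⟩ : ∃ f : G[X], f.Monic ∧ f.natDegree = Fintype.card κ ∧ aeval y f = 0 := by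
    refine ⟨(Algebra.lmul G R y).charpoly, LinearMap.charpoly_monic _, ?_, ?_⟩
    · rw [LinearMap.charpoly_natDegree, Module.finrank_eq_card_basis b']
    · have h1 := LinearMap.aeval_self_charpoly (Algebra.lmul G R y)
      rw [aeval_algHom_apply] at h1
      simpa using congrArg (fun φ : Module.End G R => φ 1) h1
  have hspan : ∀ z : R, ∃ N : κ → G, z = ∑ j, N j • y ^ (e j : ℕ) := by
    intro z
    have hz : z ∈ Algebra.adjoin G {y} := hy ▸ Algebra.mem_top
    rw [Algebra.adjoin_singleton_eq_range_aeval] at hz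
    obtain ⟨P, rfl⟩ := hz
    have h1 : aeval y (P %ₘ f) = aeval y P := by
      conv_rhs => rw [← modByMonic_add_div P f]
      rw [map_add, map_mul, hfy, zero_mul, add_zero]
    have h2 : (P %ₘ f).degree < Fintype.card κ := by
      rw [← hdeg, ← degree_eq_natDegree hf.ne_zero]
      exact degree_modByMonic_lt P hf
    refine ⟨fun j => (P %ₘ f).coeff (e j), ?_⟩
    change aeval y P = _
    rw [← h1]
    by_cases h0 : P %ₘ f = 0
    · simp [h0]
    · rw [aeval_eq_sum_range' ((natDegree_lt_iff_degree_lt h0).mpr h2) y, Finset.sum_range,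
        ← e.sum_comp]
  choose N hN using fun l => hspan (b' l)
  rw [aeval_powerDet]
  refine Matrix.isUnit_det_of_right_inverse (B := Matrix.of fun j l => N l j) ?_
  have hpow : ∀ j, b'.repr (y ^ j) = fun i =>
      MvPolynomial.aeval (fun i => b'.repr y i) (powerCoordinate b j i) := by
    intro j
    have h1 := sum_smul_pow_eq (R := R) b (fun i => b'.repr y i) j
    simp only [← hb, b'.sum_repr] at h1
    rw [h1]
    ext i
    rw [b'.repr_sum_self]
  ext i l
  have h1 := congrArg (fun z => b'.repr z i) (hN l)
  simp only [map_sum, map_smul, Finsupp.coe_finsetSum, Finset.sum_apply, Finsupp.smul_apply, hpow,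
    smul_eq_mul] at h1
  rw [Matrix.mul_apply]
  simp only [Matrix.of_apply]
  rw [Matrix.one_apply, Finset.sum_congr rfl fun j _ => mul_comm _ _, ← h1, b'.repr_self,
    Finsupp.single_apply]
  simp only [eq_comm]

end PowerCoordinates

section Density

variable {A B G R κ : Type*} [CommRing A] [IsLocalRing A] [CommRing B] [Algebra A B]
  [CommRing G] [IsLocalRing G] [Algebra A G] [IsLocalHom (algebraMap A G)] [CommRing R] [Algebra A R]
  [Algebra B R] [Algebra G R] [IsScalarTower A B R] [IsScalarTower A G R]

/-- Generating elements are dense: over an infinite residue field, an algebra is monogenic as soon as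
a base change is. -/
theorem isMonogenic_of_baseChange [Infinite (ResidueField A)] [Fintype κ] (b : Module.Basis κ A B)
    (b' : Module.Basis κ G R) (hb : ∀ i, b' i = algebraMap B R (b i)) (h : IsMonogenic G R) :
    IsMonogenic A B := by
  classical
  obtain ⟨y, hy⟩ := h
  let e := Fintype.equivFin κ
  have h1 := isUnit_powerDet_of_adjoin_eq_top b b' hb e hy
  have h2 : MvPolynomial.map (residue A) (powerDet b fun j => (e j : ℕ)) ≠ 0 := by
    intro h0
    refine ((residue_ne_zero_iff_isUnit _).mpr h1) ?_
    have h3 : ∀ P : MvPolynomial κ A, residue G (MvPolynomial.aeval (fun i => b'.repr y i) P) =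
        MvPolynomial.aeval (fun i => residue G (b'.repr y i))
          (MvPolynomial.map (residue A) P) := by
      intro P
      induction P using MvPolynomial.induction_on with
      | C a => simp [ResidueField.algebraMap_residue]
      | add P Q hP hQ => simp only [map_add, hP, hQ]
      | mul_X P i hP => simp only [map_mul, hP, MvPolynomial.aeval_X, MvPolynomial.map_X]
    rw [h3, h0, map_zero]
  -- The reduced determinant is a nonzero polynomial over an infinite field, so it has a nonzero
  -- value. Any lift of such a point gives a generator.
  obtain ⟨c, hc⟩ : ∃ c : κ → ResidueField A,
      MvPolynomial.eval c (MvPolynomial.map (residue A) (powerDet b fun j => (e j : ℕ))) ≠ 0 := by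
    by_contra! hcon
    exact h2 (MvPolynomial.funext fun c => by rw [hcon, map_zero])
  choose d hd using fun i => residue_surjective (c i)
  refine ⟨_, adjoin_eq_top_of_isUnit_powerDet b (fun j => (e j : ℕ)) d ?_⟩
  rw [← residue_ne_zero_iff_isUnit]
  refine fun h0 => hc ?_
  rw [← h0, MvPolynomial.eval_map, ← funext hd]
  exact (MvPolynomial.hom_eval₂ _ (algebraMap A A) (residue A) d).symm

end Density

/-! ### The converse and the theorem. -/

section Generic

variable {p : ℕ} [Fact p.Prime] {A : Type u} [CommRing A] [IsDomain A] [IsDiscreteValuationRing A]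
  [CharP (ResidueField A) p] {G : Type u} [CommRing G] [Algebra A G]

theorem IsCompleteResidualPerfection.perfectField [IsLocalRing G] [IsLocalHom (algebraMap A G)]
    (hG : IsCompleteResidualPerfection p A G) (hext : extIdeal A G = maximalIdeal G) :
    PerfectField (ResidueField G) := by
  have hchar : CharP (ResidueField G) p :=
    charP_of_injective_algebraMap (algebraMap (ResidueField A) (ResidueField G)).injective p
  have hperf : PerfectRing (ResidueField G) p := by
    refine PerfectRing.ofSurjective _ _ fun r => ?_
    obtain ⟨g, rfl⟩ := residue_surjective r
    obtain ⟨q, hq⟩ := hG.perfect.2 (Ideal.Quotient.mk _ g)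
    obtain ⟨q, rfl⟩ := Ideal.Quotient.mk_surjective q
    refine ⟨residue G q, ?_⟩
    rw [frobenius_def, ← map_pow, ← sub_eq_zero, ← map_sub, residue_eq_zero_iff, ← hext,
      ← Ideal.Quotient.eq_zero_iff_mem, map_sub, map_pow]
    exact sub_eq_zero.mpr hq
  exact PerfectRing.toPerfectField _ p

attribute [local instance] Algebra.TensorProduct.rightAlgebra

variable {B : Type v} [CommRing B] [IsDomain B] [IsDiscreteValuationRing B] [Algebra A B]
  [Module.Finite A B] [FaithfulSMul A B] [IsLocalHom (algebraMap A B)]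

theorem isMonogenic_of_isDVR (hG : IsGenericResidualPerfection p A G)
    (hR : IsDVR (B ⊗[A] G)) : IsMonogenic A B := by
  obtain ⟨hRd, hRdvr⟩ := hR
  obtain ⟨t, ht⟩ := IsDiscreteValuationRing.exists_irreducible A
  obtain ⟨hdom, hdvr, htG'⟩ := hG.exists_isDiscreteValuationRing ht
  have htG : maximalIdeal G = Ideal.span {algebraMap A G t} := htG'.maximalIdeal_eq
  have hlG : IsLocalHom (algebraMap A G) := isLocalHom_of_irreducible ht htG
  have hext : extIdeal A G = maximalIdeal G := (extIdeal_eq_span ht.maximalIdeal_eq).trans htG.symm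
  rcases finite_or_infinite (ResidueField A) with hfin | hinf
  -- A finite residue field is perfect, so the residue extension of `B` is separable.
  · exact isMonogenic_of_isSeparable
  · have hflat := hG.1.flat
    have hperf := hG.1.perfectField hext
    have hfin : Module.Finite G (B ⊗[A] G) := finite_tensorProduct_right
    have hinj : Function.Injective (algebraMap G (B ⊗[A] G)) :=
      Algebra.TensorProduct.includeRight_injective (FaithfulSMul.algebraMap_injective A B)
    have hfaith : FaithfulSMul G (B ⊗[A] G) := (faithfulSMul_iff_algebraMap_injective _ _).mpr hinj
    have hlGR : IsLocalHom (algebraMap G (B ⊗[A] G)) :=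
      RingHom.IsIntegral.isLocalHom (algebraMap_isIntegral_iff.mpr inferInstance) hinj
    let b := Module.Free.chooseBasis A B
    -- The residue field of `G` is perfect, which makes `B ⊗ G` monogenic over `G`. A basis of `B`
    -- over `A` transports this to `B`.
    refine isMonogenic_of_baseChange b
      ((b.baseChange G).map (tensorCommRight A B G).toLinearEquiv) (fun i => ?_)
      (isMonogenic_of_isSeparable (A := G) (B := B ⊗[A] G))
    rw [Module.Basis.map_apply, Module.Basis.baseChange_apply]
    rfl

end Generic

theorem mainTheorem7 {p : ℕ} [Fact p.Prime]
    {A : Type u} [CommRing A] [IsDomain A] [IsDiscreteValuationRing A] [CharP (ResidueField A) p]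
    {B : Type v} [CommRing B] [Algebra A B] (hB : IsDVRExtension (algebraMap A B))
    [Module.Finite A B]
    {K : Type*} [Field K] [Algebra A K] [IsFractionRing A K]
    {L : Type*} [Field L] [Algebra B L] [IsFractionRing B L]
    [Algebra K L] [Algebra A L] [IsScalarTower A K L] [IsScalarTower A B L]
    [Algebra.IsSeparable K L]
    {Ag : Type u} [CommRing Ag] [Algebra A Ag] (hAg : IsGenericResidualPerfection p A Ag) :
    (IsMonogenic A B ↔ IsDVR (B ⊗[A] Ag)) ∧
    (IsMonogenic A B →
      ∃ h : IsDVRExtension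
          (Algebra.TensorProduct.includeRight : Ag →ₐ[A] B ⊗[A] Ag).toRingHom,
        sepResidueDegree _ h = sepResidueDegree (algebraMap A B) hB) := by
  obtain ⟨_, _⟩ := hB.target
  have hloc : IsLocalHom (algebraMap A B) := hB.isLocalHom
  have hfaith : FaithfulSMul A B := (faithfulSMul_iff_algebraMap_injective _ _).mpr hB.injective
  refine ⟨⟨fun h => ?_, isMonogenic_of_isDVR hAg⟩,
    fun h => isDVRExtension_of_isMonogenic hAg h hB⟩
  obtain ⟨h', -⟩ := isDVRExtension_of_isMonogenic hAg h hB
  exact h'.target
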